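/- **Setting.** For $\omega\neq 0$ and a smooth curve $\alpha=(x,y):\mathbb R\to\mathbb R^2$ parametrized by arc length, let $$\phi(s,t)=\big(x(s)\cos\omega t+y(s)\sin\omega t,\;-x(s)\sin\omega t+y(s)\cos\omega t,\;t\big),$$ with Gauss map $\nu=\phi_s\times\phi_t/|\phi_s\times\phi_t|$ and mean curvature $H$ (half the trace of the second fundamental form $\langle d^2\phi,\nu\rangle$). For $a\neq0$ we call $\alpha$ (or $\phi$) a *helicoidal rotating drop* (with $\Lambda_0=1$) if $2H=1-\frac a2R^2$, where $R$ is the distance to the $z$-axis. The TreadmillSled of $\alpha$ is $TS(\alpha)=(\xi_1,\xi_2)=(xx'+yy',\,xy'-yx')$. Let $$G(\xi_1,\xi_2)=\frac{2\xi_2}{\sqrt{1+\omega^2\xi_1^2}}+(\xi_1^2+\xi_2^2)-\frac a4(\xi_1^2+\xi_2^2)^2 .$$ The point $(a,C,\omega)$ *represents* the drop $\alpha$ if $TS(\alpha)\subset\{G=C\}$. Profile curves are counted up to rotations about the origin and shifts of $s$. Let $$q(r,a,C)=-16C^2+64r+32Cr-16r^2-8aCr^2+8ar^3-a^2r^4,$$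 $$\rho(r)=\left(\frac{\sqrt{q(r,a,C)}}{\sqrt{64+(4C+r(-4+ar))^2\omega^2}},\ \frac{(4C+r(-4+ar))\sqrt{1+r\omega^2}}{\sqrt{64+(4C+r(-4+ar))^2\omega^2}}\right),$$ $$\Delta\tilde\theta(x_1,x_2)=\int_{x_1}^{x_2}\frac{(4C+ar^2-4r)\sqrt{1+r\omega^2}}{r\sqrt{q(r,a,C)}}\,dr .$$ "$TS(\alpha)$ is parametrized by $\rho$ on $I$" means that the image of $TS(\alpha)$ is $\rho(I)$ together with its mirror image in the $\xi_2$-axis. A *fundamental piece* is an arc $\alpha|_{[s_0,s_1]}$, $s_0<s_1$, whose TreadmillSled runs exactly once around a closed curve that is a connected component of $\{G=C\}$; its length is $s_1-s_0<\infty$. A drop is *properly immersed* if the immersion induced by $\phi$ on $\mathbb R^2$ modulo the translations $v$ with $\phi(\cdot+v)=\phi$ is a proper map. It is *circular* if its image is a round cylinder about the $z$-axis. We say that $\alpha$ *spirals to* the circle of radius $R>0$ about the origin if $\alpha$ does not meet this circle, the set of limit points of $\alpha(s)$ as $s\to+\infty$, and also as $s\to-\infty$, is exactly this circle, and both ends of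 $\alpha$ have infinite winding number with respect to every point interior to it. The drop is *of exceptional type* if $\alpha$ spirals to some such circle. Let $h(R)=2(R-1)/R^3$. For $a\ne0$ let $R_1(a)<1$ be the solution of $h(R)=a$; for $0<a<\frac8{27}$ let $R_2(a)\in(1,\frac32)$ and $R_3(a)\in(\frac32,\infty)$ be the solutions of $h(R)=a$. Put $r_i=R_i^2$ and $C_i=\dfrac{16-8r_i+6ar_i^2-a^2r_i^3}{4(-2+ar_i)}$. Define sets of triples $(a,C,\omega)$ with $\omega>0$: $\Omega_1=\{C>C_1(a),\,a<0\}$, $\Omega_2=\{C_2(a)<C<C_3(a),\,0<a<\frac8{27}\}$, $\Omega_3=\{C<C_1(a),\,a>0\}$, $\Omega=(\Omega_1\cup\Omega_3)\setminus\Omega_2$, $\beta_1=\{C=C_1(a),\,a\ne0\}$, $\beta_2=\{C=C_2(a),\,0<a<\frac8{27}\}$, $\beta_3=\{C=C_3(a),\,0<a<\frac8{27}\}$. **Theorem.** (i) For $(a,C,\omega)$ in the interior of $\Omega$, $q$ has exactly two real roots $x_1<x_2$. The point represents exactly one drop; it has a fundamental piece of finite length, and its TreadmillSled is parametrized by $\rho$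 on $[x_1,x_2]$. (ii) For $(a,C,\omega)\in\Omega_2$, $q$ has exactly four real roots $x_1<x_2<x_3<x_4$. The point represents exactly two drops, both with fundamental pieces of finite length; their TreadmillSleds are parametrized by $\rho$ on $[x_1,x_2]$ and on $[x_3,x_4]$ respectively. (iii) Every point of $\beta_1$ represents exactly one drop, the round cylinder of radius $|R_1(a)|$, which is the same for all $\omega$. (iv) For $(a,C,\omega)\in\beta_2$, $q$ has exactly three real roots $x_1<x_2<x_3$, where $x_1=r_2(a)$ has multiplicity two. The point represents exactly two drops: the round cylinder of radius $R_2(a)$, the same for all $\omega$, and a non-circular drop with a fundamental piece of finite length and TreadmillSled parametrized by $\rho$ on $[x_2,x_3]$. (v) For $(a,C,\omega)\in\beta_3$, $q$ has exactly three real roots $x_1<x_2<x_3$, where $x_2=r_3(a)$ has multiplicity two. The point represents exactly three drops: the round cylinder of radius $R_3(a)$, the same for all $\omega$, and two drops whose TreadmillSleds are parametrized by $\rho$ on $[x_1,x_2)$ and on $(x_2,x_3]$. The last two are not properly immersed, and their profile curves spiral to the circle of radius $\sqrt{x_2}=R_3(a)$ (so they are of exceptional type). (vi) For $(a,C,\omega)=(\frac8{27},-\frac98,\omega)$,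 $\omega>0$, the real roots of $q$ are $\frac94$ (of multiplicity three) and $\frac{81}4$. The point represents exactly two drops: the round cylinder of radius $\frac32$, and a drop whose TreadmillSled is parametrized by $\rho$ on $(\frac94,\frac{81}4]$, which is not properly immersed and spirals to the circle of radius $\frac32$ (so it is of exceptional type). (vii) Let $a\neq0$ and $\omega\ne0$. Every helicoidal drop agrees, up to a rigid motion of $\mathbb R^3$ and a reparametrization, with a drop represented by a point of one of the cases (i)–(vi). (viii) Let $a\neq 0$, $\omega\ne0$, and let $\alpha$ be a drop in the level set $\{G=C\}$ that is not of exceptional type. Either it is circular and properly immersed, or there are roots $0\le x_1<x_2$ of $q$, with $q>0$ on $(x_1,x_2)$, such that $TS(\alpha)$ is parametrized by $\rho$ on $[x_1,x_2]$, the integral $\Delta\tilde\theta=\Delta\tilde\theta(x_1,x_2)$ converges absolutely, and the following holds. Let $\delta=\Delta\tilde\theta$ if $x_1>0$, and $\delta=\Delta\tilde\theta+\pi$ if $x_1=0$ (the case in which the profile curve passes through the axis). Then $\alpha$ has a fundamental piece, of finite length $T$, with $\alpha(s+T)=\mathrm{Rot}_\delta\,\alpha(s)$ for all $s$. If $\Delta\tilde\theta/\pi$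 is rational, then the drop is properly immersed and, writing $\delta=2\pi k/m$ with coprime integers $k$ and $m>0$, invariant under the cyclic group of order $m$ generated by the rotation by $2\pi/m$ about the $z$-axis. If $\Delta\tilde\theta/\pi$ is irrational, then the drop is not properly immersed, and the closure of its image is the region $\{x_1\le x^2+y^2\le x_2\}$ between two coaxial round cylinders (a solid cylinder if $x_1=0$). -/

import Mathlib

open Filter Topology Set

noncomputable section

namespace HelicoidalDrop

/-- The Euclidean plane. -/
abbrev E2 := EuclideanSpace ℝ (Fin 2)

/-- Euclidean three-space. -/
abbrev E3 := EuclideanSpace ℝ (Fin 3)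

/-! ### Differential geometry of a parametrized surface -/

/-- Partial derivative in the first parameter. -/
def dS (X : ℝ × ℝ → E3) (p : ℝ × ℝ) : E3 := deriv (fun s => X (s, p.2)) p.1

/-- Partial derivative in the second parameter. -/
def dT (X : ℝ × ℝ → E3) (p : ℝ × ℝ) : E3 := deriv (fun t => X (p.1, t)) p.2

/-- The cross product `X_s × X_t`. -/
def normalVec (X : ℝ × ℝ → E3) (p : ℝ × ℝ) : E3 :=
  WithLp.toLp 2 (crossProduct (dS X p).ofLp (dT X p).ofLp)

/-- The Gauss map `ν = (X_s × X_t) / |X_s × X_t|`. -/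
def gaussMap (X : ℝ × ℝ → E3) (p : ℝ × ℝ) : E3 := ‖normalVec X p‖⁻¹ • normalVec X p

/-- Mean curvature `H = (eG - 2fF + gE) / (2 (EG - F²))` (half the trace of the second fundamental
form `⟨d²X, ν⟩` with respect to the first). -/
def meanCurvature (X : ℝ × ℝ → E3) (p : ℝ × ℝ) : ℝ :=
  let E := inner ℝ (dS X p) (dS X p)
  let F := inner ℝ (dS X p) (dT X p)
  let G := inner ℝ (dT X p) (dT X p)
  let e := inner ℝ (dS (dS X) p) (gaussMap X p)
  let f := inner ℝ (dT (dS X) p) (gaussMap X p)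
  let g := inner ℝ (dT (dT X) p) (gaussMap X p)
  (e * G - 2 * f * F + g * E) / (2 * (E * G - F ^ 2))

/-! ### Helicoidal immersions and rotating drops -/

/-- The helicoidal immersion with profile curve `α`:
`φ(s,t) = (x cos ωt + y sin ωt, -x sin ωt + y cos ωt, t)`, where `α = (x, y)`. -/
def helicoidal (ω : ℝ) (α : ℝ → E2) (p : ℝ × ℝ) : E3 :=
  !₂[α p.1 0 * Real.cos (ω * p.2) + α p.1 1 * Real.sin (ω * p.2),
     -(α p.1 0) * Real.sin (ω * p.2) + α p.1 1 * Real.cos (ω * p.2),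
     p.2]

/-- The image of the helicoidal immersion. -/
def surface (ω : ℝ) (α : ℝ → E2) : Set E3 := range (helicoidal ω α)

/-- `α : ℝ → ℝ²` is a (complete) smooth arc-length parametrized profile curve of a helicoidal
rotating drop: `2 H = Λ₀ - a R² / 2`, where `R` is the distance to the `z`-axis. -/
structure IsDrop (Λ₀ a ω : ℝ) (α : ℝ → E2) : Prop where
  smooth : ContDiff ℝ (⊤ : ℕ∞) α
  unit_speed : ∀ s, ‖deriv α s‖ = 1
  mean_curvature : ∀ p, 2 * meanCurvature (helicoidal ω α) p =
    Λ₀ - a * (helicoidal ω α p 0 ^ 2 + helicoidal ω α p 1 ^ 2) / 2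

/-- The TreadmillSled `(ξ₁, ξ₂) = (x cos θ + y sin θ, x sin θ - y cos θ)` of a unit speed curve
`α = (x, y)`, where `α' = (cos θ, sin θ)`. -/
def treadmillSled (α : ℝ → E2) (s : ℝ) : E2 :=
  !₂[α s 0 * deriv α s 0 + α s 1 * deriv α s 1,
     α s 0 * deriv α s 1 - α s 1 * deriv α s 0]

/-- `G(ξ₁,ξ₂) = 2ξ₂/√(1+ω²ξ₁²) + Λ₀(ξ₁²+ξ₂²) - (a/4)(ξ₁²+ξ₂²)²` with `Λ₀ = 1`. -/
def G (a ω : ℝ) (ξ : E2) : ℝ :=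
  2 * ξ 1 / Real.sqrt (1 + ω ^ 2 * ξ 0 ^ 2) + (ξ 0 ^ 2 + ξ 1 ^ 2)
    - a / 4 * (ξ 0 ^ 2 + ξ 1 ^ 2) ^ 2

/-- The level set `G = C`. -/
def levelSet (a C ω : ℝ) : Set E2 := {ξ | G a ω ξ = C}

/-- The point `(a, C, ω)` represents the drop with profile curve `α` (for `Λ₀ = 1`). -/
def Represents (a C ω : ℝ) (α : ℝ → E2) : Prop :=
  IsDrop 1 a ω α ∧ ∀ s, treadmillSled α s ∈ levelSet a C ω

/-- Counterclockwise rotation of the plane by the angle `δ`. -/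
def rot (δ : ℝ) (v : E2) : E2 :=
  !₂[Real.cos δ * v 0 - Real.sin δ * v 1, Real.sin δ * v 0 + Real.cos δ * v 1]

/-- Rotation of space about the `z`-axis by the angle `δ`. -/
def rotZ (δ : ℝ) (v : E3) : E3 :=
  !₂[Real.cos δ * v 0 - Real.sin δ * v 1, Real.sin δ * v 0 + Real.cos δ * v 1, v 2]

/-- Two arc-length parametrized profile curves agree up to a rotation about the origin and a shift
of the arc-length parameter. -/
def CongruentProfiles (α β : ℝ → E2) : Prop := ∃ δ s₀ : ℝ, ∀ s, β s = rot δ (α (s + s₀))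

/-- Two immersions agree up to a rigid motion of space and a reparametrization. -/
def CongruentImmersions (X Y : ℝ × ℝ → E3) : Prop :=
  ∃ (M : E3 ≃ᵢ E3) (Φ : (ℝ × ℝ) ≃ₜ (ℝ × ℝ)), ∀ p, X p = M (Y (Φ p))

/-- The round cylinder of radius `R` about the `z`-axis. -/
def roundCylinder (R : ℝ) : Set E3 := {p | p 0 ^ 2 + p 1 ^ 2 = R ^ 2}

/-- The helicoidal surface with profile `α` is the round cylinder of radius `R > 0`. -/
def IsCircular (ω : ℝ) (α : ℝ → E2) (R : ℝ) : Prop := 0 < R ∧ surface ω α = roundCylinder R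

/-! ### The polynomial `q`, the map `ρ` and the angle function -/

/-- `q(r,a,C) = -16C² + 64r + 32Cr - 16r² - 8aCr² + 8ar³ - a²r⁴` as a polynomial in `r`. -/
def q (a C : ℝ) : Polynomial ℝ :=
  Polynomial.C (-16 * C ^ 2) + Polynomial.C (64 + 32 * C) * Polynomial.X
    - Polynomial.C (16 + 8 * a * C) * Polynomial.X ^ 2
    + Polynomial.C (8 * a) * Polynomial.X ^ 3 - Polynomial.C (a ^ 2) * Polynomial.X ^ 4

/-- The map `ρ`, which parametrizes the part of the level set `G = C` in `ξ₁ ≥ 0`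
by `r = ξ₁² + ξ₂²`. -/
def rho (a C ω r : ℝ) : E2 :=
  !₂[Real.sqrt ((q a C).eval r) / Real.sqrt (64 + (4 * C + r * (-4 + a * r)) ^ 2 * ω ^ 2),
     (4 * C + r * (-4 + a * r)) * Real.sqrt (1 + r * ω ^ 2)
       / Real.sqrt (64 + (4 * C + r * (-4 + a * r)) ^ 2 * ω ^ 2)]

/-- Reflection in the `ξ₂`-axis. -/
def mirror (ξ : E2) : E2 := !₂[-ξ 0, ξ 1]

/-- The curve whose right half is parametrized by `ρ` on the set `I` of values of `r`, and whose
left half is the mirror image. -/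
def rhoCurve (a C ω : ℝ) (I : Set ℝ) : Set E2 :=
  rho a C ω '' I ∪ mirror '' (rho a C ω '' I)

/-- The integrand of `Δθ̃`. -/
def deltaIntegrand (a C ω r : ℝ) : ℝ :=
  (4 * C + a * r ^ 2 - 4 * r) * Real.sqrt (1 + r * ω ^ 2)
    / (r * Real.sqrt ((q a C).eval r))

/-- `Δθ̃(C,a,ω,x₁,x₂)`. -/
def deltaTheta (a C ω x₁ x₂ : ℝ) : ℝ := ∫ r in x₁..x₂, deltaIntegrand a C ω r

/-- `α` restricted to the compact arc-length interval `[s₀, s₁]` (so of finite length `s₁ - s₀`) is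
a fundamental piece: its TreadmillSled runs exactly once around a closed curve which is a
connected component of the level set `G = C`. -/
structure IsFundamentalPiece (a C ω : ℝ) (α : ℝ → E2) (s₀ s₁ : ℝ) : Prop where
  lt : s₀ < s₁
  closed : treadmillSled α s₀ = treadmillSled α s₁
  once : InjOn (treadmillSled α) (Ico s₀ s₁)
  image_eq : treadmillSled α '' Icc s₀ s₁ =
    connectedComponentIn (levelSet a C ω) (treadmillSled α s₀)

/-! ### Proper immersions -/

/-- The group of translations of the parameter plane that leave the immersion `X` unchanged. -/
def periods (X : ℝ × ℝ → E3) : AddSubgroup (ℝ × ℝ) where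
  carrier := {v | ∀ p, X (p + v) = X p}
  zero_mem' := by intro p; simp
  add_mem' := by
    intro u v hu hv p
    rw [← add_assoc, hv, hu]
  neg_mem' := by
    intro u hu p
    have h := hu (p + -u)
    simpa using h.symm

/-- The map induced by `X` on the quotient of the parameter plane by its periods. -/
def quotientMap (X : ℝ × ℝ → E3) : (ℝ × ℝ) ⧸ periods X → E3 :=
  Quotient.lift X (by
    intro u v huv
    have h : -u + v ∈ periods X := QuotientAddGroup.leftRel_apply.mp huv
    have h' := h u
    simpa using h'.symm)

/-- The surface `X` is properly immersed: the immersion of the surface `ℝ² / periods` into space is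
a proper map. -/
def ProperlyImmersed (X : ℝ × ℝ → E3) : Prop := IsProperMap (quotientMap X)

/-! ### Limit cycles and exceptional drops -/

/-- The circle of radius `R` about the origin is a limit cycle of `α`, at both ends: it is disjoint
from `α`, and it is the set of limit points of `α` as `s → ∞` and as `s → -∞`. -/
structure HasLimitCycle (α : ℝ → E2) (R : ℝ) : Prop where
  avoid : ∀ s, ‖α s‖ ≠ R
  omega_limit : {p | MapClusterPt p atTop α} = Metric.sphere (0 : E2) R
  alpha_limit : {p | MapClusterPt p atBot α} = Metric.sphere (0 : E2) R

/-- Both ends of `α` wind infinitely often around the point `p`: near each end `α` avoids `p`, and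
a continuous choice of the polar angle of `α - p` is unbounded there. -/
def HasInfiniteWinding (α : ℝ → E2) (p : E2) : Prop :=
  (∃ (S : ℝ) (ψ : ℝ → ℝ), ContinuousOn ψ (Ici S) ∧
    (∀ s ∈ Ici S, α s ≠ p ∧ α s - p = ‖α s - p‖ • !₂[Real.cos (ψ s), Real.sin (ψ s)]) ∧
    Tendsto (fun s => |ψ s|) atTop atTop) ∧
  (∃ (S : ℝ) (ψ : ℝ → ℝ), ContinuousOn ψ (Iic S) ∧
    (∀ s ∈ Iic S, α s ≠ p ∧ α s - p = ‖α s - p‖ • !₂[Real.cos (ψ s), Real.sin (ψ s)]) ∧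
    Tendsto (fun s => |ψ s|) atBot atTop)

/-- `α` has the circle of radius `R` as a limit cycle and has infinite winding number with respect
to the points interior to that circle. -/
def SpiralsTo (α : ℝ → E2) (R : ℝ) : Prop :=
  HasLimitCycle α R ∧ ∀ p, ‖p‖ < R → HasInfiniteWinding α p

/-- Profile curves of helicoidal drops of exceptional type. -/
def IsExceptional (α : ℝ → E2) : Prop := ∃ R, 0 < R ∧ SpiralsTo α R

/-! ### The parameter regions -/

/-- `h(R) = 2(R-1)/R³`. -/
def h (R : ℝ) : ℝ := 2 * (R - 1) / R ^ 3

/-- For `a ≠ 0`: the unique nonzero `R < 1` with `h(R) = a`. -/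
def R₁ (a : ℝ) : ℝ := Classical.epsilon fun R => R ≠ 0 ∧ R < 1 ∧ h R = a

/-- For `0 < a < 8/27`: the unique `R` with `h(R) = a` and `1 < R < 3/2`. -/
def R₂ (a : ℝ) : ℝ := Classical.epsilon fun R => 1 < R ∧ R < 3 / 2 ∧ h R = a

/-- For `0 < a < 8/27`: the unique `R > 3/2` with `h(R) = a`. -/
def R₃ (a : ℝ) : ℝ := Classical.epsilon fun R => 3 / 2 < R ∧ h R = a

/-- `(16 - 8r + 6ar² - a²r³) / (4(-2 + ar))`. -/
def Cfun (a r : ℝ) : ℝ := (16 - 8 * r + 6 * a * r ^ 2 - a ^ 2 * r ^ 3) / (4 * (-2 + a * r))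

/-- `C₁(a)`, with `r₁ = R₁²`. -/
def C₁ (a : ℝ) : ℝ := Cfun a (R₁ a ^ 2)

/-- `C₂(a)`, with `r₂ = R₂²`. -/
def C₂ (a : ℝ) : ℝ := Cfun a (R₂ a ^ 2)

/-- `C₃(a)`, with `r₃ = R₃²`. -/
def C₃ (a : ℝ) : ℝ := Cfun a (R₃ a ^ 2)

/-! Points of the parameter space are triples `p = (a, C, ω)`. -/

/-- `Ω₁ = {C > C₁(a), a < 0, ω > 0}`. -/
def Ω₁ : Set (ℝ × ℝ × ℝ) := {p | C₁ p.1 < p.2.1 ∧ p.1 < 0 ∧ 0 < p.2.2}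

/-- `Ω₂ = {C₂(a) < C < C₃(a), 0 < a < 8/27, ω > 0}`. -/
def Ω₂ : Set (ℝ × ℝ × ℝ) :=
  {p | C₂ p.1 < p.2.1 ∧ p.2.1 < C₃ p.1 ∧ 0 < p.1 ∧ p.1 < 8 / 27 ∧ 0 < p.2.2}

/-- `Ω₃ = {C < C₁(a), a > 0, ω > 0}`. -/
def Ω₃ : Set (ℝ × ℝ × ℝ) := {p | p.2.1 < C₁ p.1 ∧ 0 < p.1 ∧ 0 < p.2.2}

/-- `Ω = (Ω₁ ∪ Ω₃) \ Ω₂`. -/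
def Ω : Set (ℝ × ℝ × ℝ) := (Ω₁ ∪ Ω₃) \ Ω₂

/-- `β₁ = {C = C₁(a), a ≠ 0, ω > 0}`. -/
def β₁ : Set (ℝ × ℝ × ℝ) := {p | p.2.1 = C₁ p.1 ∧ p.1 ≠ 0 ∧ 0 < p.2.2}

/-- `β₂ = {C = C₂(a), 0 < a < 8/27, ω > 0}`. -/
def β₂ : Set (ℝ × ℝ × ℝ) := {p | p.2.1 = C₂ p.1 ∧ 0 < p.1 ∧ p.1 < 8 / 27 ∧ 0 < p.2.2}

/-- `β₃ = {C = C₃(a), 0 < a < 8/27, ω > 0}`. -/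
def β₃ : Set (ℝ × ℝ × ℝ) := {p | p.2.1 = C₃ p.1 ∧ 0 < p.1 ∧ p.1 < 8 / 27 ∧ 0 < p.2.2}

/-- The points `(8/27, -9/8, ω)`, `ω > 0`. -/
def cuspPoints : Set (ℝ × ℝ × ℝ) := {p | p.1 = 8 / 27 ∧ p.2.1 = -(9 / 8) ∧ 0 < p.2.2}

end HelicoidalDrop

end

open HelicoidalDrop

/-!
On a level set `G = C` everything about a profile curve `α` is a function of `r = |α|²`. The level
equation can be solved for `ξ₂` (`mem_levelSet_iff`): with `P(r) = 4C - 4r + ar²` and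
`D(r) = 64 + ω² P(r)²` it forces `ξ₂ = S(r) = P(r) √(1 + ω² r) / √(D(r))` and `ξ₁² = q(r) / D(r)`.
Since `r' = 2 ξ₁`, the function `r` satisfies `r'² = Q(r)` with `Q = 4q/D`, and in fact Newton's
equation `r'' = Q'(r)/2`. The mean curvature equation is the equation `k = 2 S'(r)` for the
curvature of `α` (`curvature_eq_levelK_iff`). Hence `G` is a first integral of the drops
(`IsDrop.exists_represents`), conversely every solution of Newton's equation with energy zero is
`|α|²` for some drop `α` in the level set (`exists_represents`), and `α` is determined by its
TreadmillSled up to a rotation (`exists_eq_rot`). Thus the drops on a level set correspond to the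
orbits of a particle in the potential well `-Q`, up to shifts of time.

The orbits are of three kinds. Between two simple roots of `q` with `q > 0` in between, the motion
is periodic (`SimpleArc.exists_period`), and its phase curve, the TreadmillSled, is a closed curve:
this is a fundamental piece of finite length. A multiple root is an equilibrium, which is a round
cylinder. Between a simple root and a multiple one the motion is homoclinic: it takes an infinite
time to reach the multiple root `R²` (`homoclinic_left`, `homoclinic_right`). As the curvature and
the angular velocity of `α` then converge to those of the circle of radius `R`, the curve spirals
to it (`Represents.spiralsTo`), and the drop is not properly immersed.

It remains to find the roots of `q`. A number `R²` with `R ≠ 0` is a root of `q` exactly if the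
circle of radius `R`, with one of its two orientations, lies on the level set; the orientation is
encoded in the sign of `R`, and the condition reads `levelG a R = C` (`q_root_iff`). At such a root
`q'` is a nonzero multiple of the cubic `aR³ - 2R + 2`, whose zeros are the critical radii `R₁`,
`R₂`, `R₃`. The function `levelG a` is monotone between the critical radii. Counting its preimages
of `C` gives the roots of `q` and their multiplicities in each region of the parameters
(`twoSimple_of_mem_interior`, `exists_two_arcs`, `multiple_root_unique`), and comparing `C` with
the critical values shows that the regions account for every level set which contains a drop
(`mem_regions`). Drops with `ω < 0` are mirror images of drops with `ω > 0`
(`congruentImmersions_neg`).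

For a periodic orbit, the substitution `r = |α(s)|²` turns the angle swept out by `α` in one period
into `Δθ̃` (`Represents.deltaTheta_eq`). So `α(s + T) = Rot_δ α(s)`, with an additional half turn
if the curve passes through the origin, where its polar angle jumps by `π` (`SimpleArc.monodromy`).
If `δ/π` is rational, then `α` is periodic and the surface is proper
(`properlyImmersed_of_rational`). Otherwise the rotations by multiples of `δ` are dense, so the
curve is dense in the annulus `x₁ ≤ |α|² ≤ x₂`, and the surface is dense in the corresponding solid
(`closure_surface_of_irrational`).
-/

open Filter Topology Set

noncomputable section

namespace HelicoidalDrop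

/-! ### Global solutions of autonomous equations -/

/-- A bounded Lipschitz vector field is complete. -/
theorem exists_global_solution {E : Type*} [NormedAddCommGroup E] [NormedSpace ℝ E]
    [CompleteSpace E] {F : E → E} {K L : NNReal} (hF : LipschitzWith K F)
    (hL : ∀ x, ‖F x‖ ≤ L) (x₀ : E) :
    ∃ γ : ℝ → E, γ 0 = x₀ ∧ ∀ t, HasDerivAt γ (F (γ t)) t := by
  -- Picard–Lindelöf applies on every interval `(-|n| - 1, |n| + 1)`, since the bound on `F` keeps
  -- the solution in the ball on which it is required.
  have key : ∀ n : ℝ, ∃ γ : ℝ → E, γ 0 = x₀ ∧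
      ∀ t ∈ Ioo (-(|n| + 1)) (|n| + 1), HasDerivAt γ (F (γ t)) t := by
    intro n
    have hn : (0 : ℝ) ≤ |n| + 1 := by positivity
    have hPL : IsPicardLindelof (fun _ => F) (tmin := -(|n| + 1)) (tmax := |n| + 1)
        ⟨0, by constructor <;> linarith⟩ x₀ (L * ⟨|n| + 1, hn⟩) 0 L K := by
      refine IsPicardLindelof.of_time_independent (fun x _ => hL x) hF.lipschitzOnWith ?_
      simp only [zero_add, sub_neg_eq_add, sub_zero, max_self, NNReal.coe_zero]
      exact le_rfl
    obtain ⟨γ, h0, hγ⟩ := hPL.exists_eq_forall_mem_Icc_hasDerivWithinAt₀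
    exact ⟨γ, h0, fun t ht => (hγ t (Ioo_subset_Icc_self ht)).hasDerivAt
      (Icc_mem_nhds ht.1 ht.2)⟩
  choose γ h0 hγ using key
  have agree : ∀ n m : ℝ, |n| ≤ |m| → EqOn (γ n) (γ m) (Ioo (-(|n| + 1)) (|n| + 1)) := by
    intro n m hnm
    refine ODE_solution_unique_of_mem_Ioo (v := fun _ => F) (s := fun _ => univ) (K := K)
      (t₀ := 0) (fun _ _ => hF.lipschitzOnWith) ?_
      (fun t ht => ⟨hγ n t ht, trivial⟩)
      (fun t ht => ⟨hγ m t ⟨by linarith [ht.1], by linarith [ht.2]⟩, trivial⟩)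
      (by rw [h0, h0])
    constructor <;> nlinarith [abs_nonneg n]
  -- By uniqueness the local solutions agree on common intervals; the diagonal `t ↦ γ t t` patches
  -- them together.
  refine ⟨fun t => γ t t, h0 0, fun t => ?_⟩
  have ht : t ∈ Ioo (-(|t| + 1)) (|t| + 1) := by
    rw [mem_Ioo, ← abs_lt]; linarith
  refine (hγ t t ht).congr_of_eventuallyEq ?_
  filter_upwards [Ioo_mem_nhds ht.1 ht.2] with s hs
  rcases le_total |s| |t| with hst | hst
  · refine agree s t hst ?_
    rw [mem_Ioo, ← abs_lt]; linarith
  · exact (agree t s hst hs).symm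

/-! ### Newton's equation in a potential well -/

/-- A `C²` function which is nonnegative only on a bounded set; `-Q` is the potential energy of a
particle on the line. -/
structure IsPotential (Q : ℝ → ℝ) : Prop where
  smooth : ContDiff ℝ 2 Q
  bdd : ∃ M, ∀ x, 0 ≤ Q x → |x| ≤ M

/-- A motion with position `r` and velocity `v` that solves `r'' = Q'(r) / 2` on the energy level
`r'² = Q(r)`. -/
structure IsNewton (Q r v : ℝ → ℝ) : Prop where
  deriv_pos : ∀ s, HasDerivAt r (v s) s
  deriv_vel : ∀ s, HasDerivAt v (deriv Q (r s) / 2) s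
  energy : ∀ s, v s ^ 2 = Q (r s)

theorem IsPotential.neg {Q : ℝ → ℝ} (hQ : IsPotential Q) : IsPotential fun x => Q (-x) := by
  obtain ⟨M, hM⟩ := hQ.bdd
  exact ⟨hQ.smooth.comp contDiff_neg, M, fun x hx => by simpa using hM (-x) hx⟩

theorem IsPotential.hasDerivAt {Q : ℝ → ℝ} (hQ : IsPotential Q) (x : ℝ) :
    HasDerivAt Q (deriv Q x) x :=
  (hQ.smooth.differentiable (by norm_num) x).hasDerivAt

theorem IsPotential.continuous_deriv {Q : ℝ → ℝ} (hQ : IsPotential Q) : Continuous (deriv Q) :=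
  hQ.smooth.continuous_deriv (by norm_num)

namespace IsNewton

variable {Q r v : ℝ → ℝ}

theorem continuous_pos (hN : IsNewton Q r v) : Continuous r :=
  continuous_iff_continuousAt.2 fun s => (hN.deriv_pos s).continuousAt

theorem continuous_vel (hN : IsNewton Q r v) : Continuous v :=
  continuous_iff_continuousAt.2 fun s => (hN.deriv_vel s).continuousAt

theorem shift (hN : IsNewton Q r v) (b : ℝ) :
    IsNewton Q (fun s => r (s + b)) (fun s => v (s + b)) :=
  ⟨fun s => (hN.deriv_pos (s + b)).comp_add_const s b,
    fun s => (hN.deriv_vel (s + b)).comp_add_const s b, fun _ => hN.energy _⟩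

theorem reverse (hN : IsNewton Q r v) (b : ℝ) :
    IsNewton Q (fun s => r (b - s)) (fun s => -v (b - s)) := by
  refine ⟨fun s => (hN.deriv_pos (b - s)).comp_const_sub b s, fun s => ?_, fun s => ?_⟩
  · have := ((hN.deriv_vel (b - s)).comp_const_sub b s).neg
    rwa [neg_neg] at this
  · simpa using hN.energy (b - s)

theorem neg (hN : IsNewton Q r v) :
    IsNewton (fun x => Q (-x)) (fun s => -r s) (fun s => -v s) := by
  refine ⟨fun s => (hN.deriv_pos s).neg, fun s => ?_, fun s => by simpa using hN.energy s⟩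
  have h1 : deriv (fun x => Q (-x)) (-r s) = -deriv Q (r s) := by
    rw [deriv_comp_neg]; simp
  rw [h1, neg_div]
  exact (hN.deriv_vel s).neg

end IsNewton

/-- The derivative of a `C²` function is Lipschitz on compact intervals. -/
theorem exists_lipschitzOn_deriv {Q : ℝ → ℝ} (hQ : ContDiff ℝ 2 Q) (M : ℝ) :
    ∃ K, LipschitzOnWith K (fun x => deriv Q x / 2) (Icc (-M) M) := by
  have h1 : ContDiff ℝ 1 (fun x => deriv Q x / 2) := by
    have : ContDiff ℝ (1 + 1) Q := by simpa [one_add_one_eq_two] using hQ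
    exact (contDiff_succ_iff_deriv.1 this).2.2.div_const 2
  exact h1.contDiffOn.exists_lipschitzOnWith (by norm_num) (convex_Icc _ _) isCompact_Icc

/-- Motions through the same point of phase space are translates of each other. -/
theorem IsNewton.unique {Q r v r' v' : ℝ → ℝ} (hQ : IsPotential Q) (hN : IsNewton Q r v)
    (hN' : IsNewton Q r' v') {a b : ℝ} (hr : r a = r' b) (hv : v a = v' b) (s : ℝ) :
    r (s + a) = r' (s + b) ∧ v (s + a) = v' (s + b) := by
  obtain ⟨M, hM⟩ := hQ.bdd
  obtain ⟨K, hK⟩ := exists_lipschitzOn_deriv hQ.smooth M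
  have mem : ∀ {r v : ℝ → ℝ}, IsNewton Q r v → ∀ s, r s ∈ Icc (-M) M := fun hN s =>
    abs_le.1 (hM _ (by rw [← hN.energy]; positivity))
  have hL : LipschitzOnWith (max 1 K) (fun p : ℝ × ℝ => (p.2, deriv Q p.1 / 2))
      {p | p.1 ∈ Icc (-M) M} := by
    have h2 : LipschitzOnWith K (fun p : ℝ × ℝ => deriv Q p.1 / 2) {p | p.1 ∈ Icc (-M) M} := by
      have := hK.comp (LipschitzWith.prod_fst (α := ℝ) (β := ℝ)).lipschitzOnWith
        (s := {p : ℝ × ℝ | p.1 ∈ Icc (-M) M}) (fun p hp => hp)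
      simpa [Function.comp_def] using this
    exact (LipschitzWith.prod_snd (α := ℝ) (β := ℝ)).lipschitzOnWith.prodMk h2
  have sol : ∀ {r v : ℝ → ℝ}, IsNewton Q r v → ∀ b s,
      HasDerivAt (fun s => (r (s + b), v (s + b)))
        ((fun p : ℝ × ℝ => (p.2, deriv Q p.1 / 2)) (r (s + b), v (s + b))) s := fun hN b s =>
    ((hN.shift b).deriv_pos s).prodMk ((hN.shift b).deriv_vel s)
  have := ODE_solution_unique_univ (v := fun _ => fun p : ℝ × ℝ => (p.2, deriv Q p.1 / 2))
    (s := fun _ => {p | p.1 ∈ Icc (-M) M}) (t₀ := 0) (fun _ => hL)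
    (fun t => ⟨sol hN a t, mem hN _⟩) (fun t => ⟨sol hN' b t, mem hN' _⟩) (by simp [hr, hv])
  exact Prod.mk.inj (congrFun this s)

/-- Existence of the motion through a given point of the energy level. The force is frozen outside
a large interval to make the vector field complete; the conservation of energy keeps the motion
inside that interval. -/
theorem exists_isNewton {Q : ℝ → ℝ} (hQ : IsPotential Q) {x₀ v₀ : ℝ} (h0 : v₀ ^ 2 = Q x₀) :
    ∃ r v, IsNewton Q r v ∧ r 0 = x₀ ∧ v 0 = v₀ := by
  obtain ⟨M, hM⟩ := hQ.bdd
  have hM0 : 0 ≤ M := (abs_nonneg x₀).trans (hM x₀ (by rw [← h0]; positivity))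
  obtain ⟨K, hK⟩ := exists_lipschitzOn_deriv hQ.smooth (M + 1)
  have hI : -(M + 1) ≤ M + 1 := by linarith
  obtain ⟨V, hV⟩ := isCompact_Icc.exists_bound_of_continuousOn (s := Icc (-(M + 1)) (M + 1))
    hQ.smooth.continuous.continuousOn
  obtain ⟨A, hA⟩ := isCompact_Icc.exists_bound_of_continuousOn (s := Icc (-(M + 1)) (M + 1))
    hQ.continuous_deriv.continuousOn
  -- `W` exceeds every velocity allowed by the energy, as `v² = Q(r) ≤ V` implies `|v| < |V| + 2`.
  set W : ℝ := |V| + 2 with hW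
  have hWI : -W ≤ W := by have := abs_nonneg V; linarith
  -- Clamping position and velocity to compact intervals makes the vector field bounded and globally
  -- Lipschitz.
  set p₁ : ℝ → ℝ := fun x => projIcc (-(M + 1)) (M + 1) hI x with hp₁
  set p₂ : ℝ → ℝ := fun x => projIcc (-W) W hWI x with hp₂
  have m₁ : ∀ x, p₁ x ∈ Icc (-(M + 1)) (M + 1) := fun x => (projIcc _ _ hI x).2
  have m₂ : ∀ x, p₂ x ∈ Icc (-W) W := fun x => (projIcc _ _ hWI x).2
  have l₁ : LipschitzWith 1 p₁ := by
    have := (LipschitzWith.subtype_val _).comp (LipschitzWith.projIcc hI)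
    rwa [mul_one] at this
  have l₂ : LipschitzWith 1 p₂ := by
    have := (LipschitzWith.subtype_val _).comp (LipschitzWith.projIcc hWI)
    rwa [mul_one] at this
  have lQ : LipschitzWith (K * 1) (fun x => deriv Q (p₁ x) / 2) := by
    rw [← lipschitzOnWith_univ]
    exact hK.comp l₁.lipschitzOnWith (fun x _ => m₁ x)
  have lF : LipschitzWith (max (1 * 1) (K * 1 * 1))
      (fun p : ℝ × ℝ => (p₂ p.2, deriv Q (p₁ p.1) / 2)) :=
    (l₂.comp LipschitzWith.prod_snd).prodMk (lQ.comp LipschitzWith.prod_fst)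
  obtain ⟨γ, hγ0, hγ⟩ := exists_global_solution lF (L := ⟨max W |A|, by positivity⟩)
    (fun p => by
      rw [Prod.norm_def]
      refine max_le_max (abs_le.2 (m₂ _)) ?_
      have := hA _ (m₁ p.1)
      simp only [Real.norm_eq_abs] at this ⊢
      rw [abs_div, abs_two]
      have h3 := abs_nonneg (deriv Q (p₁ p.1))
      have h4 := le_abs_self A
      linarith) (x₀, v₀)
  set r : ℝ → ℝ := fun s => (γ s).1
  set v : ℝ → ℝ := fun s => (γ s).2
  have hr : ∀ s, HasDerivAt r (p₂ (v s)) s := fun s => (hγ s).fst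
  have hv : ∀ s, HasDerivAt v (deriv Q (p₁ (r s)) / 2) s := fun s => (hγ s).snd
  have cr : Continuous r := continuous_iff_continuousAt.2 fun s => (hr s).continuousAt
  have cv : Continuous v := continuous_iff_continuousAt.2 fun s => (hv s).continuousAt
  have e₁ : ∀ x ∈ Icc (-(M + 1)) (M + 1), p₁ x = x := fun x hx => by
    simp [hp₁, projIcc_of_mem hI hx]
  have e₂ : ∀ x ∈ Icc (-W) W, p₂ x = x := fun x hx => by
    simp [hp₂, projIcc_of_mem hWI hx]
  have small : ∀ s, v s ^ 2 = Q (r s) → |r s| < M + 1 ∧ |v s| < W := by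
    intro s hs
    have h1 : |r s| ≤ M := hM _ (by rw [← hs]; positivity)
    refine ⟨by linarith, ?_⟩
    have h2 := hV (r s) (abs_le.1 (by linarith))
    rw [← hs, Real.norm_eq_abs, abs_of_nonneg (sq_nonneg _)] at h2
    have h3 : |v s| ^ 2 = v s ^ 2 := sq_abs _
    have h4 := le_abs_self V
    have h5 := abs_nonneg V
    nlinarith [abs_nonneg (v s)]
  -- The energy is conserved as long as the clamping has no effect, so the set of times at which `v²
  -- = Q(r)` holds is open as well as closed.
  have clopen : IsClopen {s | v s ^ 2 = Q (r s)} := by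
    refine ⟨isClosed_eq (cv.pow 2) (hQ.smooth.continuous.comp cr), ?_⟩
    rw [isOpen_iff_mem_nhds]
    intro s hs
    obtain ⟨h1, h2⟩ := small s hs
    have ev : ∀ᶠ t in 𝓝 s, |r t| < M + 1 ∧ |v t| < W :=
      (cr.abs.continuousAt.eventually (gt_mem_nhds h1)).and
        (cv.abs.continuousAt.eventually (gt_mem_nhds h2))
    obtain ⟨ε, hε, hball⟩ := Metric.eventually_nhds_iff_ball.1 ev
    refine Filter.mem_of_superset (Metric.ball_mem_nhds s hε) fun t ht => ?_
    have hd : ∀ t ∈ Metric.ball s ε, HasDerivAt (fun t => v t ^ 2 - Q (r t)) 0 t := by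
      intro t ht
      obtain ⟨h3, h4⟩ := hball t ht
      have h5 := ((hv t).pow 2).sub ((hQ.hasDerivAt (r t)).comp t (hr t))
      rw [e₁ _ (abs_le.1 h3.le), e₂ _ (abs_le.1 h4.le)] at h5
      exact h5.congr_deriv (by push_cast; ring)
    have hc := (Metric.isOpen_ball (x := s) (ε := ε)).is_const_of_deriv_eq_zero
      (convex_ball s ε).isPreconnected
      (fun t ht => (hd t ht).differentiableAt.differentiableWithinAt)
      (fun t ht => (hd t ht).deriv) ht (Metric.mem_ball_self hε)
    have hs' : v s ^ 2 = Q (r s) := hs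
    have : v t ^ 2 - Q (r t) = 0 := by rw [hc, hs', sub_self]
    exact sub_eq_zero.1 this
  have all : ∀ s, v s ^ 2 = Q (r s) := by
    have h0' : (0 : ℝ) ∈ {s | v s ^ 2 = Q (r s)} := by
      change (γ 0).2 ^ 2 = Q (γ 0).1
      rw [hγ0]; exact h0
    have := clopen.eq_univ ⟨0, h0'⟩
    intro s
    have hs : s ∈ {s | v s ^ 2 = Q (r s)} := by rw [this]; trivial
    exact hs
  refine ⟨r, v, ⟨fun s => ?_, fun s => ?_, all⟩, by simp [r, hγ0], by simp [v, hγ0]⟩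
  · have := hr s
    rwa [e₂ _ (abs_le.1 (small s (all s)).2.le)] at this
  · have := hv s
    rwa [e₁ _ (abs_le.1 (small s (all s)).1.le)] at this

/-- If `r` converges and `r'` converges at infinity, then `r'` tends to zero. -/
theorem deriv_limit_eq_zero {r v : ℝ → ℝ} {L c : ℝ} (hr : ∀ s, HasDerivAt r (v s) s)
    (hL : Tendsto r atTop (𝓝 L)) (hc : Tendsto v atTop (𝓝 c)) : c = 0 := by
  have h1 : Tendsto (fun s => r (s + 1) - r s) atTop (𝓝 (L - L)) :=
    (hL.comp (tendsto_atTop_add_const_right _ 1 tendsto_id)).sub hL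
  have hmv : ∀ s, ∃ t, s < t ∧ v t = r (s + 1) - r s := by
    intro s
    obtain ⟨t, ht, h2⟩ := exists_hasDerivAt_eq_slope r v (show s < s + 1 by linarith)
      (fun x _ => (hr x).continuousAt.continuousWithinAt) (fun x _ => hr x)
    exact ⟨t, ht.1, by rw [h2]; simp⟩
  choose t ht hvt using hmv
  have h2 : Tendsto t atTop atTop := tendsto_atTop_mono (fun s => (ht s).le) tendsto_id
  have h3 : Tendsto (fun s => r (s + 1) - r s) atTop (𝓝 c) :=
    (hc.comp h2).congr fun s => hvt s
  simpa using tendsto_nhds_unique h3 h1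

/-- A function with positive derivative at `s₀` is larger than its value there, just to the
right. -/
theorem eventually_gt_of_deriv_pos {f : ℝ → ℝ} {s₀ d : ℝ} (hf : HasDerivAt f d s₀) (hd : 0 < d) :
    ∀ᶠ s in 𝓝[>] s₀, f s₀ < f s := by
  have h1 := hasDerivAt_iff_tendsto_slope.1 hf
  have h2 : ∀ᶠ s in 𝓝[≠] s₀, 0 < slope f s₀ s := h1.eventually (lt_mem_nhds hd)
  have h3 := h2.filter_mono (nhdsWithin_mono s₀ (fun s (hs : s₀ < s) => (ne_of_gt hs)))
  filter_upwards [h3, self_mem_nhdsWithin] with s hs hs'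
  rw [slope_def_field] at hs
  have h4 : 0 < s - s₀ := sub_pos.2 hs'
  have := (div_pos_iff_of_pos_right h4).1 hs
  linarith

namespace IsNewton

variable {Q r v : ℝ → ℝ}

/-- Motions are symmetric about their turning points. -/
theorem symm_of_vel_eq_zero (hQ : IsPotential Q) (hN : IsNewton Q r v) {b : ℝ} (hb : v b = 0)
    (s : ℝ) : r (b - s) = r (b + s) ∧ v (b - s) = -v (b + s) := by
  have h1 := unique hQ (hN.reverse (2 * b)) hN (a := b) (b := b)
    (by ring_nf) (by rw [show 2 * b - b = b by ring, hb, neg_zero]) s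
  rw [show 2 * b - (s + b) = b - s by ring, add_comm s b] at h1
  exact ⟨h1.1, by linarith [h1.2]⟩

/-- A motion that meets a critical zero of `Q` stays there. -/
theorem eq_const (hQ : IsPotential Q) (hN : IsNewton Q r v) {x b : ℝ} (hx : Q x = 0)
    (hd : deriv Q x = 0) (hb : r b = x) (s : ℝ) : r s = x ∧ v s = 0 := by
  have hc : IsNewton Q (fun _ => x) (fun _ => 0) :=
    ⟨fun s => hasDerivAt_const _ _, fun s => by simpa [hd] using hasDerivAt_const s (0 : ℝ),
      fun s => by simp [hx]⟩
  have hv : v b = 0 := by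
    have := hN.energy b
    rw [hb, hx] at this
    exact pow_eq_zero_iff two_ne_zero |>.1 this
  have := unique hQ hN hc (a := b) (b := b) hb hv (s - b)
  simpa using this

/-- The first half of the motion that starts at a simple zero `x₁` of `Q`, where `Q > 0` up to the
next zero `x₂`: as long as the velocity is positive, `r` increases from `x₁` towards `x₂`. -/
theorem mem_Ioo_of_vel_pos (hN : IsNewton Q r v) {x₁ x₂ : ℝ} (h12 : x₁ < x₂)
    (h2 : Q x₂ = 0) (h0 : r 0 = x₁) {t : ℝ}
    (ht : ∀ s ∈ Ioo 0 t, 0 < v s) : StrictMonoOn r (Icc 0 t) ∧ ∀ s ∈ Ioo 0 t, r s ∈ Ioo x₁ x₂ := by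
  have hm : StrictMonoOn r (Icc 0 t) := by
    refine strictMonoOn_of_deriv_pos (convex_Icc _ _) hN.continuous_pos.continuousOn ?_
    intro s hs
    rw [interior_Icc] at hs
    rw [(hN.deriv_pos s).deriv]
    exact ht s hs
  refine ⟨hm, fun s hs => ⟨?_, ?_⟩⟩
  · rw [← h0]
    exact hm ⟨le_rfl, (hs.1.trans hs.2).le⟩ ⟨hs.1.le, hs.2.le⟩ hs.1
  · by_contra! hle
    obtain ⟨u, hu, hru⟩ := intermediate_value_Icc hs.1.le hN.continuous_pos.continuousOn
      (show x₂ ∈ Icc (r 0) (r s) from ⟨by rw [h0]; exact h12.le, hle⟩)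
    have hu0 : u ≠ 0 := by rintro rfl; rw [h0] at hru; exact h12.ne hru
    have hv := ht u ⟨lt_of_le_of_ne hu.1 (Ne.symm hu0), lt_of_le_of_lt hu.2 hs.2⟩
    have he := hN.energy u
    rw [hru, h2] at he
    nlinarith

/-- By conservation of energy, the zeros of `Q` are turning points. -/
theorem vel_eq_zero (hN : IsNewton Q r v) {s : ℝ} (h : Q (r s) = 0) : v s = 0 := by
  have := hN.energy s
  rw [h] at this
  exact pow_eq_zero_iff two_ne_zero |>.1 this

/-- From a simple zero of `Q` the motion sets out into the region `Q > 0`. -/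
theorem eventually_vel_pos (hN : IsNewton Q r v) {x₁ : ℝ} (h1 : Q x₁ = 0)
    (hd : 0 < deriv Q x₁) (h0 : r 0 = x₁) : ∃ ε > 0, ∀ s ∈ Ioo 0 ε, 0 < v s := by
  have hv0 : v 0 = 0 := hN.vel_eq_zero (by rw [h0, h1])
  have hev := eventually_gt_of_deriv_pos (hN.deriv_vel 0) (by rw [h0]; linarith)
  rw [hv0] at hev
  obtain ⟨ε, hε, hs⟩ := mem_nhdsGT_iff_exists_Ioo_subset.1 hev
  exact ⟨ε, hε, fun s h => hs h⟩

/-- If the velocity never vanishes again after the turning point `x₁`, the motion converges to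
`x₂`, which must be a critical zero of `Q`. -/
theorem tendsto_of_vel_pos (hQ : IsPotential Q) (hN : IsNewton Q r v) {x₁ x₂ : ℝ}
    (h12 : x₁ < x₂) (h2 : Q x₂ = 0) (hpos : ∀ x ∈ Ioo x₁ x₂, 0 < Q x)
    (h0 : r 0 = x₁) (hv : ∀ s, 0 < s → 0 < v s) :
    Tendsto r atTop (𝓝 x₂) ∧ deriv Q x₂ = 0 := by
  have hin : ∀ s, 0 < s → r s ∈ Ioo x₁ x₂ := fun s hs =>
    (hN.mem_Ioo_of_vel_pos h12 h2 h0 (t := s + 1) fun u hu => hv u hu.1).2 s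
      ⟨hs, by linarith⟩
  have hmono : ∀ s t, 0 ≤ s → s < t → r s < r t := fun s t hs hst =>
    (hN.mem_Ioo_of_vel_pos h12 h2 h0 (t := t) fun u hu => hv u hu.1).1
      ⟨hs, hst.le⟩ ⟨hs.trans hst.le, le_rfl⟩ hst
  -- extended by its initial value to negative times, the position is monotone and bounded
  set r' : ℝ → ℝ := fun s => r (max s 0) with hr'
  have hm' : Monotone r' := by
    intro s t hst
    rcases (max_le_max_right 0 hst).eq_or_lt with h | h
    · simp [hr', h]
    · exact (hmono _ _ (le_max_right _ _) h).le
  have hbdd : BddAbove (range r') := by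
    refine ⟨x₂, ?_⟩
    rintro _ ⟨s, rfl⟩
    rcases (le_max_right s 0).eq_or_lt with h | h
    · simp only [hr', ← h, h0]; exact h12.le
    · exact (hin _ h).2.le
  have hlim := tendsto_atTop_ciSup hm' hbdd
  set L := ⨆ s, r' s
  have hrr : r' =ᶠ[atTop] r := by
    filter_upwards [eventually_ge_atTop 0] with s hs
    simp [hr', hs]
  have hL : Tendsto r atTop (𝓝 L) := hlim.congr' hrr
  have hL1 : r 1 ≤ L := by
    have := le_ciSup hbdd 1
    simpa [hr'] using this
  have hL2 : L ≤ x₂ := ciSup_le fun s => by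
    rcases (le_max_right s 0).eq_or_lt with h | h
    · simp only [hr', ← h, h0]; exact h12.le
    · exact (hin _ h).2.le
  -- The velocity `√Q(r)` converges too, hence to zero, and so does the force.
  have hvsq : Tendsto v atTop (𝓝 (Real.sqrt (Q L))) := by
    have h3 : Tendsto (fun s => Real.sqrt (Q (r s))) atTop (𝓝 (Real.sqrt (Q L))) :=
      (Real.continuous_sqrt.comp hQ.smooth.continuous).continuousAt.tendsto.comp hL
    refine h3.congr' ?_
    filter_upwards [eventually_gt_atTop 0] with s hs
    rw [← hN.energy, Real.sqrt_sq (hv s hs).le]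
  have hz := deriv_limit_eq_zero hN.deriv_pos hL hvsq
  have hQL : Q L ≤ 0 := Real.sqrt_eq_zero'.1 hz
  have hLx : L = x₂ := by
    rcases hL2.eq_or_lt with h | h
    · exact h
    · exact absurd (hpos L ⟨lt_of_lt_of_le (hin 1 one_pos).1 hL1, h⟩) (not_lt.2 hQL)
  refine ⟨hLx ▸ hL, ?_⟩
  rw [hz] at hvsq
  have h4 : Tendsto (fun s => deriv Q (r s) / 2) atTop (𝓝 (deriv Q L / 2)) :=
    ((hQ.continuous_deriv.div_const 2).continuousAt (x := L)).tendsto.comp hL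
  have := deriv_limit_eq_zero hN.deriv_vel hvsq h4
  rw [← hLx]; linarith

/-- After leaving the simple zero `x₁` of `Q`, either the velocity stays positive forever, or the
motion reaches the next zero `x₂` of `Q` in a finite time. -/
theorem vel_pos_or_exists_time (hN : IsNewton Q r v) {x₁ x₂ : ℝ}
    (h12 : x₁ < x₂) (h1 : Q x₁ = 0) (h2 : Q x₂ = 0) (hpos : ∀ x ∈ Ioo x₁ x₂, 0 < Q x)
    (hd1 : 0 < deriv Q x₁) (h0 : r 0 = x₁) :
    (∀ s, 0 < s → 0 < v s) ∨ ∃ T > 0, r T = x₂ ∧ ∀ s ∈ Ioo 0 T, 0 < v s := by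
  obtain ⟨ε, hε, hεv⟩ := hN.eventually_vel_pos h1 hd1 h0
  -- the first zero of the velocity after the start, if there is one, is the time of arrival
  set Z : Set ℝ := {s | ε / 2 ≤ s ∧ v s = 0} with hZ
  have hZc : IsClosed Z := (isClosed_le continuous_const continuous_id).inter
    (isClosed_eq hN.continuous_vel continuous_const)
  have hZb : BddBelow Z := ⟨ε / 2, fun s hs => hs.1⟩
  have pos_of : ∀ t, (∀ s ∈ Z, t ≤ s) → ∀ s ∈ Ioo 0 t, 0 < v s := by
    intro t ht s hs
    rcases lt_or_ge s ε with h | h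
    · exact hεv s ⟨hs.1, h⟩
    by_contra! hneg
    obtain ⟨u, hu, hvu⟩ := intermediate_value_Icc' (show ε / 2 ≤ s by linarith)
      hN.continuous_vel.continuousOn (show (0 : ℝ) ∈ Icc (v s) (v (ε / 2)) from
        ⟨hneg, (hεv _ ⟨by linarith, by linarith⟩).le⟩)
    have := ht u ⟨hu.1, hvu⟩
    linarith [hu.2, hs.2]
  rcases Z.eq_empty_or_nonempty with hE | hne
  · exact Or.inl fun s hs => pos_of (s + 1) (by simp [hE]) s ⟨hs, by linarith⟩
  · set T := sInf Z
    have hT : T ∈ Z := hZc.csInf_mem hne hZb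
    have hT0 : 0 < T := by have := hT.1; linarith
    have hv := pos_of T fun s hs => csInf_le hZb hs
    obtain ⟨hm, hin⟩ := hN.mem_Ioo_of_vel_pos h12 h2 h0 hv
    refine Or.inr ⟨T, hT0, ?_, hv⟩
    have hQT : Q (r T) = 0 := by rw [← hN.energy, hT.2]; norm_num
    have hgt : x₁ < r T := by
      rw [← h0]; exact hm ⟨le_rfl, hT0.le⟩ ⟨hT0.le, le_rfl⟩ hT0
    have hle : r T ≤ x₂ := by
      refine le_of_tendsto (hN.continuous_pos.continuousWithinAt (s := Iio T)) ?_
      filter_upwards [Ioo_mem_nhdsLT hT0] with s hs using (hin s hs).2.le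
    rcases hle.eq_or_lt with h | h
    · exact h
    · exact absurd (hpos _ ⟨hgt, h⟩) (by rw [hQT]; exact lt_irrefl _)

/-- Between two simple zeros `x₁ < x₂` of `Q` the motion reaches `x₂` from `x₁` in a finite time. -/
theorem exists_half_period (hQ : IsPotential Q) (hN : IsNewton Q r v) {x₁ x₂ : ℝ}
    (h12 : x₁ < x₂) (h1 : Q x₁ = 0) (h2 : Q x₂ = 0) (hpos : ∀ x ∈ Ioo x₁ x₂, 0 < Q x)
    (hd1 : 0 < deriv Q x₁) (hd2 : deriv Q x₂ ≠ 0) (h0 : r 0 = x₁) :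
    ∃ T > 0, r T = x₂ ∧ ∀ s ∈ Ioo 0 T, 0 < v s :=
  (hN.vel_pos_or_exists_time h12 h1 h2 hpos hd1 h0).resolve_left fun h =>
    hd2 (tendsto_of_vel_pos hQ hN h12 h2 hpos h0 h).2

/-- From a simple zero `x₁` of `Q` towards a critical zero `x₂`, the motion is increasing for all
positive times and converges to `x₂`. -/
theorem homoclinic (hQ : IsPotential Q) (hN : IsNewton Q r v) {x₁ x₂ : ℝ}
    (h12 : x₁ < x₂) (h1 : Q x₁ = 0) (h2 : Q x₂ = 0) (hpos : ∀ x ∈ Ioo x₁ x₂, 0 < Q x)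
    (hd1 : 0 < deriv Q x₁) (hd2 : deriv Q x₂ = 0) (h0 : r 0 = x₁) :
    (∀ s, 0 < s → 0 < v s) ∧ (∀ s, 0 < s → r s ∈ Ioo x₁ x₂) ∧ Tendsto r atTop (𝓝 x₂) := by
  have hv := (hN.vel_pos_or_exists_time h12 h1 h2 hpos hd1 h0).resolve_right (by
    rintro ⟨T, -, hT, -⟩
    have := (hN.eq_const hQ h2 hd2 hT 0).1
    rw [h0] at this
    exact h12.ne this)
  refine ⟨hv, fun s hs => ?_, (hN.tendsto_of_vel_pos hQ h12 h2 hpos h0 hv).1⟩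
  exact (hN.mem_Ioo_of_vel_pos h12 h2 h0 (t := s + 1) fun u hu => hv u hu.1).2 s
    ⟨hs, by linarith⟩

theorem vel_nonneg (hN : IsNewton Q r v) {T : ℝ} (hT : 0 < T) (hv : ∀ s ∈ Ioo 0 T, 0 < v s)
    {s : ℝ} (hs : s ∈ Icc 0 T) : 0 ≤ v s := by
  have h1 : closure (Ioo 0 T) ⊆ {s | 0 ≤ v s} :=
    closure_minimal (fun s hs => (hv s hs).le) (isClosed_le continuous_const hN.continuous_vel)
  rw [closure_Ioo hT.ne] at h1
  exact h1 hs

/-- The motion between two simple zeros of `Q` is periodic and traverses the closed phase curve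
`w² = Q(x)`, `x₁ ≤ x ≤ x₂`, exactly once in each period. -/
theorem periodic_phase (hQ : IsPotential Q) (hN : IsNewton Q r v) {x₁ x₂ T : ℝ}
    (h12 : x₁ < x₂) (h1 : Q x₁ = 0) (h2 : Q x₂ = 0) (h0 : r 0 = x₁) (hT : 0 < T)
    (hrT : r T = x₂) (hv : ∀ s ∈ Ioo 0 T, 0 < v s) :
    (∀ s, r (s + 2 * T) = r s ∧ v (s + 2 * T) = v s) ∧ (∀ s, r s ∈ Icc x₁ x₂) ∧
    (∀ x ∈ Icc x₁ x₂, ∀ w, w ^ 2 = Q x → ∃ s ∈ Ico 0 (2 * T), r s = x ∧ v s = w) ∧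
    (∀ s ∈ Ico 0 (2 * T), ∀ t ∈ Ico 0 (2 * T), r s = r t → v s = v t → s = t) := by
  obtain ⟨hm, hin⟩ := hN.mem_Ioo_of_vel_pos h12 h2 h0 hv
  have v0 : v 0 = 0 := hN.vel_eq_zero (by rw [h0, h1])
  have vT : v T = 0 := hN.vel_eq_zero (by rw [hrT, h2])
  have hs0 := hN.symm_of_vel_eq_zero hQ v0
  have hsT := hN.symm_of_vel_eq_zero hQ vT
  -- the reflections of time at the two turning points `0` and `T` compose to the translation by
  -- `2T`
  have fold : ∀ s, r (2 * T - s) = r s ∧ v (2 * T - s) = -v s := by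
    intro s
    have := hsT (s - T)
    rw [show T - (s - T) = 2 * T - s by ring, show T + (s - T) = s by ring] at this
    exact this
  have hper : ∀ s, r (s + 2 * T) = r s ∧ v (s + 2 * T) = v s := by
    intro s
    have a := fold (-s)
    have b := hs0 s
    rw [zero_sub, zero_add] at b
    rw [show 2 * T - -s = s + 2 * T by ring, b.1, b.2, neg_neg] at a
    exact a
  have hIcc : ∀ s ∈ Icc 0 T, r s ∈ Icc x₁ x₂ := by
    intro s hs
    rw [← h0, ← hrT]
    exact ⟨hm.monotoneOn ⟨le_rfl, hT.le⟩ hs hs.1, hm.monotoneOn hs ⟨hT.le, le_rfl⟩ hs.2⟩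
  have vneg : ∀ s ∈ Ioo T (2 * T), v s < 0 := by
    intro s hs
    have := (fold s).2
    have h3 := hv (2 * T - s) ⟨by linarith [hs.2], by linarith [hs.1]⟩
    linarith
  refine ⟨hper, ?_, ?_, ?_⟩
  · intro s
    have hp : Function.Periodic r (2 * T) := fun s => (hper s).1
    obtain ⟨t, ht, hst⟩ := hp.exists_mem_Ico₀ (by linarith) s
    rw [hst]
    rcases le_total t T with h | h
    · exact hIcc t ⟨ht.1, h⟩
    · rw [← (fold t).1]
      exact hIcc _ ⟨by linarith [ht.2], by linarith⟩
  · intro x hx w hw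
    obtain ⟨s, hs, hsx⟩ := intermediate_value_Icc hT.le hN.continuous_pos.continuousOn
      (show x ∈ Icc (r 0) (r T) by rwa [h0, hrT])
    have hvs := hN.vel_nonneg hT hv hs
    have hsq : v s ^ 2 = w ^ 2 := by rw [hN.energy, hsx, hw]
    rcases sq_eq_sq_iff_eq_or_eq_neg.1 hsq with h | h
    · exact ⟨s, ⟨hs.1, by linarith [hs.2]⟩, hsx, h⟩
    · rcases eq_or_ne w 0 with hw0 | hw0
      · exact ⟨s, ⟨hs.1, by linarith [hs.2]⟩, hsx, by rw [h, hw0, neg_zero]⟩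
      · have hs0 : s ≠ 0 := by
          rintro rfl
          rw [v0] at h
          exact hw0 (by linarith)
        refine ⟨2 * T - s, ⟨by linarith [hs.2], ?_⟩, by rw [(fold s).1, hsx], by
          rw [(fold s).2, h, neg_neg]⟩
        have : 0 < s := lt_of_le_of_ne hs.1 (Ne.symm hs0)
        linarith
  · have key : ∀ s ∈ Icc 0 T, ∀ t ∈ Icc 0 T, r s = r t → s = t := fun s hs t ht h =>
      hm.injOn hs ht h
    intro s hs t ht hr hvv
    rcases le_or_gt s T with h | h <;> rcases le_or_gt t T with h' | h'
    · exact key s ⟨hs.1, h⟩ t ⟨ht.1, h'⟩ hr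
    · have a := hN.vel_nonneg hT hv (s := s) ⟨hs.1, h⟩
      have b := vneg t ⟨h', ht.2⟩
      linarith
    · have a := hN.vel_nonneg hT hv (s := t) ⟨ht.1, h'⟩
      have b := vneg s ⟨h, hs.2⟩
      linarith
    · have := key (2 * T - s) ⟨by linarith [hs.2], by linarith⟩ (2 * T - t)
        ⟨by linarith [ht.2], by linarith⟩ (by rw [(fold s).1, (fold t).1, hr])
      linarith

/-- The motion from a simple zero `x₁` of `Q` towards a critical zero `x₂` is asymptotic to `x₂` in
both time directions and traverses the loop `w² = Q(x)`, `x₁ ≤ x < x₂`. -/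
theorem homoclinic_phase (hQ : IsPotential Q) (hN : IsNewton Q r v) {x₁ x₂ : ℝ}
    (h12 : x₁ < x₂) (h1 : Q x₁ = 0) (h2 : Q x₂ = 0) (hpos : ∀ x ∈ Ioo x₁ x₂, 0 < Q x)
    (hd1 : 0 < deriv Q x₁) (hd2 : deriv Q x₂ = 0) (h0 : r 0 = x₁) :
    Tendsto r atTop (𝓝 x₂) ∧ Tendsto r atBot (𝓝 x₂) ∧ (∀ s, r s ∈ Ico x₁ x₂) ∧
    (∀ x ∈ Ico x₁ x₂, ∀ w, w ^ 2 = Q x → ∃ s, r s = x ∧ v s = w) := by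
  obtain ⟨hv, hin, hlim⟩ := hN.homoclinic hQ h12 h1 h2 hpos hd1 hd2 h0
  have v0 : v 0 = 0 := hN.vel_eq_zero (by rw [h0, h1])
  have hs0 : ∀ s, r (-s) = r s ∧ v (-s) = -v s := by
    simpa using hN.symm_of_vel_eq_zero hQ v0
  have hin' : ∀ s, s ≠ 0 → r s ∈ Ioo x₁ x₂ := by
    intro s hs
    rcases hs.lt_or_gt with h | h
    · rw [← (hs0 s).1]; exact hin _ (by linarith)
    · exact hin s h
  refine ⟨hlim, ?_, ?_, ?_⟩
  · exact (hlim.comp tendsto_neg_atBot_atTop).congr fun s => (hs0 s).1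
  · intro s
    rcases eq_or_ne s 0 with rfl | h
    · rw [h0]; exact ⟨le_rfl, h12⟩
    · exact Ioo_subset_Ico_self (hin' s h)
  · intro x hx w hw
    obtain ⟨t, ht0, htx⟩ := ((eventually_ge_atTop 0).and
      (hlim.eventually (lt_mem_nhds hx.2))).exists
    obtain ⟨s, hs, hsx⟩ := intermediate_value_Icc ht0 hN.continuous_pos.continuousOn
      (show x ∈ Icc (r 0) (r t) from ⟨by rw [h0]; exact hx.1, htx.le⟩)
    have hsq : v s ^ 2 = w ^ 2 := by rw [hN.energy, hsx, hw]
    rcases sq_eq_sq_iff_eq_or_eq_neg.1 hsq with h | h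
    · exact ⟨s, hsx, h⟩
    · exact ⟨-s, by rw [(hs0 s).1, hsx], by rw [(hs0 s).2, h, neg_neg]⟩

end IsNewton

/-! ### The level set `G = C` as a curve over the `r`-axis -/

/-- The polynomial `P(r) = 4C - 4r + a r²`; on the level set `G = C` the TreadmillSled satisfies
`8 ξ₂ = P(r) √(1 + ω² ξ₁²)`, where `r = ξ₁² + ξ₂²`. -/
def levelP (a C r : ℝ) : ℝ := 4 * C + r * (-4 + a * r)

/-- The denominator `D(r) = 64 + ω² P(r)²`. -/
def levelD (a C ω r : ℝ) : ℝ := 64 + levelP a C r ^ 2 * ω ^ 2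

/-- The coordinate `ξ₂` on the level set `G = C`, as a function of `r = ξ₁² + ξ₂²`. -/
def levelS (a C ω r : ℝ) : ℝ :=
  levelP a C r * Real.sqrt (1 + r * ω ^ 2) / Real.sqrt (levelD a C ω r)

/-- The curvature of a profile curve on the level set `G = C`, as a function of its squared distance
`r` to the origin. It equals twice the derivative of `levelS`. -/
def levelK (a C ω r : ℝ) : ℝ :=
  ω ^ 2 * levelS a C ω r / (1 + r * ω ^ 2)
    + 128 * (2 * a * r - 4) * Real.sqrt (1 + r * ω ^ 2) / Real.sqrt (levelD a C ω r) ^ 3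

/-- The function `Q = 4 q / D`; on the level set `G = C` the squared distance `r` to the origin
satisfies `r'² = Q(r)`. -/
def levelQ (a C ω r : ℝ) : ℝ := 4 * (q a C).eval r / levelD a C ω r

theorem levelD_pos (a C ω r : ℝ) : 0 < levelD a C ω r := by unfold levelD; positivity

theorem sqrt_levelD_pos (a C ω r : ℝ) : 0 < Real.sqrt (levelD a C ω r) :=
  Real.sqrt_pos.2 (levelD_pos a C ω r)

theorem one_add_pos {r : ℝ} (hr : 0 ≤ r) (ω : ℝ) : 0 < 1 + r * ω ^ 2 := by positivity

/-- `q` factors as `(8√r - P)(8√r + P)`: on the level set `|ξ₂| ≤ √r` amounts to `q ≥ 0`. -/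
theorem q_eval (a C r : ℝ) : (q a C).eval r = 64 * r - levelP a C r ^ 2 := by
  simp only [q, levelP, Polynomial.eval_add, Polynomial.eval_sub, Polynomial.eval_mul,
    Polynomial.eval_C, Polynomial.eval_X, Polynomial.eval_pow]
  ring

theorem q_derivative_eval (a C r : ℝ) :
    (q a C).derivative.eval r = 64 - 2 * levelP a C r * (2 * a * r - 4) := by
  simp only [q, levelP, Polynomial.derivative_add, Polynomial.derivative_sub,
    Polynomial.derivative_C_mul, Polynomial.derivative_C, Polynomial.derivative_X,
    Polynomial.derivative_X_pow, Polynomial.eval_add, Polynomial.eval_sub, Polynomial.eval_mul,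
    Polynomial.eval_C, Polynomial.eval_X, Polynomial.eval_pow, Polynomial.eval_zero,
    Polynomial.eval_one]
  push_cast
  ring

theorem nonneg_of_q_nonneg {a C r : ℝ} (h : 0 ≤ (q a C).eval r) : 0 ≤ r := by
  rw [q_eval] at h
  nlinarith [sq_nonneg (levelP a C r)]

theorem levelQ_nonneg_iff {a C ω r : ℝ} : 0 ≤ levelQ a C ω r ↔ 0 ≤ (q a C).eval r := by
  unfold levelQ
  rw [le_div_iff₀ (levelD_pos a C ω r), zero_mul]
  constructor <;> intro h <;> linarith

theorem levelQ_pos_iff {a C ω r : ℝ} : 0 < levelQ a C ω r ↔ 0 < (q a C).eval r := by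
  unfold levelQ
  rw [lt_div_iff₀ (levelD_pos a C ω r), zero_mul]
  constructor <;> intro h <;> linarith

/-- Since `r' = 2 ξ₁` along a profile curve, `Q = 4 (r - ξ₂²)` is `r'²`. -/
theorem levelQ_eq_zero_iff {a C ω r : ℝ} : levelQ a C ω r = 0 ↔ (q a C).eval r = 0 := by
  unfold levelQ
  rw [div_eq_zero_iff]
  have := (levelD_pos a C ω r).ne'
  simp [this]

theorem levelS_sq {a C ω r : ℝ} (hr : 0 ≤ r) :
    levelS a C ω r ^ 2 = r - (q a C).eval r / levelD a C ω r := by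
  have hD := levelD_pos a C ω r
  rw [q_eval, levelS, div_pow, mul_pow, Real.sq_sqrt (one_add_pos hr ω).le, Real.sq_sqrt hD.le]
  field_simp
  unfold levelD
  ring

theorem levelQ_eq {a C ω r : ℝ} (hr : 0 ≤ r) :
    levelQ a C ω r = 4 * (r - levelS a C ω r ^ 2) := by
  rw [levelS_sq hr, levelQ]
  ring

theorem hasDerivAt_levelP (a C r : ℝ) : HasDerivAt (levelP a C) (2 * a * r - 4) r := by
  have h := (((hasDerivAt_id r).const_mul a).const_add (-4))
  exact (((hasDerivAt_id r).mul h).const_add (4 * C)).congr_deriv (by simp; ring)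

/-- The curvature is twice the derivative of `ξ₂` with respect to `r`; this is the equation `ξ₂' = k
ξ₁` on the level set, because `r' = 2 ξ₁`. -/
theorem hasDerivAt_levelS {a C ω r : ℝ} (hr : 0 ≤ r) :
    HasDerivAt (levelS a C ω) (levelK a C ω r / 2) r := by
  have hB := one_add_pos hr ω
  have hD := levelD_pos a C ω r
  have hP := hasDerivAt_levelP a C r
  have hB' : HasDerivAt (fun r => 1 + r * ω ^ 2) (ω ^ 2) r := by
    simpa using ((hasDerivAt_id r).mul_const (ω ^ 2)).const_add 1
  have hD' : HasDerivAt (levelD a C ω) (2 * levelP a C r * (2 * a * r - 4) * ω ^ 2) r :=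
    (((hP.pow 2).mul_const (ω ^ 2)).const_add 64).congr_deriv (by push_cast; ring)
  have h := (hP.mul (hB'.sqrt hB.ne')).div (hD'.sqrt hD.ne') (sqrt_levelD_pos a C ω r).ne'
  refine h.congr_deriv ?_
  have sB : Real.sqrt (1 + r * ω ^ 2) ^ 2 = 1 + r * ω ^ 2 := Real.sq_sqrt hB.le
  have sD : Real.sqrt (levelD a C ω r) ^ 2 = 64 + levelP a C r ^ 2 * ω ^ 2 := Real.sq_sqrt hD.le
  have pB := Real.sqrt_pos.2 hB
  have pD := sqrt_levelD_pos a C ω r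
  simp only [levelK, levelS, Pi.mul_apply]
  generalize Real.sqrt (1 + r * ω ^ 2) = b at *
  generalize Real.sqrt (levelD a C ω r) = e at *
  generalize levelP a C r = p at *
  rw [← sB]
  field_simp
  have sD' : p ^ 2 * ω ^ 2 = e ^ 2 - 64 := by linarith
  linear_combination (-(2 * b ^ 2 * (2 * a * r - 4))) * sD'

theorem exists_hasDerivAt_levelQ (a C ω r : ℝ) : ∃ d, HasDerivAt (levelQ a C ω) d r ∧
    ((q a C).eval r = 0 → d = 4 * (q a C).derivative.eval r / levelD a C ω r) := by
  have hD := levelD_pos a C ω r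
  have hD' : HasDerivAt (levelD a C ω) (2 * levelP a C r * (2 * a * r - 4) * ω ^ 2) r :=
    ((((hasDerivAt_levelP a C r).pow 2).mul_const (ω ^ 2)).const_add 64).congr_deriv
      (by push_cast; ring)
  refine ⟨_, (((q a C).hasDerivAt r).const_mul 4).div hD' hD.ne', fun h => ?_⟩
  rw [h]
  field_simp
  ring

/-- At a root of `q`, the derivative of `Q` is a positive multiple of that of `q`. -/
theorem deriv_levelQ_of_root {a C ω r : ℝ} (h : (q a C).eval r = 0) :
    deriv (levelQ a C ω) r = 4 * (q a C).derivative.eval r / levelD a C ω r := by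
  obtain ⟨d, hd, hd'⟩ := exists_hasDerivAt_levelQ a C ω r
  rw [hd.deriv, hd' h]

theorem contDiff_levelQ (a C ω : ℝ) : ContDiff ℝ 2 (levelQ a C ω) := by
  have h1 : ContDiff ℝ 2 (fun r => (q a C).eval r) := by
    simp only [q_eval, levelP]; fun_prop
  have h2 : ContDiff ℝ 2 (levelD a C ω) := by
    unfold levelD levelP; fun_prop
  exact (contDiff_const.mul h1).div h2 fun r => (levelD_pos a C ω r).ne'

/-- The derivative of `Q` in terms of the curvature; this turns `ξ₁' = 1 - k ξ₂` into Newton's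
equation for `r`. -/
theorem deriv_levelQ {a C ω r : ℝ} (hr : 0 ≤ r) :
    deriv (levelQ a C ω) r = 4 * (1 - levelK a C ω r * levelS a C ω r) := by
  have h1 : HasDerivAt (fun r => 4 * (r - levelS a C ω r ^ 2))
      (4 * (1 - levelK a C ω r * levelS a C ω r)) r :=
    (((hasDerivAt_id r).sub ((hasDerivAt_levelS hr).pow 2)).const_mul 4).congr_deriv
      (by push_cast; ring)
  have h2 : HasDerivAt (levelQ a C ω) (deriv (levelQ a C ω) r) r :=
    ((contDiff_levelQ a C ω).differentiable (by norm_num) r).hasDerivAt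
  -- At the end point `r = 0` only the right derivatives can be compared.
  exact (uniqueDiffWithinAt_Ici r).eq_deriv (Ici r) h2.hasDerivWithinAt
    (h1.hasDerivWithinAt.congr (fun x hx => levelQ_eq (hr.trans hx)) (levelQ_eq hr))

/-- The region `q ≥ 0` is bounded: there `P² ≤ 64 r`, whereas `P` grows like `a r²`. -/
theorem abs_le_of_q_nonneg {a C r : ℝ} (ha : a ≠ 0) (h : 0 ≤ (q a C).eval r) :
    |r| ≤ 1 + (21 + 4 * |C|) / |a| := by
  have hr := nonneg_of_q_nonneg h
  rw [q_eval] at h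
  have ha' : 0 < |a| := abs_pos.2 ha
  rw [abs_of_nonneg hr]
  rcases le_total r 1 with h1 | h1
  · have : 0 ≤ (21 + 4 * |C|) / |a| := by positivity
    linarith
  -- `P² ≤ 64 r ≤ (r + 16)²`
  have hP : |levelP a C r| ≤ r + 16 :=
    abs_le_of_sq_le_sq (by nlinarith [sq_nonneg (r - 16)]) (by linarith)
  have h2 : |a| * r ^ 2 ≤ (r + 16) + 4 * r + 4 * |C| := by
    have h3 : |a * r ^ 2| = |a| * r ^ 2 := by rw [abs_mul, abs_of_nonneg (sq_nonneg r)]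
    rw [← h3]
    have h4 : a * r ^ 2 = levelP a C r + 4 * r - 4 * C := by unfold levelP; ring
    rw [h4]
    refine (abs_sub _ _).trans ?_
    have h5 := abs_add_le (levelP a C r) (4 * r)
    rw [abs_of_nonneg (show 0 ≤ 4 * r by linarith)] at h5
    have h6 : |4 * C| = 4 * |C| := by rw [abs_mul]; norm_num
    linarith
  have h7 : r ≤ (21 + 4 * |C|) / |a| := by
    rw [le_div_iff₀ ha']
    nlinarith [abs_nonneg C]
  linarith

theorem isPotential_levelQ {a : ℝ} (ha : a ≠ 0) (C ω : ℝ) : IsPotential (levelQ a C ω) :=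
  ⟨contDiff_levelQ a C ω, _, fun _ hx => abs_le_of_q_nonneg ha (levelQ_nonneg_iff.1 hx)⟩

theorem continuousOn_levelK (a C ω : ℝ) : ContinuousOn (levelK a C ω) (Ici 0) := by
  have h1 : ContinuousOn (levelS a C ω) (Ici 0) := fun r hr =>
    (hasDerivAt_levelS hr).continuousAt.continuousWithinAt
  have h2 : Continuous (levelD a C ω) := by unfold levelD levelP; fun_prop
  unfold levelK
  refine ContinuousOn.add (ContinuousOn.div (continuousOn_const.mul h1) (by fun_prop) ?_)
    (ContinuousOn.div (by fun_prop) (by fun_prop) ?_)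
  · exact fun r hr => (one_add_pos hr ω).ne'
  · exact fun r _ => (pow_pos (sqrt_levelD_pos a C ω r) 3).ne'

/-! ### Profile curves on a level set -/

/-- `(x, y)` is a unit speed curve with unit tangent `(c, d)` whose TreadmillSled lies on the level
set `G = C` and whose curvature is the one prescribed there. -/
structure IsProfile (a C ω : ℝ) (x y c d : ℝ → ℝ) : Prop where
  hx : ∀ s, HasDerivAt x (c s) s
  hy : ∀ s, HasDerivAt y (d s) s
  hc : ∀ s, HasDerivAt c (-(levelK a C ω (x s ^ 2 + y s ^ 2) * d s)) s
  hd : ∀ s, HasDerivAt d (levelK a C ω (x s ^ 2 + y s ^ 2) * c s) s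
  unit : ∀ s, c s ^ 2 + d s ^ 2 = 1
  level : ∀ s, x s * d s - y s * c s = levelS a C ω (x s ^ 2 + y s ^ 2)

/-- A point of the unit circle is of the form `(cos δ, sin δ)`. -/
theorem exists_cos_sin {A B : ℝ} (h : A ^ 2 + B ^ 2 = 1) :
    ∃ δ, A = Real.cos δ ∧ B = Real.sin δ := by
  have hz : ‖(⟨A, B⟩ : ℂ)‖ = 1 := by
    rw [Complex.norm_eq_sqrt_sq_add_sq, h, Real.sqrt_one]
  have h1 := Complex.norm_mul_cos_arg ⟨A, B⟩
  have h2 := Complex.norm_mul_sin_arg ⟨A, B⟩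
  rw [hz, one_mul] at h1 h2
  exact ⟨_, h1.symm, h2.symm⟩

namespace IsProfile

variable {a C ω : ℝ} {x y c d x' y' c' d' : ℝ → ℝ}

theorem shift (hp : IsProfile a C ω x y c d) (b : ℝ) :
    IsProfile a C ω (fun s => x (s + b)) (fun s => y (s + b)) (fun s => c (s + b))
      (fun s => d (s + b)) :=
  ⟨fun s => (hp.hx (s + b)).comp_add_const s b, fun s => (hp.hy (s + b)).comp_add_const s b,
    fun s => (hp.hc (s + b)).comp_add_const s b, fun s => (hp.hd (s + b)).comp_add_const s b,
    fun _ => hp.unit _, fun _ => hp.level _⟩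

/-- The squared distance to the origin moves by Newton's equation in the potential `-Q`. -/
theorem isNewton (hp : IsProfile a C ω x y c d) :
    IsNewton (levelQ a C ω) (fun s => x s ^ 2 + y s ^ 2)
      (fun s => 2 * (x s * c s + y s * d s)) := by
  refine ⟨fun s => ?_, fun s => ?_, fun s => ?_⟩
  · exact (((hp.hx s).pow 2).add ((hp.hy s).pow 2)).congr_deriv (by push_cast; ring)
  · have h := ((((hp.hx s).mul (hp.hc s)).add ((hp.hy s).mul (hp.hd s))).const_mul 2)
    refine h.congr_deriv ?_
    rw [deriv_levelQ (by positivity)]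
    have h1 := hp.unit s
    have h2 := hp.level s
    linear_combination 2 * h1 - 2 * levelK a C ω (x s ^ 2 + y s ^ 2) * h2
  · rw [levelQ_eq (by positivity)]
    rw [← hp.level]
    linear_combination 4 * (x s ^ 2 + y s ^ 2) * hp.unit s

/-- Two profile curves with the same phase curve differ by a rotation. -/
theorem exists_rotation (hp : IsProfile a C ω x y c d) (hp' : IsProfile a C ω x' y' c' d')
    (hr : ∀ s, x' s ^ 2 + y' s ^ 2 = x s ^ 2 + y s ^ 2)
    (hv : ∀ s, x' s * c' s + y' s * d' s = x s * c s + y s * d s) :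
    ∃ δ, ∀ s, c' s = Real.cos δ * c s - Real.sin δ * d s ∧
      d' s = Real.sin δ * c s + Real.cos δ * d s ∧
      x' s = Real.cos δ * x s - Real.sin δ * y s ∧
      y' s = Real.sin δ * x s + Real.cos δ * y s := by
  -- Both curves have the same curvature, so the angle between their tangents, with cosine `A` and
  -- sine `B`, is constant. The position is recovered from the tangent and the TreadmillSled.
  set A : ℝ → ℝ := fun s => c s * c' s + d s * d' s with hA
  set B : ℝ → ℝ := fun s => c s * d' s - d s * c' s with hB
  have dA : ∀ s, HasDerivAt A 0 s := fun s => by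
    have h := ((hp.hc s).mul (hp'.hc s)).add ((hp.hd s).mul (hp'.hd s))
    rw [hr s] at h
    exact h.congr_deriv (by ring)
  have dB : ∀ s, HasDerivAt B 0 s := fun s => by
    have h := ((hp.hc s).mul (hp'.hd s)).sub ((hp.hd s).mul (hp'.hc s))
    rw [hr s] at h
    exact h.congr_deriv (by ring)
  have cA : ∀ s, A s = A 0 := fun s => is_const_of_deriv_eq_zero
    (fun s => (dA s).differentiableAt) (fun s => (dA s).deriv) s 0
  have cB : ∀ s, B s = B 0 := fun s => is_const_of_deriv_eq_zero
    (fun s => (dB s).differentiableAt) (fun s => (dB s).deriv) s 0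
  have hAB : A 0 ^ 2 + B 0 ^ 2 = 1 := by
    simp only [hA, hB]
    linear_combination (c' 0 ^ 2 + d' 0 ^ 2) * hp.unit 0 + hp'.unit 0
  obtain ⟨δ, hδA, hδB⟩ := exists_cos_sin hAB
  refine ⟨δ, fun s => ?_⟩
  have eA : c s * c' s + d s * d' s = Real.cos δ := by rw [← hδA, ← cA s]
  have eB : c s * d' s - d s * c' s = Real.sin δ := by rw [← hδB, ← cB s]
  have u := hp.unit s
  have u' := hp'.unit s
  have hc' : c' s = Real.cos δ * c s - Real.sin δ * d s := by
    rw [← eA, ← eB]; linear_combination (-c' s) * u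
  have hd' : d' s = Real.sin δ * c s + Real.cos δ * d s := by
    rw [← eA, ← eB]; linear_combination (-d' s) * u
  have l := hp.level s
  have l' := hp'.level s
  rw [hr s, ← l] at l'
  have hvs := hv s
  have ex : x' s = (x s * c s + y s * d s) * c' s + (x s * d s - y s * c s) * d' s := by
    linear_combination (-x' s) * u' + c' s * hvs + d' s * l'
  have ey : y' s = (x s * c s + y s * d s) * d' s - (x s * d s - y s * c s) * c' s := by
    linear_combination (-y' s) * u' + d' s * hvs - c' s * l'
  refine ⟨hc', hd', ?_, ?_⟩
  · rw [ex, hc', hd']; linear_combination (Real.cos δ * x s - Real.sin δ * y s) * u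
  · rw [ey, hc', hd']; linear_combination (Real.sin δ * x s + Real.cos δ * y s) * u

/-- Two profile curves whose TreadmillSleds meet are congruent. -/
theorem exists_rotation_shift (ha : a ≠ 0) (hp : IsProfile a C ω x y c d)
    (hp' : IsProfile a C ω x' y' c' d') {b b' : ℝ}
    (hr : x' b' ^ 2 + y' b' ^ 2 = x b ^ 2 + y b ^ 2)
    (hv : x' b' * c' b' + y' b' * d' b' = x b * c b + y b * d b) :
    ∃ δ, ∀ s, c' (s + b') = Real.cos δ * c (s + b) - Real.sin δ * d (s + b) ∧
      d' (s + b') = Real.sin δ * c (s + b) + Real.cos δ * d (s + b) ∧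
      x' (s + b') = Real.cos δ * x (s + b) - Real.sin δ * y (s + b) ∧
      y' (s + b') = Real.sin δ * x (s + b) + Real.cos δ * y (s + b) := by
  have hu := hp'.isNewton.unique (isPotential_levelQ ha C ω) hp.isNewton hr
    (by simp only [hv])
  exact exists_rotation (hp.shift b) (hp'.shift b') (fun s => (hu s).1)
    (fun s => by linarith [(hu s).2])

end IsProfile

/-- A motion in the potential `Q` lifts to a profile curve: its TreadmillSled is `(v/2, S(r))`, and
the direction of its tangent is the integral of the curvature. -/
theorem exists_isProfile {a C ω : ℝ} {r v : ℝ → ℝ} (hN : IsNewton (levelQ a C ω) r v) :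
    ∃ x y c d, IsProfile a C ω x y c d ∧ (∀ s, x s ^ 2 + y s ^ 2 = r s) ∧
      ∀ s, 2 * (x s * c s + y s * d s) = v s := by
  have hr : ∀ s, 0 ≤ r s := fun s => nonneg_of_q_nonneg (C := C) (a := a)
    (levelQ_nonneg_iff (ω := ω).1 (by rw [← hN.energy]; positivity))
  have hk : Continuous fun s => levelK a C ω (r s) :=
    (continuousOn_levelK a C ω).comp_continuous hN.continuous_pos fun s => hr s
  set θ : ℝ → ℝ := fun s => ∫ t in (0 : ℝ)..s, levelK a C ω (r t) with hθ
  have dθ : ∀ s, HasDerivAt θ (levelK a C ω (r s)) s := fun s =>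
    intervalIntegral.integral_hasDerivAt_right (hk.intervalIntegrable _ _)
      hk.aestronglyMeasurable.stronglyMeasurableAtFilter hk.continuousAt
  have dc := fun s => (dθ s).cos
  have dd := fun s => (dθ s).sin
  have dS : ∀ s, HasDerivAt (fun s => levelS a C ω (r s)) (levelK a C ω (r s) / 2 * v s) s :=
    fun s => (hasDerivAt_levelS (hr s)).comp s (hN.deriv_pos s)
  have dv : ∀ s, HasDerivAt (fun s => v s / 2)
      (1 - levelK a C ω (r s) * levelS a C ω (r s)) s := fun s =>
    ((hN.deriv_vel s).div_const 2).congr_deriv (by rw [deriv_levelQ (hr s)]; ring)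
  have cs := fun s => Real.cos_sq_add_sin_sq (θ s)
  set x : ℝ → ℝ := fun s => v s / 2 * Real.cos (θ s) + levelS a C ω (r s) * Real.sin (θ s)
    with hx
  set y : ℝ → ℝ := fun s => v s / 2 * Real.sin (θ s) - levelS a C ω (r s) * Real.cos (θ s)
    with hy
  have hxy : ∀ s, x s ^ 2 + y s ^ 2 = r s := fun s => by
    have h1 := hN.energy s
    rw [levelQ_eq (hr s)] at h1
    simp only [hx, hy]
    linear_combination (v s ^ 2 / 4 + levelS a C ω (r s) ^ 2) * cs s + h1 / 4
  refine ⟨x, y, fun s => Real.cos (θ s), fun s => Real.sin (θ s),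
    ⟨fun s => ?_, fun s => ?_, fun s => ?_, fun s => ?_, cs, fun s => ?_⟩, hxy, fun s => ?_⟩
  · exact (((dv s).mul (dc s)).add ((dS s).mul (dd s))).congr_deriv (by ring)
  · exact (((dv s).mul (dd s)).sub ((dS s).mul (dc s))).congr_deriv (by ring)
  · rw [hxy]; exact (dc s).congr_deriv (by ring)
  · rw [hxy]; exact (dd s).congr_deriv (by ring)
  · rw [hxy]; simp only [hx, hy]; linear_combination levelS a C ω (r s) * cs s
  · simp only [hx, hy]; linear_combination v s * cs s

/-! ### Helicoidal surfaces: the mean curvature equation as an equation for the profile curve -/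

theorem hasDerivAt_euclidean_iff {n : ℕ} {f : ℝ → EuclideanSpace ℝ (Fin n)}
    {f' : EuclideanSpace ℝ (Fin n)} {s : ℝ} :
    HasDerivAt f f' s ↔ ∀ i, HasDerivAt (fun s => f s i) (f' i) s := by
  rw [hasDerivAt_iff_hasFDerivAt, ← hasFDerivWithinAt_univ, hasFDerivWithinAt_euclidean]
  refine forall_congr' fun i => ?_
  rw [hasFDerivWithinAt_univ, hasDerivAt_iff_hasFDerivAt]
  congr!

theorem hasDerivAt_vec3 {f g h : ℝ → ℝ} {f' g' h' s : ℝ} (hf : HasDerivAt f f' s)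
    (hg : HasDerivAt g g' s) (hh : HasDerivAt h h' s) :
    HasDerivAt (fun s => (!₂[f s, g s, h s] : E3)) !₂[f', g', h'] s := by
  rw [hasDerivAt_euclidean_iff]
  intro i
  fin_cases i
  · exact hf
  · exact hg
  · exact hh

theorem hasDerivAt_vec2 {f g : ℝ → ℝ} {f' g' s : ℝ} (hf : HasDerivAt f f' s)
    (hg : HasDerivAt g g' s) :
    HasDerivAt (fun s => (!₂[f s, g s] : E2)) !₂[f', g'] s := by
  rw [hasDerivAt_euclidean_iff]
  intro i
  fin_cases i
  · exact hf
  · exact hg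

theorem inner_vec3 (a b c a' b' c' : ℝ) :
    inner ℝ (!₂[a, b, c] : E3) !₂[a', b', c'] = a * a' + b * b' + c * c' := by
  rw [PiLp.inner_apply, Fin.sum_univ_three]
  simp
  ring

theorem norm_vec2_sq (v : E2) : ‖v‖ ^ 2 = v 0 ^ 2 + v 1 ^ 2 := by
  rw [EuclideanSpace.norm_sq_eq, Fin.sum_univ_two]
  simp

/-- The mean curvature of the helicoidal surface whose profile curve has tangent `(c, d)` and
curvature `k`. -/
theorem two_mul_meanCurvature_helicoidal {ω : ℝ} {α : ℝ → E2} {c d k : ℝ → ℝ}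
    (hx : ∀ s, HasDerivAt (fun s => α s 0) (c s) s)
    (hy : ∀ s, HasDerivAt (fun s => α s 1) (d s) s)
    (hc : ∀ s, HasDerivAt c (-(k s * d s)) s) (hd : ∀ s, HasDerivAt d (k s * c s) s)
    (hu : ∀ s, c s ^ 2 + d s ^ 2 = 1) (p : ℝ × ℝ) :
    2 * meanCurvature (helicoidal ω α) p =
      (ω ^ 2 * (α p.1 0 * d p.1 - α p.1 1 * c p.1)
        - k p.1 * (1 + ω ^ 2 * (α p.1 0 ^ 2 + α p.1 1 ^ 2)))
        / Real.sqrt (1 + ω ^ 2 * (α p.1 0 * c p.1 + α p.1 1 * d p.1) ^ 2) ^ 3 := by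
  have hcos : ∀ t, HasDerivAt (fun t => Real.cos (ω * t)) (-(ω * Real.sin (ω * t))) t := fun t =>
    ((hasDerivAt_id t).const_mul ω).cos.congr_deriv (by simp; ring)
  have hsin : ∀ t, HasDerivAt (fun t => Real.sin (ω * t)) (ω * Real.cos (ω * t)) t := fun t =>
    ((hasDerivAt_id t).const_mul ω).sin.congr_deriv (by simp; ring)
  -- the partial derivative in `s` of a vector rotated by the angle `-ωt`
  have rotS : ∀ {f g : ℝ → ℝ} {f' g' : ℝ} (h : ℝ → ℝ) (h' s t : ℝ), HasDerivAt f f' s →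
      HasDerivAt g g' s → HasDerivAt h h' s →
      HasDerivAt (fun s => (!₂[f s * Real.cos (ω * t) + g s * Real.sin (ω * t),
        -(f s) * Real.sin (ω * t) + g s * Real.cos (ω * t), h s] : E3))
        !₂[f' * Real.cos (ω * t) + g' * Real.sin (ω * t),
          -f' * Real.sin (ω * t) + g' * Real.cos (ω * t), h'] s := by
    intro f g f' g' h h' s t hf hg hh
    exact hasDerivAt_vec3 ((hf.mul_const _).add (hg.mul_const _))
      ((hf.neg.mul_const _).add (hg.mul_const _)) hh
  have rotT : ∀ (f g : ℝ) (h : ℝ → ℝ) (h' t : ℝ), HasDerivAt h h' t →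
      HasDerivAt (fun t => (!₂[f * Real.cos (ω * t) + g * Real.sin (ω * t),
        -f * Real.sin (ω * t) + g * Real.cos (ω * t), h t] : E3))
        !₂[(ω * g) * Real.cos (ω * t) + (-(ω * f)) * Real.sin (ω * t),
          -(ω * g) * Real.sin (ω * t) + (-(ω * f)) * Real.cos (ω * t), h'] t := by
    intro f g h h' t hh
    refine hasDerivAt_vec3 ?_ ?_ hh
    · exact (((hcos t).const_mul f).add ((hsin t).const_mul g)).congr_deriv (by ring)
    · exact (((hsin t).const_mul (-f)).add ((hcos t).const_mul g)).congr_deriv (by ring)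
  have eS : dS (helicoidal ω α) = fun p =>
      !₂[c p.1 * Real.cos (ω * p.2) + d p.1 * Real.sin (ω * p.2),
      -(c p.1) * Real.sin (ω * p.2) + d p.1 * Real.cos (ω * p.2), 0] := by
    funext p
    exact (rotS (fun _ => p.2) 0 p.1 p.2 (hx p.1) (hy p.1) (hasDerivAt_const _ _)).deriv
  have eT : dT (helicoidal ω α) = fun p =>
      !₂[(ω * α p.1 1) * Real.cos (ω * p.2) + (-(ω * α p.1 0)) * Real.sin (ω * p.2),
        -(ω * α p.1 1) * Real.sin (ω * p.2) + (-(ω * α p.1 0)) * Real.cos (ω * p.2), 1] := by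
    funext p
    exact (rotT (α p.1 0) (α p.1 1) (fun t => t) 1 p.2 (hasDerivAt_id _)).deriv
  have eSS : dS (dS (helicoidal ω α)) p =
      !₂[-(k p.1 * d p.1) * Real.cos (ω * p.2) + k p.1 * c p.1 * Real.sin (ω * p.2),
        -(-(k p.1 * d p.1)) * Real.sin (ω * p.2) + k p.1 * c p.1 * Real.cos (ω * p.2), 0] := by
    rw [eS]
    exact (rotS (fun _ => 0) 0 p.1 p.2 (hc p.1) (hd p.1) (hasDerivAt_const _ _)).deriv
  have eTS : dT (dS (helicoidal ω α)) p =
      !₂[(ω * d p.1) * Real.cos (ω * p.2) + (-(ω * c p.1)) * Real.sin (ω * p.2),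
        -(ω * d p.1) * Real.sin (ω * p.2) + (-(ω * c p.1)) * Real.cos (ω * p.2), 0] := by
    rw [eS]
    exact (rotT (c p.1) (d p.1) (fun _ => 0) 0 p.2 (hasDerivAt_const _ _)).deriv
  have eTT : dT (dT (helicoidal ω α)) p =
      !₂[(ω * (-(ω * α p.1 0))) * Real.cos (ω * p.2) + (-(ω * (ω * α p.1 1))) * Real.sin (ω * p.2),
        -(ω * (-(ω * α p.1 0))) * Real.sin (ω * p.2) + (-(ω * (ω * α p.1 1))) * Real.cos (ω * p.2),
        0] := by
    rw [eT]
    exact (rotT (ω * α p.1 1) (-(ω * α p.1 0)) (fun _ => 1) 0 p.2 (hasDerivAt_const _ _)).deriv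
  have hcs := Real.cos_sq_add_sin_sq (ω * p.2)
  have hus := hu p.1
  have eN : normalVec (helicoidal ω α) p =
      !₂[-(c p.1) * Real.sin (ω * p.2) + d p.1 * Real.cos (ω * p.2),
        -(c p.1 * Real.cos (ω * p.2) + d p.1 * Real.sin (ω * p.2)),
        -(ω * (α p.1 0 * c p.1 + α p.1 1 * d p.1))] := by
    unfold normalVec
    rw [eS, eT, cross_apply]
    congr 1
    funext i
    fin_cases i
    · simp
    · simp
    · simp
      linear_combination (-ω * (α p.1 0 * c p.1 + α p.1 1 * d p.1)) * hcs
  have hW : 0 < 1 + ω ^ 2 * (α p.1 0 * c p.1 + α p.1 1 * d p.1) ^ 2 := by positivity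
  have eNorm : ‖normalVec (helicoidal ω α) p‖ =
      Real.sqrt (1 + ω ^ 2 * (α p.1 0 * c p.1 + α p.1 1 * d p.1) ^ 2) := by
    rw [@norm_eq_sqrt_real_inner _ _ _, eN, inner_vec3]
    congr 1
    linear_combination (c p.1 ^ 2 + d p.1 ^ 2) * hcs + hus
  have eS' := congrFun eS p
  have eT' := congrFun eT p
  have sq : Real.sqrt (1 + ω ^ 2 * (α p.1 0 * c p.1 + α p.1 1 * d p.1) ^ 2) ^ 2 =
    1 + ω ^ 2 * (α p.1 0 * c p.1 + α p.1 1 * d p.1) ^ 2 := Real.sq_sqrt hW.le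
  have pos := Real.sqrt_pos.2 hW
  have gE : inner ℝ (dS (helicoidal ω α) p) (dS (helicoidal ω α) p) = 1 := by
    rw [eS', inner_vec3]
    linear_combination (c p.1 ^ 2 + d p.1 ^ 2) * hcs + hus
  have gF : inner ℝ (dS (helicoidal ω α) p) (dT (helicoidal ω α) p) =
      -ω * (α p.1 0 * d p.1 - α p.1 1 * c p.1) := by
    rw [eS', eT', inner_vec3]
    linear_combination (-ω * (α p.1 0 * d p.1 - α p.1 1 * c p.1)) * hcs
  have gG : inner ℝ (dT (helicoidal ω α) p) (dT (helicoidal ω α) p) =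
      1 + ω ^ 2 * (α p.1 0 ^ 2 + α p.1 1 ^ 2) := by
    rw [eT', inner_vec3]
    linear_combination (ω ^ 2 * (α p.1 0 ^ 2 + α p.1 1 ^ 2)) * hcs
  have ge : inner ℝ (dS (dS (helicoidal ω α)) p) (gaussMap (helicoidal ω α) p) =
      (Real.sqrt (1 + ω ^ 2 * (α p.1 0 * c p.1 + α p.1 1 * d p.1) ^ 2))⁻¹ * (-(k p.1)) := by
    rw [gaussMap, inner_smul_right, eNorm, eSS, eN, inner_vec3]
    congr 1
    linear_combination (-(k p.1) * (c p.1 ^ 2 + d p.1 ^ 2)) * hcs - k p.1 * hus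
  have gf : inner ℝ (dT (dS (helicoidal ω α)) p) (gaussMap (helicoidal ω α) p) =
      (Real.sqrt (1 + ω ^ 2 * (α p.1 0 * c p.1 + α p.1 1 * d p.1) ^ 2))⁻¹ * ω := by
    rw [gaussMap, inner_smul_right, eNorm, eTS, eN, inner_vec3]
    congr 1
    linear_combination (ω * (c p.1 ^ 2 + d p.1 ^ 2)) * hcs + ω * hus
  have gg : inner ℝ (dT (dT (helicoidal ω α)) p) (gaussMap (helicoidal ω α) p) =
      (Real.sqrt (1 + ω ^ 2 * (α p.1 0 * c p.1 + α p.1 1 * d p.1) ^ 2))⁻¹ *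
        (-(ω ^ 2 * (α p.1 0 * d p.1 - α p.1 1 * c p.1))) := by
    rw [gaussMap, inner_smul_right, eNorm, eTT, eN, inner_vec3]
    congr 1
    linear_combination (-(ω ^ 2 * (α p.1 0 * d p.1 - α p.1 1 * c p.1))) * hcs
  simp only [meanCurvature]
  rw [gE, gF, gG, ge, gf, gg]
  generalize Real.sqrt (1 + ω ^ 2 * (α p.1 0 * c p.1 + α p.1 1 * d p.1) ^ 2) = W at *
  have den : 1 * (1 + ω ^ 2 * (α p.1 0 ^ 2 + α p.1 1 ^ 2)) -
      (-ω * (α p.1 0 * d p.1 - α p.1 1 * c p.1)) ^ 2 = W ^ 2 := by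
    rw [sq]
    linear_combination (-ω ^ 2 * (α p.1 0 ^ 2 + α p.1 1 ^ 2)) * hus
  rw [den]
  field_simp
  ring

/-- The equation `2H = 1 - a R² / 2` as an equation for the curvature `k` of the profile curve. -/
theorem meanCurvature_eq_iff {a ω : ℝ} {α : ℝ → E2} {c d k : ℝ → ℝ}
    (hx : ∀ s, HasDerivAt (fun s => α s 0) (c s) s)
    (hy : ∀ s, HasDerivAt (fun s => α s 1) (d s) s)
    (hc : ∀ s, HasDerivAt c (-(k s * d s)) s) (hd : ∀ s, HasDerivAt d (k s * c s) s)
    (hu : ∀ s, c s ^ 2 + d s ^ 2 = 1) :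
    (∀ p, 2 * meanCurvature (helicoidal ω α) p =
      1 - a * (helicoidal ω α p 0 ^ 2 + helicoidal ω α p 1 ^ 2) / 2) ↔
    ∀ s, k s * (1 + ω ^ 2 * (α s 0 ^ 2 + α s 1 ^ 2)) = ω ^ 2 * (α s 0 * d s - α s 1 * c s)
      - Real.sqrt (1 + ω ^ 2 * (α s 0 * c s + α s 1 * d s) ^ 2) ^ 3
        * (1 - a * (α s 0 ^ 2 + α s 1 ^ 2) / 2) := by
  have hR : ∀ p, helicoidal ω α p 0 ^ 2 + helicoidal ω α p 1 ^ 2 =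
      α p.1 0 ^ 2 + α p.1 1 ^ 2 := fun p => by
    simp only [helicoidal, PiLp.toLp_apply, Matrix.cons_val_zero, Matrix.cons_val_one]
    linear_combination (α p.1 0 ^ 2 + α p.1 1 ^ 2) * Real.cos_sq_add_sin_sq (ω * p.2)
  have hW : ∀ s, Real.sqrt (1 + ω ^ 2 * (α s 0 * c s + α s 1 * d s) ^ 2) ^ 3 ≠ 0 := fun s =>
    (pow_pos (Real.sqrt_pos.2 (by positivity)) 3).ne'
  simp_rw [two_mul_meanCurvature_helicoidal hx hy hc hd hu, hR]
  constructor
  · intro h s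
    have := h (s, 0)
    rw [div_eq_iff (hW s)] at this
    linarith
  · intro h p
    rw [div_eq_iff (hW p.1)]
    linarith [h p.1]

/-! ### The level set `G = C` -/

/-- The equation `G = C` solved for `ξ₂`, with the factor `√(1 + ω² ξ₁²)` still depending on `ξ₁`.
-/
theorem mem_levelSet_aux {a C ω : ℝ} (ξ : E2) : ξ ∈ levelSet a C ω ↔
    8 * ξ 1 = levelP a C (ξ 0 ^ 2 + ξ 1 ^ 2) * Real.sqrt (1 + ω ^ 2 * ξ 0 ^ 2) := by
  have hW : 0 < Real.sqrt (1 + ω ^ 2 * ξ 0 ^ 2) := Real.sqrt_pos.2 (by positivity)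
  have : ξ ∈ levelSet a C ω ↔ 2 * ξ 1 / Real.sqrt (1 + ω ^ 2 * ξ 0 ^ 2) =
      levelP a C (ξ 0 ^ 2 + ξ 1 ^ 2) / 4 := by
    change G a ω ξ = C ↔ _
    unfold G levelP
    constructor <;> intro h <;> linarith
  rw [this, div_eq_iff hW.ne']
  constructor <;> intro h <;> linarith

theorem sqrt_eq_mul_sqrt_div_sqrt {X B D : ℝ} (hB : 0 ≤ B) (hD : 0 < D)
    (h : X * D = 64 * B) : Real.sqrt X = 8 * Real.sqrt B / Real.sqrt D := by
  have h1 : X = (8 * Real.sqrt B / Real.sqrt D) ^ 2 := by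
    rw [div_pow, mul_pow, Real.sq_sqrt hB, Real.sq_sqrt hD.le, eq_div_iff hD.ne', h]
    norm_num
  rw [h1, Real.sqrt_sq (by positivity)]

/-- On the level set `G = C`, both `ξ₂` and `W = √(1 + ω² ξ₁²)` are functions of `r`. -/
theorem sqrt_of_levelS {a C ω : ℝ} {ξ₁ ξ₂ : ℝ} (h : ξ₂ = levelS a C ω (ξ₁ ^ 2 + ξ₂ ^ 2)) :
    Real.sqrt (1 + ω ^ 2 * ξ₁ ^ 2) = 8 * Real.sqrt (1 + (ξ₁ ^ 2 + ξ₂ ^ 2) * ω ^ 2)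
      / Real.sqrt (levelD a C ω (ξ₁ ^ 2 + ξ₂ ^ 2)) := by
  have hr : 0 ≤ ξ₁ ^ 2 + ξ₂ ^ 2 := by positivity
  have h2 : ξ₂ ^ 2 = levelS a C ω (ξ₁ ^ 2 + ξ₂ ^ 2) ^ 2 := by rw [← h]
  have hD := levelD_pos a C ω (ξ₁ ^ 2 + ξ₂ ^ 2)
  rw [levelS_sq hr, q_eval, eq_sub_iff_add_eq, ← eq_sub_iff_add_eq', div_eq_iff hD.ne'] at h2
  have hB := one_add_pos hr ω
  refine sqrt_eq_mul_sqrt_div_sqrt hB.le hD ?_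
  simp only [levelD] at h2 ⊢
  linear_combination (-ω ^ 2) * h2

/-- The level set `G = C` is a curve over the `r`-axis: on it `ξ₂` is the function `S` of `r = ξ₁² +
ξ₂²`. -/
theorem mem_levelSet_iff {a C ω : ℝ} (ξ : E2) :
    ξ ∈ levelSet a C ω ↔ ξ 1 = levelS a C ω (ξ 0 ^ 2 + ξ 1 ^ 2) := by
  rw [mem_levelSet_aux]
  have hr : 0 ≤ ξ 0 ^ 2 + ξ 1 ^ 2 := by positivity
  have hD := levelD_pos a C ω (ξ 0 ^ 2 + ξ 1 ^ 2)
  have hB := one_add_pos hr ω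
  constructor
  · intro h
    have hW2 : Real.sqrt (1 + ω ^ 2 * ξ 0 ^ 2) ^ 2 = 1 + ω ^ 2 * ξ 0 ^ 2 :=
      Real.sq_sqrt (by positivity)
    have hW : Real.sqrt (1 + ω ^ 2 * ξ 0 ^ 2) = 8 * Real.sqrt (1 + (ξ 0 ^ 2 + ξ 1 ^ 2) * ω ^ 2)
        / Real.sqrt (levelD a C ω (ξ 0 ^ 2 + ξ 1 ^ 2)) := by
      refine sqrt_eq_mul_sqrt_div_sqrt hB.le hD ?_
      rw [levelD]
      have h2 : (8 * ξ 1) ^ 2 = _ := congrArg (· ^ 2) h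
      simp only [mul_pow, hW2] at h2
      linear_combination (-ω ^ 2) * h2
    rw [hW] at h
    unfold levelS
    rw [← mul_div_assoc, eq_div_iff (sqrt_levelD_pos _ _ _ _).ne'] at h
    rw [eq_div_iff (sqrt_levelD_pos _ _ _ _).ne']
    linarith
  · intro h
    rw [sqrt_of_levelS h]
    nth_rewrite 1 [h]
    unfold levelS
    ring

/-- On the level set `G = C` the curvature solving the drop equation is `levelK`. -/
theorem curvature_eq_levelK_iff {a C ω ξ₁ ξ₂ k : ℝ}
    (h : ξ₂ = levelS a C ω (ξ₁ ^ 2 + ξ₂ ^ 2)) :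
    k * (1 + ω ^ 2 * (ξ₁ ^ 2 + ξ₂ ^ 2)) = ω ^ 2 * ξ₂
      - Real.sqrt (1 + ω ^ 2 * ξ₁ ^ 2) ^ 3 * (1 - a * (ξ₁ ^ 2 + ξ₂ ^ 2) / 2) ↔
    k = levelK a C ω (ξ₁ ^ 2 + ξ₂ ^ 2) := by
  have hr : 0 ≤ ξ₁ ^ 2 + ξ₂ ^ 2 := by positivity
  have hB := one_add_pos hr ω
  have key : ω ^ 2 * ξ₂ - Real.sqrt (1 + ω ^ 2 * ξ₁ ^ 2) ^ 3 * (1 - a * (ξ₁ ^ 2 + ξ₂ ^ 2) / 2) =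
      levelK a C ω (ξ₁ ^ 2 + ξ₂ ^ 2) * (1 + (ξ₁ ^ 2 + ξ₂ ^ 2) * ω ^ 2) := by
    have sB : Real.sqrt (1 + (ξ₁ ^ 2 + ξ₂ ^ 2) * ω ^ 2) ^ 2 = 1 + (ξ₁ ^ 2 + ξ₂ ^ 2) * ω ^ 2 :=
      Real.sq_sqrt hB.le
    have pB := Real.sqrt_pos.2 hB
    have pD := sqrt_levelD_pos a C ω (ξ₁ ^ 2 + ξ₂ ^ 2)
    rw [sqrt_of_levelS h, levelK, ← h]
    generalize Real.sqrt (1 + (ξ₁ ^ 2 + ξ₂ ^ 2) * ω ^ 2) = b at *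
    generalize Real.sqrt (levelD a C ω (ξ₁ ^ 2 + ξ₂ ^ 2)) = e at *
    rw [← sB]
    field_simp
    ring
  rw [key, show 1 + ω ^ 2 * (ξ₁ ^ 2 + ξ₂ ^ 2) = 1 + (ξ₁ ^ 2 + ξ₂ ^ 2) * ω ^ 2 by ring]
  exact mul_left_inj' hB.ne'

/-! ### Profile curves and drops -/

theorem contDiffAt_levelK {a C ω r : ℝ} {n : WithTop ℕ∞} (hr : 0 ≤ r) :
    ContDiffAt ℝ n (levelK a C ω) r := by
  have hB := one_add_pos hr ω
  have hD := levelD_pos a C ω r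
  have hP : ContDiffAt ℝ n (levelP a C) r := by unfold levelP; fun_prop
  have hB' : ContDiffAt ℝ n (fun r => 1 + r * ω ^ 2) r := by fun_prop
  have hD' : ContDiffAt ℝ n (levelD a C ω) r := by unfold levelD levelP; fun_prop
  have sB := hB'.sqrt hB.ne'
  have sD := hD'.sqrt hD.ne'
  have hne := (sqrt_levelD_pos a C ω r).ne'
  have hS : ContDiffAt ℝ n (levelS a C ω) r := (hP.mul sB).div sD hne
  have hl : ContDiffAt ℝ n (fun r => 128 * (2 * a * r - 4)) r := by fun_prop
  exact ((contDiffAt_const.mul hS).div hB' hB.ne').add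
    ((hl.mul sB).div (sD.pow 3) (pow_ne_zero 3 hne))

theorem treadmillSled_zero (α : ℝ → E2) (s : ℝ) :
    treadmillSled α s 0 = α s 0 * deriv α s 0 + α s 1 * deriv α s 1 := rfl

theorem treadmillSled_one (α : ℝ → E2) (s : ℝ) :
    treadmillSled α s 1 = α s 0 * deriv α s 1 - α s 1 * deriv α s 0 := rfl

/-- Bootstrapping: the curvature is a smooth function of the position, so each derivative of the
tangent is as smooth as the position allows. -/
theorem IsProfile.contDiff {a C ω : ℝ} {x y c d : ℝ → ℝ} (hp : IsProfile a C ω x y c d) (n : ℕ) :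
    ContDiff ℝ n x ∧ ContDiff ℝ n y ∧ ContDiff ℝ n c ∧ ContDiff ℝ n d := by
  have dx := funext fun s => (hp.hx s).deriv
  have dy := funext fun s => (hp.hy s).deriv
  have dc := funext fun s => (hp.hc s).deriv
  have dd := funext fun s => (hp.hd s).deriv
  have fx : Differentiable ℝ x := fun s => (hp.hx s).differentiableAt
  have fy : Differentiable ℝ y := fun s => (hp.hy s).differentiableAt
  have fc : Differentiable ℝ c := fun s => (hp.hc s).differentiableAt
  have fd : Differentiable ℝ d := fun s => (hp.hd s).differentiableAt
  induction n with
  | zero =>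
    simp only [Nat.cast_zero, contDiff_zero]
    exact ⟨fx.continuous, fy.continuous, fc.continuous, fd.continuous⟩
  | succ n ih =>
    obtain ⟨ix, iy, ic, id⟩ := ih
    have hk : ContDiff ℝ n fun s => levelK a C ω (x s ^ 2 + y s ^ 2) := by
      rw [contDiff_iff_contDiffAt]
      intro s
      exact (contDiffAt_levelK (by positivity)).comp s ((ix.pow 2).add (iy.pow 2)).contDiffAt
    push_cast
    simp only [contDiff_succ_iff_deriv, dx, dy, dc, dd, fx, fy, fc, fd, true_and]
    refine ⟨⟨by simp, ic⟩, ⟨by simp, id⟩, ⟨by simp, (hk.mul id).neg⟩, ⟨by simp, hk.mul ic⟩⟩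

/-- A solution of the profile equations is the profile curve of a drop. -/
theorem IsProfile.represents {a C ω : ℝ} {x y c d : ℝ → ℝ} (hp : IsProfile a C ω x y c d) :
    Represents a C ω (fun s => !₂[x s, y s]) ∧
      deriv (fun s => (!₂[x s, y s] : E2)) = fun s => !₂[c s, d s] := by
  have hder : deriv (fun s => (!₂[x s, y s] : E2)) = fun s => !₂[c s, d s] :=
    funext fun s => (hasDerivAt_vec2 (hp.hx s) (hp.hy s)).deriv
  have hr : ∀ s, (x s * c s + y s * d s) ^ 2 + (x s * d s - y s * c s) ^ 2 = x s ^ 2 + y s ^ 2 :=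
    fun s => by linear_combination (x s ^ 2 + y s ^ 2) * hp.unit s
  refine ⟨⟨⟨?_, fun s => ?_, ?_⟩, fun s => ?_⟩, hder⟩
  · rw [contDiff_euclidean]
    intro i
    rw [contDiff_infty]
    intro n
    fin_cases i
    · exact (hp.contDiff n).1
    · exact (hp.contDiff n).2.1
  · rw [hder]
    have h := norm_vec2_sq !₂[c s, d s]
    have h' : ‖(!₂[c s, d s] : E2)‖ ^ 2 = 1 := h.trans (hp.unit s)
    exact (pow_eq_one_iff_of_nonneg (norm_nonneg _) two_ne_zero).1 h'
  · refine (meanCurvature_eq_iff (α := fun s => !₂[x s, y s])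
      (k := fun s => levelK a C ω (x s ^ 2 + y s ^ 2)) hp.hx hp.hy hp.hc hp.hd hp.unit).2
      fun s => ?_
    have hl := hp.level s
    have := (curvature_eq_levelK_iff (a := a) (C := C) (ω := ω) (ξ₁ := x s * c s + y s * d s)
      (ξ₂ := x s * d s - y s * c s) (k := levelK a C ω (x s ^ 2 + y s ^ 2)) (by rwa [hr s])).2
      (by rw [hr s])
    rw [hr s] at this
    exact this
  · rw [mem_levelSet_iff, treadmillSled_zero, treadmillSled_one, hder]
    change x s * d s - y s * c s =
      levelS a C ω ((x s * c s + y s * d s) ^ 2 + (x s * d s - y s * c s) ^ 2)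
    rw [hr s, hp.level s]

/-- The profile curve of a drop is a unit speed curve whose signed curvature `k` solves the drop
equation. -/
theorem IsDrop.exists_curvature {a ω : ℝ} {α : ℝ → E2} (hd : IsDrop 1 a ω α) :
    (∀ i s, HasDerivAt (fun s => α s i) (deriv α s i) s) ∧
    (∀ s, deriv α s 0 ^ 2 + deriv α s 1 ^ 2 = 1) ∧ ∃ k : ℝ → ℝ,
      (∀ s, HasDerivAt (fun s => deriv α s 0) (-(k s * deriv α s 1)) s) ∧
      (∀ s, HasDerivAt (fun s => deriv α s 1) (k s * deriv α s 0) s) ∧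
      ∀ s, k s * (1 + ω ^ 2 * (α s 0 ^ 2 + α s 1 ^ 2))
        = ω ^ 2 * (α s 0 * deriv α s 1 - α s 1 * deriv α s 0)
          - Real.sqrt (1 + ω ^ 2 * (α s 0 * deriv α s 0 + α s 1 * deriv α s 1) ^ 2) ^ 3
            * (1 - a * (α s 0 ^ 2 + α s 1 ^ 2) / 2) := by
  have hα : Differentiable ℝ α := hd.smooth.differentiable (by simp)
  have hα' : Differentiable ℝ (deriv α) :=
    ((contDiff_infty_iff_deriv.1 hd.smooth).2).differentiable (by simp)
  have h1 := fun s => hasDerivAt_euclidean_iff.1 (hα s).hasDerivAt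
  have h2 := fun s => hasDerivAt_euclidean_iff.1 (hα' s).hasDerivAt
  have hu : ∀ s, deriv α s 0 ^ 2 + deriv α s 1 ^ 2 = 1 := fun s => by
    rw [← norm_vec2_sq, hd.unit_speed s, one_pow]
  set c1 : ℝ → ℝ := fun s => deriv (deriv α) s 0
  set d1 : ℝ → ℝ := fun s => deriv (deriv α) s 1
  -- the acceleration is orthogonal to the unit tangent, hence a multiple `k` of the unit normal
  have horth : ∀ s, deriv α s 0 * c1 s + deriv α s 1 * d1 s = 0 := fun s => by
    have e : HasDerivAt (fun s => deriv α s 0 ^ 2 + deriv α s 1 ^ 2) _ s :=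
      ((h2 s 0).pow 2).add ((h2 s 1).pow 2)
    have e' : HasDerivAt (fun s => deriv α s 0 ^ 2 + deriv α s 1 ^ 2) 0 s := by
      simp_rw [hu]; exact hasDerivAt_const _ _
    have := e.unique e'
    push_cast at this
    change 2 * deriv α s 0 ^ (2 - 1) * c1 s + 2 * deriv α s 1 ^ (2 - 1) * d1 s = 0 at this
    norm_num at this
    linarith
  set k : ℝ → ℝ := fun s => deriv α s 0 * d1 s - deriv α s 1 * c1 s with hk
  have hc : ∀ s, HasDerivAt (fun s => deriv α s 0) (-(k s * deriv α s 1)) s := fun s => by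
    refine (h2 s 0).congr_deriv ?_
    change c1 s = _
    simp only [hk]
    linear_combination deriv α s 0 * horth s - c1 s * hu s
  have hd' : ∀ s, HasDerivAt (fun s => deriv α s 1) (k s * deriv α s 0) s := fun s => by
    refine (h2 s 1).congr_deriv ?_
    change d1 s = _
    simp only [hk]
    linear_combination deriv α s 1 * horth s - d1 s * hu s
  exact ⟨fun i s => h1 s i, hu, k, hc, hd', (meanCurvature_eq_iff (fun s => h1 s 0)
    (fun s => h1 s 1) hc hd' hu).1 hd.mean_curvature⟩

/-- The profile curve of a drop on the level set `G = C` solves the profile equations. -/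
theorem Represents.isProfile {a C ω : ℝ} {α : ℝ → E2} (h : Represents a C ω α) :
    IsProfile a C ω (fun s => α s 0) (fun s => α s 1) (fun s => deriv α s 0)
      (fun s => deriv α s 1) := by
  obtain ⟨hd, hl⟩ := h
  obtain ⟨h1, hu, k, hc, hd', hk⟩ := hd.exists_curvature
  have hr : ∀ s, (α s 0 * deriv α s 0 + α s 1 * deriv α s 1) ^ 2
      + (α s 0 * deriv α s 1 - α s 1 * deriv α s 0) ^ 2 = α s 0 ^ 2 + α s 1 ^ 2 :=
    fun s => by linear_combination (α s 0 ^ 2 + α s 1 ^ 2) * hu s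
  have hlev : ∀ s, α s 0 * deriv α s 1 - α s 1 * deriv α s 0 =
      levelS a C ω (α s 0 ^ 2 + α s 1 ^ 2) := fun s => by
    have := (mem_levelSet_iff _).1 (hl s)
    rwa [treadmillSled_zero, treadmillSled_one, hr s] at this
  have hK : ∀ s, k s = levelK a C ω (α s 0 ^ 2 + α s 1 ^ 2) := fun s => by
    have := (curvature_eq_levelK_iff (a := a) (C := C) (ω := ω) (k := k s)
      (ξ₁ := α s 0 * deriv α s 0 + α s 1 * deriv α s 1)
      (ξ₂ := α s 0 * deriv α s 1 - α s 1 * deriv α s 0) (by rw [hr s, hlev s])).1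
      (by rw [hr s]; exact hk s)
    rwa [hr s] at this
  refine ⟨h1 0, h1 1, fun s => ?_, fun s => ?_, hu, hlev⟩
  · rw [← hK]; exact hc s
  · rw [← hK]; exact hd' s

/-- `G` is a first integral: the TreadmillSled of every drop lies on a level set of `G`. -/
theorem IsDrop.exists_represents {a ω : ℝ} {α : ℝ → E2} (hd : IsDrop 1 a ω α) :
    ∃ C, Represents a C ω α := by
  obtain ⟨h1, hu, k, hc, hd', hk⟩ := hd.exists_curvature
  set x : ℝ → ℝ := fun s => α s 0 * deriv α s 0 + α s 1 * deriv α s 1 with hx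
  set y : ℝ → ℝ := fun s => α s 0 * deriv α s 1 - α s 1 * deriv α s 0 with hy
  have hr : ∀ s, x s ^ 2 + y s ^ 2 = α s 0 ^ 2 + α s 1 ^ 2 := fun s => by
    simp only [hx, hy]
    linear_combination (α s 0 ^ 2 + α s 1 ^ 2) * hu s
  have dx : ∀ s, HasDerivAt x (1 - k s * y s) s := fun s =>
    (((h1 0 s).mul (hc s)).add ((h1 1 s).mul (hd' s))).congr_deriv (by
      simp only [hy]; linear_combination hu s)
  have dy : ∀ s, HasDerivAt y (k s * x s) s := fun s =>
    (((h1 0 s).mul (hd' s)).sub ((h1 1 s).mul (hc s))).congr_deriv (by simp only [hx]; ring)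
  have dr : ∀ s, HasDerivAt (fun s => x s ^ 2 + y s ^ 2) (2 * x s) s := fun s =>
    (((dx s).pow 2).add ((dy s).pow 2)).congr_deriv (by push_cast; ring)
  -- The TreadmillSled `(x, y)` satisfies `x' = 1 - k y`, `y' = k x`; with the drop equation for `k`
  -- the derivative of `G` along it vanishes.
  have dG : ∀ s, HasDerivAt (fun s => 2 * y s / Real.sqrt (1 + ω ^ 2 * x s ^ 2)
      + (x s ^ 2 + y s ^ 2) - a / 4 * (x s ^ 2 + y s ^ 2) ^ 2) 0 s := fun s => by
    have hpos : 0 < 1 + ω ^ 2 * x s ^ 2 := by positivity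
    have hW := Real.sqrt_pos.2 hpos
    have hW2 := Real.sq_sqrt hpos.le
    have dW := ((((dx s).pow 2).const_mul (ω ^ 2)).const_add 1).sqrt hpos.ne'
    have h2 := ((((dy s).const_mul 2).div dW hW.ne').add (dr s)).sub
      (((dr s).pow 2).const_mul (a / 4))
    refine h2.congr_deriv ?_
    have e := hk s
    rw [← hr s] at e
    change k s * (1 + ω ^ 2 * (x s ^ 2 + y s ^ 2)) = ω ^ 2 * y s
      - Real.sqrt (1 + ω ^ 2 * x s ^ 2) ^ 3 * (1 - a * (x s ^ 2 + y s ^ 2) / 2) at e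
    simp only [Pi.pow_apply]
    generalize Real.sqrt (1 + ω ^ 2 * x s ^ 2) = W at *
    generalize x s = X at *
    generalize y s = Y at *
    field_simp
    push_cast
    linear_combination 8 * X * k s * hW2 + 8 * X * e
  refine ⟨G a ω (treadmillSled α 0), hd, fun s => ?_⟩
  exact is_const_of_deriv_eq_zero (fun s => (dG s).differentiableAt) (fun s => (dG s).deriv) s 0

/-- The drop equation depends on `ω²` only. -/
theorem IsDrop.neg {a ω : ℝ} {α : ℝ → E2} (hd : IsDrop 1 a ω α) : IsDrop 1 a (-ω) α := by
  obtain ⟨h1, hu, k, hc, hd', hk⟩ := hd.exists_curvature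
  refine ⟨hd.smooth, hd.unit_speed, (meanCurvature_eq_iff (h1 0) (h1 1) hc hd' hu).2 ?_⟩
  rwa [neg_sq]

theorem treadmillSled_norm {a C ω : ℝ} {α : ℝ → E2} (h : Represents a C ω α) (s : ℝ) :
    treadmillSled α s 0 ^ 2 + treadmillSled α s 1 ^ 2 = α s 0 ^ 2 + α s 1 ^ 2 := by
  rw [treadmillSled_zero, treadmillSled_one]
  linear_combination (α s 0 ^ 2 + α s 1 ^ 2) * h.isProfile.unit s

/-- Every point of the level set lies on the TreadmillSled of a drop. -/
theorem exists_represents {a : ℝ} (ha : a ≠ 0) {C ω : ℝ} {ξ : E2} (hξ : ξ ∈ levelSet a C ω) :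
    ∃ α, Represents a C ω α ∧ treadmillSled α 0 = ξ := by
  rw [mem_levelSet_iff] at hξ
  obtain ⟨r, v, hN, hr0, hv0⟩ := exists_isNewton (isPotential_levelQ ha C ω)
    (x₀ := ξ 0 ^ 2 + ξ 1 ^ 2) (v₀ := 2 * ξ 0) (by
      rw [levelQ_eq (by positivity), ← hξ]; ring)
  obtain ⟨x, y, c, d, hp, hr, hv⟩ := exists_isProfile hN
  obtain ⟨h1, h2⟩ := hp.represents
  refine ⟨_, h1, ?_⟩
  ext i
  fin_cases i
  · change treadmillSled _ 0 0 = ξ 0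
    rw [treadmillSled_zero, h2]
    change x 0 * c 0 + y 0 * d 0 = ξ 0
    have := hv 0
    rw [hv0] at this
    linarith
  · change treadmillSled _ 0 1 = ξ 1
    rw [treadmillSled_one, h2]
    change x 0 * d 0 - y 0 * c 0 = ξ 1
    rw [hp.level 0, hr 0, hr0, ← hξ]

/-- Drops on the same level set whose TreadmillSleds meet are congruent. -/
theorem exists_eq_rot {a C ω : ℝ} (ha : a ≠ 0) {α β : ℝ → E2} (hα : Represents a C ω α)
    (hβ : Represents a C ω β) {s t : ℝ} (h : treadmillSled α s = treadmillSled β t) :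
    ∃ δ, ∀ u, β (u + t) = rot δ (α (u + s)) ∧ deriv β (u + t) = rot δ (deriv α (u + s)) := by
  have h0 : treadmillSled β t 0 = treadmillSled α s 0 := by rw [h]
  have hr : β t 0 ^ 2 + β t 1 ^ 2 = α s 0 ^ 2 + α s 1 ^ 2 := by
    rw [← treadmillSled_norm hα, ← treadmillSled_norm hβ, h]
  obtain ⟨δ, hδ⟩ := hα.isProfile.exists_rotation_shift ha hβ.isProfile hr h0
  refine ⟨δ, fun u => ⟨?_, ?_⟩⟩
  · ext i
    fin_cases i
    · exact (hδ u).2.2.1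
    · exact (hδ u).2.2.2
  · ext i
    fin_cases i
    · exact (hδ u).1
    · exact (hδ u).2.1

theorem congruentProfiles_of_treadmillSled_eq {a C ω : ℝ} (ha : a ≠ 0) {α β : ℝ → E2}
    (hα : Represents a C ω α) (hβ : Represents a C ω β) {s t : ℝ}
    (h : treadmillSled α s = treadmillSled β t) : CongruentProfiles α β := by
  obtain ⟨δ, hδ⟩ := exists_eq_rot ha hα hβ h
  refine ⟨δ, s - t, fun u => ?_⟩
  have := (hδ (u - t)).1
  rwa [sub_add_cancel, show u - t + s = u + (s - t) by ring] at this

/-! ### Phase portraits of drops -/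

/-- On the level set `Q(r) = 4 ξ₁²`, which is nonnegative. -/
theorem q_nonneg_of_mem_levelSet {a C ω : ℝ} {ξ : E2} (h : ξ ∈ levelSet a C ω) :
    0 ≤ (q a C).eval (ξ 0 ^ 2 + ξ 1 ^ 2) := by
  rw [mem_levelSet_iff] at h
  refine levelQ_nonneg_iff (ω := ω).1 ?_
  rw [levelQ_eq (by positivity), ← h]
  nlinarith [sq_nonneg (ξ 0)]

/-- The curve traced by `ρ` over `I`, with its mirror image, is the part of the level set over
`I`. -/
theorem mem_rhoCurve_iff {a C ω : ℝ} {I : Set ℝ} (hI : ∀ r ∈ I, 0 ≤ (q a C).eval r) (ξ : E2) :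
    ξ ∈ rhoCurve a C ω I ↔ ξ ∈ levelSet a C ω ∧ ξ 0 ^ 2 + ξ 1 ^ 2 ∈ I := by
  have hsq : ∀ r ∈ I, (rho a C ω r 0) ^ 2 + levelS a C ω r ^ 2 = r := fun r hr => by
    rw [levelS_sq (nonneg_of_q_nonneg (hI r hr))]
    change (Real.sqrt _ / Real.sqrt (levelD a C ω r)) ^ 2 + _ = r
    rw [div_pow, Real.sq_sqrt (hI r hr), Real.sq_sqrt (levelD_pos a C ω r).le]
    ring
  have h1 : ∀ r, rho a C ω r 1 = levelS a C ω r := fun r => rfl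
  constructor
  · rintro (⟨r, hr, rfl⟩ | ⟨_, ⟨r, hr, rfl⟩, rfl⟩)
    · have e : rho a C ω r 0 ^ 2 + rho a C ω r 1 ^ 2 = r := by rw [h1, hsq r hr]
      rw [mem_levelSet_iff, e]
      exact ⟨h1 r, hr⟩
    · have e : mirror (rho a C ω r) 0 ^ 2 + mirror (rho a C ω r) 1 ^ 2 = r := by
        change (-rho a C ω r 0) ^ 2 + rho a C ω r 1 ^ 2 = r
        rw [neg_sq, h1, hsq r hr]
      rw [mem_levelSet_iff, e]
      exact ⟨h1 r, hr⟩
  · rintro ⟨h, hr⟩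
    have h2 := (mem_levelSet_iff ξ).1 h
    have h3 := hsq _ hr
    rw [← h2] at h3
    have h4 : rho a C ω (ξ 0 ^ 2 + ξ 1 ^ 2) 0 ^ 2 = ξ 0 ^ 2 := by linarith
    rcases sq_eq_sq_iff_eq_or_eq_neg.1 h4 with h5 | h5
    · refine Or.inl ⟨_, hr, ?_⟩
      ext i
      fin_cases i
      · exact h5
      · exact (h1 _).trans h2.symm
    · refine Or.inr ⟨_, ⟨_, hr, rfl⟩, ?_⟩
      ext i
      fin_cases i
      · change -rho a C ω (ξ 0 ^ 2 + ξ 1 ^ 2) 0 = ξ 0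
        rw [h5, neg_neg]
      · exact (h1 _).trans h2.symm

/-- The squared distance of the profile curve to the origin. -/
def sqDist (α : ℝ → E2) (s : ℝ) : ℝ := α s 0 ^ 2 + α s 1 ^ 2

/-- The derivative of the squared distance of a unit speed curve to the origin. -/
def sqDistVel (α : ℝ → E2) (s : ℝ) : ℝ := 2 * treadmillSled α s 0

theorem sqDist_nonneg (α : ℝ → E2) (s : ℝ) : 0 ≤ sqDist α s := by unfold sqDist; positivity

theorem norm_sq_eq_sqDist (α : ℝ → E2) (s : ℝ) : ‖α s‖ ^ 2 = sqDist α s := norm_vec2_sq _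

theorem norm_eq_sqrt_sqDist (α : ℝ → E2) (s : ℝ) : ‖α s‖ = Real.sqrt (sqDist α s) := by
  rw [← norm_sq_eq_sqDist, Real.sqrt_sq (norm_nonneg _)]

namespace Represents

variable {a C ω : ℝ} {α : ℝ → E2}

theorem isNewton (h : Represents a C ω α) :
    IsNewton (levelQ a C ω) (sqDist α) (sqDistVel α) := h.isProfile.isNewton

theorem q_nonneg (h : Represents a C ω α) (s : ℝ) : 0 ≤ (q a C).eval (sqDist α s) :=
  levelQ_nonneg_iff.1 (by rw [← h.isNewton.energy]; positivity)

theorem treadmillSled_one_eq (h : Represents a C ω α) (s : ℝ) :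
    treadmillSled α s 1 = levelS a C ω (sqDist α s) := h.isProfile.level s

theorem continuous_treadmillSled (h : Represents a C ω α) : Continuous (treadmillSled α) := by
  have hc : ∀ {f f' : ℝ → ℝ}, (∀ s, HasDerivAt f (f' s) s) → Continuous f := fun hf =>
    continuous_iff_continuousAt.2 fun s => (hf s).continuousAt
  have h1 := hc h.isProfile.hx
  have h2 := hc h.isProfile.hy
  have h3 := hc h.isProfile.hc
  have h4 := hc h.isProfile.hd
  refine (PiLp.continuous_toLp 2 _).comp (continuous_pi fun i => ?_)
  fin_cases i
  · exact (h1.mul h3).add (h2.mul h4)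
  · exact (h1.mul h4).sub (h2.mul h3)

/-- The TreadmillSled and the phase curve of the squared distance determine each other. -/
theorem treadmillSled_eq_iff {β : ℝ → E2} (h : Represents a C ω α) (h' : Represents a C ω β)
    {s t : ℝ} : treadmillSled α s = treadmillSled β t ↔
      sqDist α s = sqDist β t ∧ sqDistVel α s = sqDistVel β t := by
  constructor
  · intro e
    refine ⟨?_, by unfold sqDistVel; rw [e]⟩
    unfold sqDist
    rw [← treadmillSled_norm h, ← treadmillSled_norm h', e]
  · rintro ⟨e1, e2⟩
    ext i
    fin_cases i
    · unfold sqDistVel at e2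
      change treadmillSled α s 0 = treadmillSled β t 0
      linarith
    · change treadmillSled α s 1 = treadmillSled β t 1
      rw [h.treadmillSled_one_eq, h'.treadmillSled_one_eq, e1]

/-- If the phase curve of a drop covers the energy level over `I`, its TreadmillSled is
parametrized by `ρ` on `I`. -/
theorem range_treadmillSled (h : Represents a C ω α) {I : Set ℝ} (hq : ∀ r ∈ I, 0 ≤ (q a C).eval r)
    (hI : ∀ s, sqDist α s ∈ I)
    (hcov : ∀ x ∈ I, ∀ w, w ^ 2 = levelQ a C ω x → ∃ s, sqDist α s = x ∧ sqDistVel α s = w) :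
    range (treadmillSled α) = rhoCurve a C ω I := by
  ext ξ
  rw [mem_rhoCurve_iff hq]
  constructor
  · rintro ⟨s, rfl⟩
    refine ⟨h.2 s, ?_⟩
    rw [treadmillSled_norm h]
    exact hI s
  · rintro ⟨h1, h2⟩
    obtain ⟨s, hs, hs'⟩ := hcov _ h2 (2 * ξ 0) (by
      rw [levelQ_eq (by positivity), ← (mem_levelSet_iff ξ).1 h1]; ring)
    refine ⟨s, ?_⟩
    ext i
    fin_cases i
    · unfold sqDistVel at hs'
      change treadmillSled α s 0 = ξ 0
      linarith
    · change treadmillSled α s 1 = ξ 1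
      rw [h.treadmillSled_one_eq, hs, ← (mem_levelSet_iff ξ).1 h1]

/-- A drop with a phase curve over a point of `[x₁, x₂]` reaches the turning point `x₁`, if some
motion that starts at `x₁` covers the energy level over `I`. -/
theorem exists_turning_point (ha : a ≠ 0) (h : Represents a C ω α) {I : Set ℝ} {x₀ : ℝ}
    (hx₀ : levelQ a C ω x₀ = 0)
    (hcov : ∀ r v, IsNewton (levelQ a C ω) r v → r 0 = x₀ → ∀ x ∈ I, ∀ w, w ^ 2 = levelQ a C ω x →
      ∃ s, r s = x ∧ v s = w) {t : ℝ} (ht : sqDist α t ∈ I) :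
    ∃ s₀, sqDist α s₀ = x₀ := by
  have hQ := isPotential_levelQ ha C ω
  obtain ⟨r, v, hN, hr0, -⟩ := exists_isNewton hQ (x₀ := x₀) (v₀ := 0) (by rw [hx₀]; norm_num)
  obtain ⟨s, hs, hs'⟩ := hcov r v hN hr0 _ ht _ (h.isNewton.energy t)
  have := (h.isNewton.unique hQ hN hs.symm hs'.symm (-s)).1
  rw [neg_add_cancel, hr0] at this
  exact ⟨_, this⟩

end Represents

/-- A function with positive derivative at `s₀` is smaller than its value there, just to the left.
-/
theorem eventually_lt_of_deriv_pos {f : ℝ → ℝ} {s₀ d : ℝ} (hf : HasDerivAt f d s₀) (hd : 0 < d) :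
    ∀ᶠ s in 𝓝[<] s₀, f s < f s₀ := by
  have h2 : ∀ᶠ s in 𝓝[≠] s₀, 0 < slope f s₀ s :=
    (hasDerivAt_iff_tendsto_slope.1 hf).eventually (lt_mem_nhds hd)
  have h3 := h2.filter_mono (nhdsWithin_mono s₀ (fun s (hs : s < s₀) => (ne_of_lt hs)))
  filter_upwards [h3, self_mem_nhdsWithin] with s hs hs'
  rw [slope_def_field] at hs
  have h4 : s - s₀ < 0 := sub_neg.2 hs'
  rcases div_pos_iff.1 hs with h | h <;> linarith [h.1, h.2]

/-- An arc of simple roots: `q` is positive between its consecutive simple roots `x₁ < x₂`. -/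
structure SimpleArc (a C x₁ x₂ : ℝ) : Prop where
  lt : x₁ < x₂
  root₁ : (q a C).eval x₁ = 0
  root₂ : (q a C).eval x₂ = 0
  pos : ∀ r ∈ Ioo x₁ x₂, 0 < (q a C).eval r
  deriv₁ : 0 < (q a C).derivative.eval x₁
  deriv₂ : (q a C).derivative.eval x₂ < 0

namespace SimpleArc

variable {a C ω x₁ x₂ : ℝ}

theorem nonneg (A : SimpleArc a C x₁ x₂) {r : ℝ} (hr : r ∈ Icc x₁ x₂) : 0 ≤ (q a C).eval r := by
  rcases hr.1.eq_or_lt with h | h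
  · rw [← h, A.root₁]
  rcases hr.2.eq_or_lt with h' | h'
  · rw [h', A.root₂]
  exact (A.pos r ⟨h, h'⟩).le

theorem levelQ_deriv₁ (A : SimpleArc a C x₁ x₂) (ω : ℝ) : 0 < deriv (levelQ a C ω) x₁ := by
  rw [deriv_levelQ_of_root A.root₁]
  exact div_pos (by linarith [A.deriv₁]) (levelD_pos _ _ _ _)

theorem levelQ_deriv₂ (A : SimpleArc a C x₁ x₂) (ω : ℝ) : deriv (levelQ a C ω) x₂ < 0 := by
  rw [deriv_levelQ_of_root A.root₂]
  exact div_neg_of_neg_of_pos (by linarith [A.deriv₂]) (levelD_pos _ _ _ _)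

/-- The component of `{q ≥ 0}` containing the arc does not extend beyond its end points. -/
theorem subset_Icc_of_isPreconnected (A : SimpleArc a C x₁ x₂) {K : Set ℝ} (hK : IsPreconnected K)
    (hq : ∀ r ∈ K, 0 ≤ (q a C).eval r) {x : ℝ} (hx : x ∈ Icc x₁ x₂) (hxK : x ∈ K) :
    K ⊆ Icc x₁ x₂ := by
  have ho := hK.ordConnected
  intro y hy
  by_contra hcon
  rw [mem_Icc, not_and_or, not_le, not_le] at hcon
  rcases hcon with h | h
  · have e := eventually_lt_of_deriv_pos ((q a C).hasDerivAt x₁) A.deriv₁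
    obtain ⟨z, hz, hz'⟩ := (e.and (Ioo_mem_nhdsLT h)).exists
    rw [A.root₁] at hz
    exact absurd (hq z (ho.out hy hxK ⟨hz'.1.le, hz'.2.le.trans hx.1⟩)) (not_le.2 hz)
  · have e := eventually_gt_of_deriv_pos ((q a C).hasDerivAt x₂).neg (by linarith [A.deriv₂])
    obtain ⟨z, hz, hz'⟩ := (e.and (Ioo_mem_nhdsGT h)).exists
    simp only [Pi.neg_apply, A.root₂] at hz
    have := hq z (ho.out hxK hy ⟨hx.2.trans hz'.1.le, hz'.2.le⟩)
    linarith

/-- A drop over a simple arc has a periodic TreadmillSled; half a period leads from the smallest to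
the largest distance from the origin. -/
theorem exists_period (ha : a ≠ 0) (A : SimpleArc a C x₁ x₂) {α : ℝ → E2}
    (hα : Represents a C ω α) {t : ℝ} (ht : sqDist α t ∈ Icc x₁ x₂) :
    ∃ s₀ T, 0 < T ∧ sqDist α s₀ = x₁ ∧ sqDist α (s₀ + T) = x₂ ∧
      (∀ s ∈ Ioo s₀ (s₀ + T), 0 < sqDistVel α s) ∧
      (∀ s, sqDist α s ∈ Icc x₁ x₂) ∧
      range (treadmillSled α) = rhoCurve a C ω (Icc x₁ x₂) ∧
      (∀ s, treadmillSled α (s + 2 * T) = treadmillSled α s) ∧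
      IsFundamentalPiece a C ω α s₀ (s₀ + 2 * T) := by
  have hQ := isPotential_levelQ ha C ω
  have h1 : levelQ a C ω x₁ = 0 := levelQ_eq_zero_iff.2 A.root₁
  have h2 : levelQ a C ω x₂ = 0 := levelQ_eq_zero_iff.2 A.root₂
  have hpos : ∀ x ∈ Ioo x₁ x₂, 0 < levelQ a C ω x := fun x hx => levelQ_pos_iff.2 (A.pos x hx)
  have d1 := A.levelQ_deriv₁ ω
  have d2 := (A.levelQ_deriv₂ ω).ne
  obtain ⟨s₀, hs₀⟩ := hα.exists_turning_point ha (I := Icc x₁ x₂) h1 (fun r v hN hr x hx w hw => by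
    obtain ⟨T, hT, hrT, hv⟩ := hN.exists_half_period hQ A.lt h1 h2 hpos d1 d2 hr
    obtain ⟨s, -, hs⟩ := (hN.periodic_phase hQ A.lt h1 h2 hr hT hrT hv).2.2.1 x hx w hw
    exact ⟨s, hs⟩) ht
  have hN := hα.isNewton.shift s₀
  have h0 : sqDist α (0 + s₀) = x₁ := by rw [zero_add, hs₀]
  obtain ⟨T, hT, hrT, hv⟩ := hN.exists_half_period hQ A.lt h1 h2 hpos d1 d2 h0
  obtain ⟨hper, hIcc, hcov, hinj⟩ := hN.periodic_phase hQ A.lt h1 h2 h0 hT hrT hv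
  have hper' : ∀ s, treadmillSled α (s + 2 * T) = treadmillSled α s := fun s => by
    have := hper (s - s₀)
    rw [show s - s₀ + 2 * T + s₀ = s + 2 * T by ring, sub_add_cancel] at this
    exact (hα.treadmillSled_eq_iff hα).2 this
  have hI : ∀ s, sqDist α s ∈ Icc x₁ x₂ := fun s => by simpa using hIcc (s - s₀)
  have hrange : range (treadmillSled α) = rhoCurve a C ω (Icc x₁ x₂) := by
    refine hα.range_treadmillSled (fun r hr => A.nonneg hr) hI fun x hx w hw => ?_
    obtain ⟨s, -, hs⟩ := hcov x hx w hw
    exact ⟨_, hs⟩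
  have himage : treadmillSled α '' Icc s₀ (s₀ + 2 * T) = range (treadmillSled α) := by
    have hp : Function.Periodic (treadmillSled α) (2 * T) := hper'
    exact hp.image_Icc (by linarith) s₀
  refine ⟨s₀, T, hT, hs₀, by rwa [add_comm], fun s hs => ?_, hI, hrange, hper', ?_⟩
  · have := hv (s - s₀) ⟨by linarith [hs.1], by linarith [hs.2]⟩
    rwa [sub_add_cancel] at this
  refine ⟨by linarith, (hper' s₀).symm, ?_, ?_⟩
  · intro s hs t ht hst
    obtain ⟨e1, e2⟩ := (hα.treadmillSled_eq_iff hα).1 hst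
    have := hinj (s - s₀) ⟨by linarith [hs.1], by linarith [hs.2]⟩ (t - s₀)
      ⟨by linarith [ht.1], by linarith [ht.2]⟩ (by simpa using e1) (by simpa using e2)
    linarith
  · have hcont := hα.continuous_treadmillSled
    apply Subset.antisymm
    · refine IsPreconnected.subset_connectedComponentIn
        (isPreconnected_Icc.image _ hcont.continuousOn)
        ⟨s₀, ⟨le_rfl, by linarith⟩, rfl⟩ ?_
      rintro _ ⟨s, -, rfl⟩
      exact hα.2 s
    · rw [himage, hrange]
      intro ξ hξ
      have hsub := connectedComponentIn_subset (levelSet a C ω) (treadmillSled α s₀)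
      rw [mem_rhoCurve_iff fun r hr => A.nonneg hr]
      refine ⟨hsub hξ, ?_⟩
      -- The values of `r` on the component form a connected subset of `{q ≥ 0}` that meets the arc.
      have hc : Continuous fun ξ : E2 => ξ 0 ^ 2 + ξ 1 ^ 2 := by fun_prop
      have hK := isPreconnected_connectedComponentIn.image _ (hc.continuousOn
        (s := connectedComponentIn (levelSet a C ω) (treadmillSled α s₀)))
      refine A.subset_Icc_of_isPreconnected hK ?_ (x := x₁) ⟨le_rfl, A.lt.le⟩ ?_
        ⟨ξ, hξ, rfl⟩
      · rintro _ ⟨η, hη, rfl⟩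
        exact q_nonneg_of_mem_levelSet (hsub hη)
      · refine ⟨_, mem_connectedComponentIn (hα.2 s₀), ?_⟩
        simp only [treadmillSled_norm hα]
        exact hs₀

end SimpleArc

/-- A drop over an arc of `{q > 0}` between a simple root `x₁` and a multiple root `x₂ > x₁` is
homoclinic: its distance to the origin tends to `√x₂` in both directions. -/
theorem homoclinic_left {a C ω x₁ x₂ : ℝ} (ha : a ≠ 0) (h12 : x₁ < x₂)
    (h1 : (q a C).eval x₁ = 0) (h2 : (q a C).eval x₂ = 0)
    (hpos : ∀ r ∈ Ioo x₁ x₂, 0 < (q a C).eval r)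
    (d1 : 0 < (q a C).derivative.eval x₁) (d2 : (q a C).derivative.eval x₂ = 0)
    {α : ℝ → E2} (hα : Represents a C ω α) {t : ℝ} (ht : sqDist α t ∈ Ico x₁ x₂) :
    Tendsto (sqDist α) atTop (𝓝 x₂) ∧ Tendsto (sqDist α) atBot (𝓝 x₂) ∧
      (∀ s, sqDist α s ∈ Ico x₁ x₂) ∧
      range (treadmillSled α) = rhoCurve a C ω (Ico x₁ x₂) := by
  have hQ := isPotential_levelQ ha C ω
  have h1' : levelQ a C ω x₁ = 0 := levelQ_eq_zero_iff.2 h1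
  have h2' : levelQ a C ω x₂ = 0 := levelQ_eq_zero_iff.2 h2
  have hpos' : ∀ x ∈ Ioo x₁ x₂, 0 < levelQ a C ω x := fun x hx => levelQ_pos_iff.2 (hpos x hx)
  have d1' : 0 < deriv (levelQ a C ω) x₁ := by
    rw [deriv_levelQ_of_root h1]
    exact div_pos (by linarith) (levelD_pos _ _ _ _)
  have d2' : deriv (levelQ a C ω) x₂ = 0 := by
    rw [deriv_levelQ_of_root h2, d2, mul_zero, zero_div]
  obtain ⟨s₀, hs₀⟩ := hα.exists_turning_point ha (I := Ico x₁ x₂) h1' (fun r v hN hr x hx w hw =>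
    (hN.homoclinic_phase hQ h12 h1' h2' hpos' d1' d2' hr).2.2.2 x hx w hw) ht
  obtain ⟨htop, hbot, hI, hcov⟩ := (hα.isNewton.shift s₀).homoclinic_phase hQ h12 h1' h2'
    hpos' d1' d2' (by rw [zero_add, hs₀])
  have hI2 : ∀ s, sqDist α s ∈ Ico x₁ x₂ := fun s => by simpa using hI (s - s₀)
  refine ⟨?_, ?_, hI2, hα.range_treadmillSled (fun r hr => ?_) hI2
    fun x hx w hw => ?_⟩
  · simpa [Function.comp_def] using htop.comp (tendsto_atTop_add_const_right _ (-s₀) tendsto_id)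
  · simpa [Function.comp_def] using hbot.comp (tendsto_atBot_add_const_right _ (-s₀) tendsto_id)
  · rcases hr.1.eq_or_lt with h | h
    · rw [← h, h1]
    · exact (hpos r ⟨h, hr.2⟩).le
  · obtain ⟨s, hs⟩ := hcov x hx w hw
    exact ⟨_, hs⟩

/-- A drop over an arc of `{q > 0}` between a multiple root `x₁` and a simple root `x₂ > x₁` is
homoclinic: its distance to the origin tends to `√x₁` in both directions. -/
theorem homoclinic_right {a C ω x₁ x₂ : ℝ} (ha : a ≠ 0) (h12 : x₁ < x₂)
    (h1 : (q a C).eval x₁ = 0) (h2 : (q a C).eval x₂ = 0)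
    (hpos : ∀ r ∈ Ioo x₁ x₂, 0 < (q a C).eval r)
    (d1 : (q a C).derivative.eval x₁ = 0) (d2 : (q a C).derivative.eval x₂ < 0)
    {α : ℝ → E2} (hα : Represents a C ω α) {t : ℝ} (ht : sqDist α t ∈ Ioc x₁ x₂) :
    Tendsto (sqDist α) atTop (𝓝 x₁) ∧ Tendsto (sqDist α) atBot (𝓝 x₁) ∧
      (∀ s, sqDist α s ∈ Ioc x₁ x₂) ∧
      range (treadmillSled α) = rhoCurve a C ω (Ioc x₁ x₂) := by
  have hQ := isPotential_levelQ ha C ω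
  -- reflecting the line exchanges the two end points of the arc
  have key : ∀ r v, IsNewton (levelQ a C ω) r v → r 0 = x₂ →
      Tendsto (fun s => -r s) atTop (𝓝 (-x₁)) ∧ Tendsto (fun s => -r s) atBot (𝓝 (-x₁)) ∧
      (∀ s, -r s ∈ Ico (-x₂) (-x₁)) ∧
      (∀ x ∈ Ico (-x₂) (-x₁), ∀ w, w ^ 2 = levelQ a C ω (-x) → ∃ s, -r s = x ∧ -v s = w) := by
    intro r v hN hr
    refine hN.neg.homoclinic_phase hQ.neg (by linarith) ?_ ?_ ?_ ?_ ?_ (by rw [hr])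
    · simpa using levelQ_eq_zero_iff.2 h2
    · simpa using levelQ_eq_zero_iff.2 h1
    · intro x hx
      exact levelQ_pos_iff.2 (hpos _ ⟨by linarith [hx.2], by linarith [hx.1]⟩)
    · rw [deriv_comp_neg, neg_neg, deriv_levelQ_of_root h2]
      have := div_neg_of_neg_of_pos (show 4 * (q a C).derivative.eval x₂ < 0 by linarith)
        (levelD_pos a C ω x₂)
      linarith
    · rw [deriv_comp_neg, neg_neg, deriv_levelQ_of_root h1, d1]
      simp
  have cov : ∀ r v, IsNewton (levelQ a C ω) r v → r 0 = x₂ → ∀ x ∈ Ioc x₁ x₂, ∀ w,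
      w ^ 2 = levelQ a C ω x → ∃ s, r s = x ∧ v s = w := by
    intro r v hN hr x hx w hw
    obtain ⟨s, hs, hs'⟩ := (key r v hN hr).2.2.2 (-x) ⟨by linarith [hx.2], by linarith [hx.1]⟩
      (-w) (by rw [neg_neg, neg_sq, hw])
    exact ⟨s, neg_inj.1 hs, neg_inj.1 hs'⟩
  obtain ⟨s₀, hs₀⟩ := hα.exists_turning_point ha (levelQ_eq_zero_iff.2 h2) cov ht
  have hN := hα.isNewton.shift s₀
  obtain ⟨htop, hbot, hI, -⟩ := key _ _ hN (by rw [zero_add, hs₀])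
  have hI2 : ∀ s, sqDist α s ∈ Ioc x₁ x₂ := fun s => by
    have := hI (s - s₀)
    rw [sub_add_cancel] at this
    exact ⟨by linarith [this.2], by linarith [this.1]⟩
  refine ⟨?_, ?_, hI2, hα.range_treadmillSled (fun r hr => ?_) hI2
    fun x hx w hw => ?_⟩
  · simpa [Function.comp_def] using
      (htop.comp (tendsto_atTop_add_const_right _ (-s₀) tendsto_id)).neg
  · simpa [Function.comp_def] using
      (hbot.comp (tendsto_atBot_add_const_right _ (-s₀) tendsto_id)).neg
  · rcases hr.2.eq_or_lt with h | h
    · rw [h, h2]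
    · exact (hpos r ⟨hr.1, h⟩).le
  · obtain ⟨s, hs⟩ := cov _ _ hN (by rw [zero_add, hs₀]) x hx w hw
    exact ⟨_, hs⟩

/-- A drop that meets a multiple root of `q` stays at constant distance from the origin. -/
theorem sqDist_eq_const {a C ω x : ℝ} (ha : a ≠ 0) (h : (q a C).eval x = 0)
    (hd : (q a C).derivative.eval x = 0) {α : ℝ → E2} (hα : Represents a C ω α) {t : ℝ}
    (ht : sqDist α t = x) (s : ℝ) : sqDist α s = x ∧ sqDistVel α s = 0 :=
  hα.isNewton.eq_const (isPotential_levelQ ha C ω) (levelQ_eq_zero_iff.2 h)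
    (by rw [deriv_levelQ_of_root h, hd, mul_zero, zero_div]) ht s

/-! ### Proper and non-proper helicoidal immersions -/

theorem helicoidal_zero (ω : ℝ) (α : ℝ → E2) (p : ℝ × ℝ) : helicoidal ω α p 0 =
    α p.1 0 * Real.cos (ω * p.2) + α p.1 1 * Real.sin (ω * p.2) := rfl

theorem helicoidal_one (ω : ℝ) (α : ℝ → E2) (p : ℝ × ℝ) : helicoidal ω α p 1 =
    -(α p.1 0) * Real.sin (ω * p.2) + α p.1 1 * Real.cos (ω * p.2) := rfl

theorem helicoidal_two (ω : ℝ) (α : ℝ → E2) (p : ℝ × ℝ) : helicoidal ω α p 2 = p.2 := rfl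

theorem helicoidal_sqDist (ω : ℝ) (α : ℝ → E2) (p : ℝ × ℝ) :
    helicoidal ω α p 0 ^ 2 + helicoidal ω α p 1 ^ 2 = sqDist α p.1 := by
  rw [helicoidal_zero, helicoidal_one, sqDist]
  linear_combination (α p.1 0 ^ 2 + α p.1 1 ^ 2) * Real.cos_sq_add_sin_sq (ω * p.2)

theorem continuous_helicoidal (ω : ℝ) {α : ℝ → E2} (hα : Continuous α) :
    Continuous (helicoidal ω α) := by
  refine (PiLp.continuous_toLp 2 _).comp (continuous_pi fun i => ?_)
  have h0 : Continuous fun s => α s 0 := by fun_prop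
  have h1 : Continuous fun s => α s 1 := by fun_prop
  fin_cases i
  · change Continuous fun p : ℝ × ℝ =>
      α p.1 0 * Real.cos (ω * p.2) + α p.1 1 * Real.sin (ω * p.2)
    fun_prop
  · change Continuous fun p : ℝ × ℝ =>
      -(α p.1 0) * Real.sin (ω * p.2) + α p.1 1 * Real.cos (ω * p.2)
    fun_prop
  · exact continuous_snd

theorem quotientMap_mk (X : ℝ × ℝ → E3) (p : ℝ × ℝ) :
    quotientMap X (QuotientAddGroup.mk p) = X p := rfl

theorem continuous_quotientMap {X : ℝ × ℝ → E3} (hX : Continuous X) :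
    Continuous (quotientMap X) := hX.quotient_lift _

/-- The periods of a helicoidal immersion are the periods of its profile curve. -/
theorem mem_periods_helicoidal {ω : ℝ} {α : ℝ → E2} {v : ℝ × ℝ} :
    v ∈ periods (helicoidal ω α) ↔ v.2 = 0 ∧ ∀ s, α (s + v.1) = α s := by
  change (∀ p, helicoidal ω α (p + v) = helicoidal ω α p) ↔ _
  constructor
  · intro h
    have h2 : v.2 = 0 := by
      have := congrArg (fun w : E3 => w 2) (h 0)
      simpa [helicoidal_two] using this
    refine ⟨h2, fun s => ?_⟩
    have := h (s, 0)
    ext i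
    fin_cases i
    · have := congrArg (fun w : E3 => w 0) this
      simpa [helicoidal_zero, h2] using this
    · have := congrArg (fun w : E3 => w 1) this
      simpa [helicoidal_one, h2] using this
  · rintro ⟨h2, h⟩ p
    unfold helicoidal
    rw [Prod.fst_add, Prod.snd_add, h2, add_zero, h]

/-- The preimage of a compact set is bounded in the direction of the axis, and a period bounds it,
up to periods, in the direction of the profile curve. -/
theorem properlyImmersed_of_periodic (ω : ℝ) {α : ℝ → E2} (hα : Continuous α) {T : ℝ} (hT : 0 < T)
    (hper : ∀ s, α (s + T) = α s) : ProperlyImmersed (helicoidal ω α) := by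
  have hX := continuous_helicoidal ω hα
  unfold ProperlyImmersed
  rw [isProperMap_iff_isCompact_preimage]
  refine ⟨continuous_quotientMap hX, fun K hK => ?_⟩
  obtain ⟨M, hM⟩ := hK.isBounded.exists_norm_le
  set L : Set (ℝ × ℝ) := helicoidal ω α ⁻¹' K ∩ Icc 0 T ×ˢ Icc (-M) M with hL
  have hLc : IsCompact L := (isCompact_Icc.prod isCompact_Icc).inter_left (hK.isClosed.preimage hX)
  have hLimg : quotientMap (helicoidal ω α) ⁻¹' K =
      (QuotientAddGroup.mk : ℝ × ℝ → (ℝ × ℝ) ⧸ periods (helicoidal ω α)) '' L := by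
    ext z
    constructor
    · obtain ⟨p, rfl⟩ := QuotientAddGroup.mk_surjective z
      intro hz
      have hz' : helicoidal ω α p ∈ K := hz
      have hp2 : p.2 ∈ Icc (-M) M := by
        have h1 := hM _ hz'
        have h2 := PiLp.norm_apply_le (helicoidal ω α p) 2
        rw [helicoidal_two] at h2
        exact abs_le.1 (h2.trans h1)
      obtain ⟨n, hn⟩ : ∃ n : ℤ, p.1 + n * T ∈ Icc 0 T := by
        refine ⟨-⌊p.1 / T⌋, ?_⟩
        have h1 := Int.floor_le (p.1 / T)
        have h2 := Int.lt_floor_add_one (p.1 / T)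
        rw [le_div_iff₀ hT] at h1
        rw [div_lt_iff₀ hT] at h2
        push_cast
        constructor <;> nlinarith
      have hmem : ((n * T, 0) : ℝ × ℝ) ∈ periods (helicoidal ω α) := by
        rw [mem_periods_helicoidal]
        refine ⟨rfl, fun s => ?_⟩
        have hp : Function.Periodic α T := hper
        exact hp.int_mul n s
      have hsh : helicoidal ω α (p + (n * T, 0)) = helicoidal ω α p := hmem p
      refine ⟨p + (n * T, 0), ⟨?_, ⟨hn, by simpa using hp2⟩⟩, ?_⟩
      · change helicoidal ω α (p + (n * T, 0)) ∈ K
        rw [hsh]; exact hz'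
      · rw [eq_comm, QuotientAddGroup.eq]
        simpa using hmem
    · rintro ⟨p, hp, rfl⟩
      exact hp.1
  rw [hLimg]
  exact hLc.image QuotientAddGroup.continuous_mk

/-- A bounded profile curve without periods generates a surface that accumulates on itself. -/
theorem not_properlyImmersed (ω : ℝ) {α : ℝ → E2} {M : ℝ} (hM : ∀ s, ‖α s‖ ≤ M)
    (hper : ∀ T, (∀ s, α (s + T) = α s) → T = 0) : ¬ ProperlyImmersed (helicoidal ω α) := by
  intro hP
  have htriv : ∀ v ∈ periods (helicoidal ω α), v = 0 := fun v hv => by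
    obtain ⟨h2, h1⟩ := mem_periods_helicoidal.1 hv
    exact Prod.ext (hper _ h1) h2
  -- As there are no periods, the parameter `s` is a well defined continuous function on the
  -- quotient. It is unbounded on the preimage of the ball of radius `M`, which contains the whole
  -- slice `t = 0`.
  set f : (ℝ × ℝ) ⧸ periods (helicoidal ω α) → ℝ := Quotient.lift (fun p : ℝ × ℝ => p.1) (by
    intro u v huv
    have h := htriv _ (QuotientAddGroup.leftRel_apply.mp huv)
    rw [neg_add_eq_zero] at h
    rw [h]) with hf
  have hfc : Continuous f := continuous_fst.quotient_lift _
  have hK := hP.isCompact_preimage (isCompact_closedBall (0 : E3) M)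
  obtain ⟨B, hB⟩ := (hK.image hfc).isBounded.exists_norm_le
  have h1 : (|B| + 1 : ℝ) ∈ f '' (quotientMap (helicoidal ω α) ⁻¹' Metric.closedBall 0 M) := by
    refine ⟨QuotientAddGroup.mk (|B| + 1, 0), ?_, rfl⟩
    rw [mem_preimage, quotientMap_mk, mem_closedBall_zero_iff]
    refine le_trans (le_of_eq ?_) (hM (|B| + 1))
    rw [EuclideanSpace.norm_eq, EuclideanSpace.norm_eq, Fin.sum_univ_three, Fin.sum_univ_two]
    simp [helicoidal_zero, helicoidal_one, helicoidal_two]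
  have := hB _ h1
  rw [Real.norm_eq_abs, abs_of_nonneg (by positivity)] at this
  linarith [le_abs_self B]

/-! ### The polar angle of a profile curve -/

/-- The angular velocity of a profile curve about the origin as a function of `r`. It equals
`S(r) / r`, extended by continuity to `r = 0` for `C = 0`, the only level on which the curve meets
the origin. -/
def levelAng (a C ω r : ℝ) : ℝ :=
  if C = 0 then (-4 + a * r) * Real.sqrt (1 + r * ω ^ 2) / Real.sqrt (levelD a C ω r)
  else levelS a C ω r / r

/-- The polar angle swept by the profile curve since time `0`. -/
def sweptAngle (a C ω : ℝ) (α : ℝ → E2) (s : ℝ) : ℝ :=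
  ∫ t in (0 : ℝ)..s, levelAng a C ω (sqDist α t)

/-- The angular velocity is `S / r`, also where the curve meets the origin. -/
theorem levelAng_mul {a C ω r : ℝ} (h : 0 ≤ (q a C).eval r) :
    levelAng a C ω r * r = levelS a C ω r := by
  unfold levelAng
  split_ifs with hC
  · unfold levelS levelP
    rw [hC]
    ring
  · refine div_mul_cancel₀ _ ?_
    rintro rfl
    rw [q_eval] at h
    simp only [levelP, zero_mul, add_zero, mul_zero, zero_sub] at h
    have : 0 < (4 * C) ^ 2 := by positivity
    linarith

namespace Represents

variable {a C ω : ℝ} {α : ℝ → E2}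

theorem continuous (h : Represents a C ω α) : Continuous α := h.1.smooth.continuous

theorem continuous_levelAng (h : Represents a C ω α) :
    Continuous fun s => levelAng a C ω (sqDist α s) := by
  have hr := h.isNewton.continuous_pos
  unfold levelAng
  split_ifs with hC
  · have hD : Continuous (levelD a C ω) := by unfold levelD levelP; fun_prop
    refine Continuous.div (by fun_prop) (by fun_prop) fun s => (sqrt_levelD_pos _ _ _ _).ne'
  · have hS : ContinuousOn (levelS a C ω) (Ici 0) := fun r hr =>
      (hasDerivAt_levelS hr).continuousAt.continuousWithinAt
    refine (hS.comp_continuous hr fun s => sqDist_nonneg α s).div hr fun s hs => ?_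
    have := h.q_nonneg s
    rw [hs, q_eval] at this
    simp only [levelP, zero_mul, add_zero, mul_zero, zero_sub] at this
    have : 0 < (4 * C) ^ 2 := by positivity
    linarith

theorem hasDerivAt_sweptAngle (h : Represents a C ω α) (s : ℝ) :
    HasDerivAt (sweptAngle a C ω α) (levelAng a C ω (sqDist α s)) s :=
  intervalIntegral.integral_hasDerivAt_right (h.continuous_levelAng.intervalIntegrable _ _)
    h.continuous_levelAng.aestronglyMeasurable.stronglyMeasurableAtFilter
    h.continuous_levelAng.continuousAt

/-- Polar coordinates along a piece of the profile curve off the origin. -/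
theorem exists_polar (h : Represents a C ω α) {U : Set ℝ} (hU : IsOpen U) (hU' : IsPreconnected U)
    (hpos : ∀ s ∈ U, 0 < sqDist α s) : ∃ ψ₀, ∀ s ∈ U,
      α s 0 = Real.sqrt (sqDist α s) * Real.cos (sweptAngle a C ω α s + ψ₀) ∧
      α s 1 = Real.sqrt (sqDist α s) * Real.sin (sweptAngle a C ω α s + ψ₀) := by
  rcases U.eq_empty_or_nonempty with rfl | ⟨s₁, hs₁⟩
  · exact ⟨0, by simp⟩
  have hp := h.isProfile
  set φ := sweptAngle a C ω α
  set e : ℝ → ℝ := fun s => Real.sqrt (sqDist α s) with he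
  -- The unit position vector, rotated back by the swept angle, is the constant `(A, B)`.
  set A : ℝ → ℝ := fun s => (α s 0 * Real.cos (φ s) + α s 1 * Real.sin (φ s)) / e s with hA
  set B : ℝ → ℝ := fun s => (α s 1 * Real.cos (φ s) - α s 0 * Real.sin (φ s)) / e s with hB
  have epos : ∀ s ∈ U, 0 < e s := fun s hs => Real.sqrt_pos.2 (hpos s hs)
  have esq : ∀ s, e s ^ 2 = sqDist α s := fun s => Real.sq_sqrt (sqDist_nonneg α s)
  -- the velocity, decomposed into its radial and angular parts
  have hvel : ∀ s ∈ U, deriv α s 0 = treadmillSled α s 0 / sqDist α s * α s 0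
        - levelAng a C ω (sqDist α s) * α s 1 ∧
      deriv α s 1 = treadmillSled α s 0 / sqDist α s * α s 1
        + levelAng a C ω (sqDist α s) * α s 0 := by
    intro s hs
    have h1 : levelAng a C ω (sqDist α s) = treadmillSled α s 1 / sqDist α s := by
      rw [eq_div_iff (hpos s hs).ne', levelAng_mul (h.q_nonneg s), h.treadmillSled_one_eq]
    have hne := (hpos s hs).ne'
    rw [h1, treadmillSled_zero, treadmillSled_one]
    constructor
    · field_simp
      unfold sqDist
      ring
    · field_simp
      unfold sqDist
      ring
  have dcos := fun s => (h.hasDerivAt_sweptAngle s).cos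
  have dsin := fun s => (h.hasDerivAt_sweptAngle s).sin
  have de : ∀ s ∈ U, HasDerivAt e (treadmillSled α s 0 / e s) s := fun s hs =>
    ((h.isNewton.deriv_pos s).sqrt (hpos s hs).ne').congr_deriv (by
      have := (epos s hs).ne'
      simp only [sqDistVel, he] at this ⊢
      field_simp)
  have dA : ∀ s ∈ U, HasDerivAt A 0 s := fun s hs => by
    have h1 := (((hp.hx s).mul (dcos s)).add ((hp.hy s).mul (dsin s))).div (de s hs) (epos s hs).ne'
    refine h1.congr_deriv ?_
    simp only [Pi.add_apply, Pi.mul_apply]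
    rw [(hvel s hs).1, (hvel s hs).2, ← esq s]
    have := (epos s hs).ne'
    field_simp
    ring
  have dB : ∀ s ∈ U, HasDerivAt B 0 s := fun s hs => by
    have h1 := (((hp.hy s).mul (dcos s)).sub ((hp.hx s).mul (dsin s))).div (de s hs) (epos s hs).ne'
    refine h1.congr_deriv ?_
    simp only [Pi.sub_apply, Pi.mul_apply]
    rw [(hvel s hs).1, (hvel s hs).2, ← esq s]
    have := (epos s hs).ne'
    field_simp
    ring
  have const : ∀ {F : ℝ → ℝ}, (∀ s ∈ U, HasDerivAt F 0 s) → ∀ s ∈ U, F s = F s₁ := fun hF s hs =>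
    hU.is_const_of_deriv_eq_zero hU'
      (fun s hs => (hF s hs).differentiableAt.differentiableWithinAt)
      (fun s hs => (hF s hs).deriv) hs hs₁
  have cs := fun s => Real.cos_sq_add_sin_sq (φ s)
  have hAB : A s₁ ^ 2 + B s₁ ^ 2 = 1 := by
    have hne := (epos s₁ hs₁).ne'
    simp only [hA, hB]
    rw [div_pow, div_pow, ← add_div, div_eq_one_iff_eq (pow_ne_zero 2 hne), esq, sqDist]
    linear_combination (α s₁ 0 ^ 2 + α s₁ 1 ^ 2) * cs s₁
  obtain ⟨ψ₀, h1, h2⟩ := exists_cos_sin hAB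
  refine ⟨ψ₀, fun s hs => ?_⟩
  have e1 : A s = Real.cos ψ₀ := by rw [const dA s hs, h1]
  have e2 : B s = Real.sin ψ₀ := by rw [const dB s hs, h2]
  have hne := (epos s hs).ne'
  simp only [hA, hB] at e1 e2
  rw [div_eq_iff hne] at e1 e2
  rw [Real.cos_add, Real.sin_add]
  change _ = e s * _ ∧ _ = e s * _
  constructor
  · linear_combination (-α s 0) * cs s + Real.cos (φ s) * e1 - Real.sin (φ s) * e2
  · linear_combination (-α s 1) * cs s + Real.sin (φ s) * e1 + Real.cos (φ s) * e2

end Represents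

/-! ### Spirals -/

/-- A function whose derivative tends to a nonzero limit is unbounded in one direction. -/
theorem tendsto_of_deriv_tendsto {φ g : ℝ → ℝ} {c : ℝ} (hφ : ∀ s, HasDerivAt φ (g s) s)
    (hg : Tendsto g atTop (𝓝 c)) (hc : c ≠ 0) :
    Tendsto φ atTop atTop ∨ Tendsto φ atTop atBot := by
  have key : ∀ {φ g : ℝ → ℝ} {c : ℝ}, (∀ s, HasDerivAt φ (g s) s) → Tendsto g atTop (𝓝 c) →
      0 < c → Tendsto φ atTop atTop := by
    intro φ g c hφ hg hc
    obtain ⟨S, hS⟩ := eventually_atTop.1 (hg.eventually (lt_mem_nhds (half_lt_self hc)))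
    have h1 : ∀ s ∈ Ici S, c / 2 * (s - S) + φ S ≤ φ s := by
      intro s hs
      have := (convex_Ici S).mul_sub_le_image_sub_of_le_deriv (f := φ) (C := c / 2)
        (fun t _ => (hφ t).continuousAt.continuousWithinAt)
        (fun t _ => (hφ t).differentiableAt.differentiableWithinAt)
        (fun t ht => by
          rw [(hφ t).deriv]
          exact (hS t (interior_subset ht)).le) S self_mem_Ici s hs hs
      linarith
    refine tendsto_atTop_mono' _ (eventually_atTop.2 ⟨S, h1⟩) ?_
    refine tendsto_atTop_add_const_right _ _ (Tendsto.const_mul_atTop (half_pos hc) ?_)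
    exact tendsto_atTop_add_const_right _ (-S) tendsto_id
  rcases hc.lt_or_gt with h | h
  · right
    have := key (fun s => (hφ s).neg) hg.neg (neg_pos.2 h)
    simpa using tendsto_neg_atTop_iff.1 this
  · exact Or.inl (key hφ hg h)

/-- A continuous angle that is unbounded in one direction takes every direction at arbitrarily late
times. -/
theorem frequently_angle {ψ : ℝ → ℝ} {S : ℝ} (hψ : ContinuousOn ψ (Ici S))
    (hlim : Tendsto ψ atTop atTop ∨ Tendsto ψ atTop atBot) (β : ℝ) :
    ∃ᶠ s in atTop, Real.cos (ψ s) = Real.cos β ∧ Real.sin (ψ s) = Real.sin β := by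
  have key : ∀ {ψ : ℝ → ℝ}, ContinuousOn ψ (Ici S) → Tendsto ψ atTop atTop → ∀ β,
      ∃ᶠ s in atTop, Real.cos (ψ s) = Real.cos β ∧ Real.sin (ψ s) = Real.sin β := by
    intro ψ hψ hlim β
    rw [frequently_atTop]
    intro M
    set M' := max M S
    obtain ⟨n, hn⟩ := exists_nat_ge ((ψ M' - β) / (2 * Real.pi))
    rw [div_le_iff₀ (by positivity)] at hn
    obtain ⟨s', hs', hs''⟩ := ((eventually_ge_atTop M').and
      (hlim.eventually_ge_atTop (β + n * (2 * Real.pi)))).exists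
    obtain ⟨s, hs, hse⟩ := intermediate_value_Icc hs'
      (hψ.mono fun t ht => (le_max_right M S).trans ht.1)
      (show β + n * (2 * Real.pi) ∈ Icc (ψ M') (ψ s') from ⟨by linarith, hs''⟩)
    refine ⟨s, (le_max_left M S).trans hs.1, ?_, ?_⟩
    · rw [hse, Real.cos_add_nat_mul_two_pi]
    · rw [hse, Real.sin_add_nat_mul_two_pi]
  rcases hlim with h | h
  · exact key hψ h β
  · refine (key hψ.neg (tendsto_neg_atBot_atTop.comp h) (-β)).mono fun s hs => ?_
    simp only [Real.cos_neg, Real.sin_neg, Pi.neg_apply, neg_inj] at hs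
    exact hs

/-- An end of a plane curve in polar coordinates, with polar radius tending to `R > 0` and polar
angle tending to infinity, accumulates exactly at the circle of radius `R`, and winds infinitely
often around every point inside this circle. -/
theorem spiral_end {γ : ℝ → E2} {e ψ : ℝ → ℝ} {S R : ℝ} (hγc : Continuous γ) (hR : 0 < R)
    (hψ : ContinuousOn ψ (Ici S))
    (hlim : Tendsto ψ atTop atTop ∨ Tendsto ψ atTop atBot) (he : Tendsto e atTop (𝓝 R))
    (hγ : ∀ s ∈ Ici S, γ s 0 = e s * Real.cos (ψ s) ∧ γ s 1 = e s * Real.sin (ψ s)) :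
    {p | MapClusterPt p atTop γ} = Metric.sphere (0 : E2) R ∧
    ∀ p : E2, ‖p‖ < R → ∃ (S' : ℝ) (ψ' : ℝ → ℝ), ContinuousOn ψ' (Ici S') ∧
      (∀ s ∈ Ici S', γ s ≠ p ∧ γ s - p = ‖γ s - p‖ • !₂[Real.cos (ψ' s), Real.sin (ψ' s)]) ∧
      Tendsto (fun s => |ψ' s|) atTop atTop := by
  have hnorm : ∀ s ∈ Ici S, ‖γ s‖ = |e s| := fun s hs => by
    rw [← sq_eq_sq₀ (norm_nonneg _) (abs_nonneg _), norm_vec2_sq, (hγ s hs).1, (hγ s hs).2, sq_abs]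
    linear_combination e s ^ 2 * Real.cos_sq_add_sin_sq (ψ s)
  have hnlim : Tendsto (fun s => ‖γ s‖) atTop (𝓝 R) := by
    have := he.abs
    rw [abs_of_pos hR] at this
    exact this.congr' (eventually_atTop.2 ⟨S, fun s hs => (hnorm s hs).symm⟩)
  constructor
  · ext p
    rw [mem_sphere_zero_iff_norm]
    constructor
    · intro hp
      have h1 : MapClusterPt ‖p‖ atTop (fun s => ‖γ s‖) :=
        hp.continuousAt_comp continuous_norm.continuousAt
      have h2 : (𝓝 ‖p‖ ⊓ 𝓝 R).NeBot := h1.neBot.mono (inf_le_inf_left _ hnlim)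
      exact eq_of_nhds_neBot h2
    · intro hp
      obtain ⟨β, h1, h2⟩ := exists_cos_sin (A := p 0 / R) (B := p 1 / R) (by
        rw [div_pow, div_pow, ← add_div, ← norm_vec2_sq, hp, div_self (pow_ne_zero 2 hR.ne')])
      rw [div_eq_iff hR.ne'] at h1 h2
      rw [mem_ofPred, mapClusterPt_iff_frequently]
      intro V hV
      set P : ℝ → E2 := fun ρ => !₂[ρ * Real.cos β, ρ * Real.sin β] with hP
      have hPc : Continuous P := by
        refine (PiLp.continuous_toLp 2 _).comp (continuous_pi fun i => ?_)
        fin_cases i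
        · exact continuous_id.mul continuous_const
        · exact continuous_id.mul continuous_const
      have hPR : P R = p := by
        ext i
        fin_cases i
        · change R * Real.cos β = p 0
          rw [h1]; ring
        · change R * Real.sin β = p 1
          rw [h2]; ring
      have hev : ∀ᶠ s in atTop, P (e s) ∈ V := by
        have : Tendsto (fun s => P (e s)) atTop (𝓝 p) := by
          rw [← hPR]; exact hPc.continuousAt.tendsto.comp he
        exact this.eventually hV
      refine ((frequently_angle hψ hlim β).and_eventually
        (hev.and (eventually_ge_atTop S))).mono ?_
      rintro s ⟨⟨hc, hs⟩, hV, hsS⟩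
      have : γ s = P (e s) := by
        ext i
        fin_cases i
        · exact (hγ s hsS).1.trans (by rw [hc]; rfl)
        · exact (hγ s hsS).2.trans (by rw [hs]; rfl)
      rwa [this]
  · intro p hp
    obtain ⟨S₁, hS₁⟩ := eventually_atTop.1 (he.eventually (lt_mem_nhds hp))
    set S' := max S S₁
    have hS : ∀ s ∈ Ici S', s ∈ Ici S := fun s hs =>
      mem_Ici.2 ((le_max_left S S₁).trans hs)
    have hep : ∀ s ∈ Ici S', ‖p‖ < e s := fun s hs => hS₁ s ((le_max_right _ _).trans hs)
    set P : ℂ := ⟨p 0, p 1⟩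
    set u : ℝ → ℂ := fun s => ⟨γ s 0, γ s 1⟩ with hu
    -- Near the end, `|p| < |γ|`, so `1 - p / γ` stays in the right half plane. Its argument is a
    -- bounded correction that turns the angle of `γ` into an angle of `γ - p = γ (1 - p / γ)`.
    set w : ℝ → ℂ := fun s => 1 - P / u s with hw
    have hnormP : ‖P‖ = ‖p‖ := by
      rw [← sq_eq_sq₀ (norm_nonneg _) (norm_nonneg _), norm_vec2_sq, Complex.sq_norm,
        Complex.normSq_apply]
      ring
    have hnormu : ∀ s, ‖u s‖ = ‖γ s‖ := fun s => by
      rw [← sq_eq_sq₀ (norm_nonneg _) (norm_nonneg _), norm_vec2_sq, Complex.sq_norm,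
        Complex.normSq_apply]
      ring
    have hue : ∀ s ∈ Ici S', ‖u s‖ = e s := fun s hs => by
      rw [hnormu, hnorm s (hS s hs), abs_of_pos ((norm_nonneg p).trans_lt (hep s hs))]
    have hune : ∀ s ∈ Ici S', u s ≠ 0 := fun s hs => by
      rw [← norm_pos_iff, hue s hs]
      exact (norm_nonneg p).trans_lt (hep s hs)
    have hslit : ∀ s ∈ Ici S', w s ∈ Complex.slitPlane := fun s hs => by
      have h1 : ‖P / u s‖ < 1 := by
        rw [norm_div, hnormP, hue s hs, div_lt_one ((norm_nonneg p).trans_lt (hep s hs))]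
        exact hep s hs
      left
      have h2 := (Complex.abs_re_le_norm (P / u s)).trans_lt h1
      have h3 := (abs_lt.1 h2).2
      simp only [hw, Complex.sub_re, Complex.one_re]
      linarith
    have hucont : Continuous u := by
      have : u = fun s => ((γ s 0 : ℝ) : ℂ) + ((γ s 1 : ℝ) : ℂ) * Complex.I := by
        funext s
        apply Complex.ext <;> simp [hu]
      rw [this]
      fun_prop
    have hmul : ∀ s ∈ Ici S', u s * w s = u s - P := fun s hs => by
      simp only [hw]
      rw [mul_sub, mul_one, mul_div_cancel₀ _ (hune s hs)]
    have hψ' : ContinuousOn (fun s => ψ s + Complex.arg (w s)) (Ici S') := by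
      refine (hψ.mono hS).add ?_
      intro s hs
      refine (Complex.continuousAt_arg (hslit s hs)).comp_continuousWithinAt ?_
      exact (continuousWithinAt_const.sub
        (continuousWithinAt_const.div hucont.continuousWithinAt (hune s hs)))
    refine ⟨S', fun s => ψ s + Complex.arg (w s), hψ', fun s hs => ?_, ?_⟩
    · have hwne : w s ≠ 0 := Complex.slitPlane_ne_zero (hslit s hs)
      have hne : u s - P ≠ 0 := by rw [← hmul s hs]; exact mul_ne_zero (hune s hs) hwne
      have hnorm' : ‖γ s - p‖ = ‖u s - P‖ := by
        rw [← sq_eq_sq₀ (norm_nonneg _) (norm_nonneg _), norm_vec2_sq, Complex.sq_norm,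
          Complex.normSq_apply]
        simp [hu, P]
        ring
      have hu' := hγ s (hS s hs)
      have e1 : (u s).re = ‖u s‖ * Real.cos (ψ s) := by rw [hue s hs]; exact hu'.1
      have e2 : (u s).im = ‖u s‖ * Real.sin (ψ s) := by rw [hue s hs]; exact hu'.2
      have e3 := Complex.norm_mul_cos_arg (w s)
      have e4 := Complex.norm_mul_sin_arg (w s)
      have hre : (u s - P).re = ‖u s - P‖ * Real.cos (ψ s + Complex.arg (w s)) := by
        rw [← hmul s hs, Complex.mul_re, e1, e2, ← e3, ← e4, norm_mul, Real.cos_add]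
        ring
      have him : (u s - P).im = ‖u s - P‖ * Real.sin (ψ s + Complex.arg (w s)) := by
        rw [← hmul s hs, Complex.mul_im, e1, e2, ← e3, ← e4, norm_mul, Real.sin_add]
        ring
      constructor
      · rintro h
        apply hne
        apply Complex.ext
        · change γ s 0 - p 0 = 0
          rw [h, sub_self]
        · change γ s 1 - p 1 = 0
          rw [h, sub_self]
      · rw [hnorm']
        ext i
        fin_cases i
        · exact hre
        · exact him
    · have habs : Tendsto (fun s => |ψ s|) atTop atTop := by
        rcases hlim with h | h
        · exact tendsto_abs_atTop_atTop.comp h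
        · exact tendsto_abs_atBot_atTop.comp h
      refine tendsto_atTop_mono (fun s => ?_)
        (tendsto_atTop_add_const_right _ (-Real.pi) habs)
      have h1 := Complex.abs_arg_le_pi (w s)
      have h2 := abs_sub_abs_le_abs_sub (ψ s) (-Complex.arg (w s))
      rw [abs_neg, sub_neg_eq_add] at h2
      linarith

/-- At a root of `q` the motion is purely angular, and does not stop. -/
theorem levelAng_ne_zero {a C ω x : ℝ} (hx : 0 < x) (hq : (q a C).eval x = 0) :
    levelAng a C ω x ≠ 0 := by
  intro h0
  have h1 := levelAng_mul (ω := ω) hq.ge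
  rw [h0, zero_mul] at h1
  have h2 := levelS_sq (a := a) (C := C) (ω := ω) hx.le
  rw [← h1, hq] at h2
  simp at h2
  exact hx.ne h2

/-- A drop on a homoclinic orbit spirals to a circle at both ends. -/
theorem Represents.spiralsTo {a C ω x : ℝ} {α : ℝ → E2} (hα : Represents a C ω α) (hx : 0 < x)
    (hq : (q a C).eval x = 0) (htop : Tendsto (sqDist α) atTop (𝓝 x))
    (hbot : Tendsto (sqDist α) atBot (𝓝 x)) (hne : ∀ s, sqDist α s ≠ x) :
    SpiralsTo α (Real.sqrt x) := by
  have hR := Real.sqrt_pos.2 hx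
  have hang := levelAng_ne_zero (ω := ω) hx hq
  have hcontAng : ContinuousAt (levelAng a C ω) x := by
    have hS : ContinuousAt (levelS a C ω) x := (hasDerivAt_levelS hx.le).continuousAt
    have : levelAng a C ω =ᶠ[𝓝 x] fun r => levelS a C ω r / r := by
      filter_upwards [lt_mem_nhds hx] with r hr
      unfold levelAng
      split_ifs with hC
      · rw [eq_div_iff hr.ne']
        unfold levelS levelP
        rw [hC]; ring
      · rfl
    exact (hS.div continuousAt_id hx.ne').congr this.symm
  set φ := sweptAngle a C ω α
  have dφ := hα.hasDerivAt_sweptAngle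
  have cφ : Continuous φ := continuous_iff_continuousAt.2 fun s => (dφ s).continuousAt
  have heTop : Tendsto (fun s => Real.sqrt (sqDist α s)) atTop (𝓝 (Real.sqrt x)) :=
    (Real.continuous_sqrt.tendsto x).comp htop
  have heBot : Tendsto (fun s => Real.sqrt (sqDist α (-s))) atTop (𝓝 (Real.sqrt x)) :=
    (Real.continuous_sqrt.tendsto x).comp (hbot.comp tendsto_neg_atTop_atBot)
  have hlimTop := tendsto_of_deriv_tendsto dφ (hcontAng.tendsto.comp htop) hang
  have hlimBot := tendsto_of_deriv_tendsto (φ := fun s => φ (-s))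
    (g := fun s => -levelAng a C ω (sqDist α (-s))) (c := -levelAng a C ω x)
    (fun s => ((dφ (-s)).comp s (hasDerivAt_neg s)).congr_deriv (by ring))
    ((hcontAng.tendsto.comp (hbot.comp tendsto_neg_atTop_atBot)).neg) (neg_ne_zero.2 hang)
  -- near either end the curve stays off the origin
  obtain ⟨S₁, hS₁⟩ := eventually_atTop.1 (htop.eventually (lt_mem_nhds hx))
  obtain ⟨S₂, hS₂⟩ := eventually_atBot.1 (hbot.eventually (lt_mem_nhds hx))
  obtain ⟨ψ₁, hψ₁⟩ := hα.exists_polar (U := Ioi S₁) isOpen_Ioi isPreconnected_Ioi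
    fun s hs => hS₁ s (le_of_lt hs)
  obtain ⟨ψ₂, hψ₂⟩ := hα.exists_polar (U := Iio S₂) isOpen_Iio isPreconnected_Iio
    fun s hs => hS₂ s (le_of_lt hs)
  have addc : ∀ {f : ℝ → ℝ} (c : ℝ), (Tendsto f atTop atTop ∨ Tendsto f atTop atBot) →
      (Tendsto (fun s => f s + c) atTop atTop ∨ Tendsto (fun s => f s + c) atTop atBot) :=
    fun c h => h.imp (tendsto_atTop_add_const_right _ c) (tendsto_atBot_add_const_right _ c)
  obtain ⟨e1, w1⟩ := spiral_end (γ := α) (S := S₁ + 1) hα.continuous hR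
    (ψ := fun s => φ s + ψ₁) (cφ.add continuous_const).continuousOn (addc ψ₁ hlimTop) heTop
    fun s hs => hψ₁ s (lt_of_lt_of_le (lt_add_one S₁) hs)
  obtain ⟨e2, w2⟩ := spiral_end (γ := fun s => α (-s)) (S := -S₂ + 1)
    (hα.continuous.comp continuous_neg) hR
    (ψ := fun s => φ (-s) + ψ₂) ((cφ.comp continuous_neg).add continuous_const).continuousOn
    (addc ψ₂ hlimBot) heBot fun s hs => hψ₂ (-s) (by
      have : -S₂ + 1 ≤ s := hs
      simp only [mem_Iio]; linarith)
  refine ⟨⟨fun s => ?_, e1, ?_⟩, fun p hp => ⟨w1 p hp, ?_⟩⟩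
  · rw [norm_eq_sqrt_sqDist]
    intro h
    exact hne s ((Real.sqrt_inj (sqDist_nonneg α s) hx.le).1 h)
  · rw [← e2]
    ext p
    have : map α atBot = map (fun s => α (-s)) atTop := by
      rw [← Filter.map_neg_atTop (G := ℝ), Filter.map_map]; rfl
    simp only [mem_ofPred]
    unfold MapClusterPt
    rw [this]
  · obtain ⟨S', ψ', h1, h2, h3⟩ := w2 p hp
    refine ⟨-S', fun s => ψ' (-s), h1.comp continuous_neg.continuousOn fun s hs => ?_,
      fun s hs => ?_, h3.comp tendsto_neg_atBot_atTop⟩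
    · have : s ≤ -S' := hs
      simp only [mem_Ici]; linarith
    · have := h2 (-s) (by have : s ≤ -S' := hs; simp only [mem_Ici]; linarith)
      simpa using this

/-- Every profile curve is bounded, because `q ≥ 0` along it. -/
theorem Represents.norm_le {a C ω : ℝ} (ha : a ≠ 0) {α : ℝ → E2} (hα : Represents a C ω α)
    (s : ℝ) : ‖α s‖ ≤ Real.sqrt (1 + (21 + 4 * |C|) / |a|) := by
  rw [norm_eq_sqrt_sqDist]
  exact Real.sqrt_le_sqrt ((le_abs_self _).trans (abs_le_of_q_nonneg ha (hα.q_nonneg s)))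

/-- A drop on a homoclinic orbit is not properly immersed. -/
theorem Represents.not_properlyImmersed_of_tendsto {a C ω x : ℝ} (ha : a ≠ 0) {α : ℝ → E2}
    (hα : Represents a C ω α) (htop : Tendsto (sqDist α) atTop (𝓝 x))
    (hne : ∀ s, sqDist α s ≠ x) : ¬ ProperlyImmersed (helicoidal ω α) := by
  refine not_properlyImmersed ω (hα.norm_le ha) fun T hT => ?_
  by_contra hT0
  have hp : Function.Periodic (sqDist α) T := fun s => by unfold sqDist; rw [hT s]
  have hp' : Function.Periodic (sqDist α) |T| := by
    rcases abs_choice T with h | h <;> rw [h]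
    · exact hp
    · exact hp.neg
  -- the multiples of a period would give a constant sequence with limit `x`
  have h1 : Tendsto (fun n : ℕ => sqDist α ((n : ℝ) * |T|)) atTop (𝓝 x) :=
    htop.comp (tendsto_natCast_atTop_atTop.atTop_mul_const (abs_pos.2 hT0))
  have h2 : (fun n : ℕ => sqDist α ((n : ℝ) * |T|)) = fun _ => sqDist α 0 := by
    funext n
    have := hp'.nat_mul n 0
    rwa [zero_add] at this
  rw [h2] at h1
  exact hne 0 (tendsto_nhds_unique tendsto_const_nhds h1)

/-! ### Round cylinders -/

/-- A drop at constant distance from the axis is a round cylinder. -/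
theorem Represents.isCircular {a C ω x : ℝ} {α : ℝ → E2} (hα : Represents a C ω α) (hx : 0 < x)
    (hq : (q a C).eval x = 0) (hconst : ∀ s, sqDist α s = x) :
    IsCircular ω α (Real.sqrt x) ∧ ProperlyImmersed (helicoidal ω α) := by
  have hang := levelAng_ne_zero (ω := ω) hx hq
  set c := levelAng a C ω x
  have hφ : ∀ s, sweptAngle a C ω α s = s * c := fun s => by
    unfold sweptAngle
    simp_rw [hconst]
    simp [c]
  obtain ⟨ψ₀, hψ⟩ := hα.exists_polar (U := univ) isOpen_univ isPreconnected_univ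
    fun s _ => by rw [hconst]; exact hx
  simp only [hconst, hφ, mem_univ, forall_true_left] at hψ
  refine ⟨⟨Real.sqrt_pos.2 hx, ?_⟩, ?_⟩
  · ext p
    unfold surface roundCylinder
    rw [mem_ofPred, Real.sq_sqrt hx.le]
    constructor
    · rintro ⟨z, rfl⟩
      rw [helicoidal_sqDist, hconst]
    · intro hp
      set u := Real.cos (ω * p 2)
      set w := Real.sin (ω * p 2)
      have huw : u ^ 2 + w ^ 2 = 1 := Real.cos_sq_add_sin_sq _
      have hs := Real.sq_sqrt hx.le
      have hs0 := (Real.sqrt_pos.2 hx).ne'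
      obtain ⟨β, h1, h2⟩ := exists_cos_sin (A := (p 0 * u - p 1 * w) / Real.sqrt x)
        (B := (p 0 * w + p 1 * u) / Real.sqrt x) (by
          rw [div_pow, div_pow, ← add_div, div_eq_one_iff_eq (pow_ne_zero 2 hs0), hs]
          linear_combination (p 0 ^ 2 + p 1 ^ 2) * huw + hp)
      rw [div_eq_iff hs0] at h1 h2
      have hβ : (β - ψ₀) / c * c + ψ₀ = β := by rw [div_mul_cancel₀ _ hang]; ring
      obtain ⟨e1, e2⟩ := hψ ((β - ψ₀) / c)
      rw [hβ] at e1 e2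
      refine ⟨((β - ψ₀) / c, p 2), ?_⟩
      ext i
      fin_cases i
      · change helicoidal ω α _ 0 = p 0
        rw [helicoidal_zero, e1, e2]
        change Real.sqrt x * Real.cos β * u + Real.sqrt x * Real.sin β * w = p 0
        linear_combination p 0 * huw - u * h1 - w * h2
      · change helicoidal ω α _ 1 = p 1
        rw [helicoidal_one, e1, e2]
        change -(Real.sqrt x * Real.cos β) * w + Real.sqrt x * Real.sin β * u = p 1
        linear_combination p 1 * huw + w * h1 - u * h2
      · rfl
  · refine properlyImmersed_of_periodic ω hα.continuous (T := 2 * Real.pi / |c|)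
      (div_pos Real.two_pi_pos (abs_pos.2 hang)) fun s => ?_
    have hT : ∃ n : ℤ, (s + 2 * Real.pi / |c|) * c + ψ₀ = s * c + ψ₀ + n * (2 * Real.pi) := by
      rcases hang.lt_or_gt with h | h
      · refine ⟨-1, ?_⟩
        rw [abs_of_neg h]
        field_simp
        push_cast
        ring
      · refine ⟨1, ?_⟩
        rw [abs_of_pos h]
        field_simp
        push_cast
        ring
    obtain ⟨n, hn⟩ := hT
    ext i
    fin_cases i
    · change α _ 0 = α s 0
      rw [(hψ _).1, (hψ s).1, hn, Real.cos_add_int_mul_two_pi]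
    · change α _ 1 = α s 1
      rw [(hψ _).2, (hψ s).2, hn, Real.sin_add_int_mul_two_pi]

/-! ### The angle swept over one period -/

section Swept

open MeasureTheory

variable {a C ω x₁ x₂ s₀ T : ℝ} {α : ℝ → E2}

/-- The substitution `r = |α(s)|²` turns the angular velocity of the profile curve into the
integrand of `Δθ̃`. -/
theorem Represents.deltaTheta_eq (hα : Represents a C ω α) (hT : 0 < T) (h0 : sqDist α s₀ = x₁)
    (h1 : sqDist α (s₀ + T) = x₂) (hv : ∀ s ∈ Ioo s₀ (s₀ + T), 0 < sqDistVel α s) :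
    IntervalIntegrable (deltaIntegrand a C ω) volume x₁ x₂ ∧
      deltaTheta a C ω x₁ x₂ = 2 * ∫ s in s₀..(s₀ + T), levelAng a C ω (sqDist α s) := by
  have hN := hα.isNewton
  have hle : s₀ ≤ s₀ + T := by linarith
  have hmono : StrictMonoOn (sqDist α) (Icc s₀ (s₀ + T)) := by
    refine strictMonoOn_of_deriv_pos (convex_Icc _ _) hN.continuous_pos.continuousOn fun s hs => ?_
    rw [interior_Icc] at hs
    rw [(hN.deriv_pos s).deriv]
    exact hv s hs
  have hx : x₁ < x₂ := by
    rw [← h0, ← h1]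
    exact hmono ⟨le_rfl, hle⟩ ⟨hle, le_rfl⟩ (by linarith)
  have himage : sqDist α '' Ioo s₀ (s₀ + T) = Ioo x₁ x₂ := by
    apply Subset.antisymm
    · rintro _ ⟨s, hs, rfl⟩
      rw [← h0, ← h1]
      exact ⟨hmono ⟨le_rfl, hle⟩ (Ioo_subset_Icc_self hs) hs.1,
        hmono (Ioo_subset_Icc_self hs) ⟨hle, le_rfl⟩ hs.2⟩
    · rw [← h0, ← h1]
      exact intermediate_value_Ioo hle hN.continuous_pos.continuousOn
  have hd : ∀ s ∈ Ioo s₀ (s₀ + T),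
      HasDerivWithinAt (sqDist α) (sqDistVel α s) (Ioo s₀ (s₀ + T)) s :=
    fun s _ => (hN.deriv_pos s).hasDerivWithinAt
  have hinj : InjOn (sqDist α) (Ioo s₀ (s₀ + T)) := (hmono.mono Ioo_subset_Icc_self).injOn
  have hint : ∀ s ∈ Ioo s₀ (s₀ + T),
      |sqDistVel α s| • deltaIntegrand a C ω (sqDist α s)
        = 2 * levelAng a C ω (sqDist α s) := by
    intro s hs
    have hvs := hv s hs
    have hr : 0 < sqDist α s :=
      (sqDist_nonneg α s₀).trans_lt (hmono ⟨le_rfl, hle⟩ (Ioo_subset_Icc_self hs) hs.1)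
    have hq : 0 < (q a C).eval (sqDist α s) :=
      levelQ_pos_iff.1 (by rw [← hN.energy]; positivity)
    have hD := sqrt_levelD_pos a C ω (sqDist α s)
    have hqs := Real.sqrt_pos.2 hq
    have hvel : sqDistVel α s
        = 2 * Real.sqrt ((q a C).eval (sqDist α s)) / Real.sqrt (levelD a C ω (sqDist α s)) := by
      rw [← abs_of_pos hvs, ← abs_of_pos (show 0 < 2 * Real.sqrt ((q a C).eval (sqDist α s)) /
        Real.sqrt (levelD a C ω (sqDist α s)) by positivity), ← sq_eq_sq_iff_abs_eq_abs, hN.energy,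
        div_pow, mul_pow, Real.sq_sqrt hq.le, Real.sq_sqrt (levelD_pos _ _ _ _).le]
      unfold levelQ
      norm_num
    have hang : levelAng a C ω (sqDist α s) = levelS a C ω (sqDist α s) / sqDist α s := by
      rw [eq_div_iff hr.ne', levelAng_mul hq.le]
    rw [abs_of_pos hvs, hvel, hang, smul_eq_mul]
    unfold deltaIntegrand levelS levelP
    field_simp
    ring
  have hcont := hα.continuous_levelAng
  constructor
  · rw [intervalIntegrable_iff_integrableOn_Ioo_of_le hx.le, ← himage,
      integrableOn_image_iff_integrableOn_abs_deriv_smul measurableSet_Ioo hd hinj]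
    refine IntegrableOn.congr_fun ?_ (fun s hs => (hint s hs).symm) measurableSet_Ioo
    exact ((hcont.const_mul 2).integrableOn_Icc (a := s₀) (b := s₀ + T)).mono_set
      Ioo_subset_Icc_self
  · unfold deltaTheta
    rw [intervalIntegral.integral_of_le hx.le, integral_Ioc_eq_integral_Ioo, ← himage,
      integral_image_eq_integral_abs_deriv_smul measurableSet_Ioo hd hinj,
      setIntegral_congr_fun measurableSet_Ioo hint, ← intervalIntegral.integral_const_mul,
      intervalIntegral.integral_of_le hle, integral_Ioc_eq_integral_Ioo]

/-- Over a full period the profile curve sweeps the angle `Δθ̃`. -/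
theorem Represents.sweptAngle_period (ha : a ≠ 0) (hα : Represents a C ω α) (hT : 0 < T)
    (hq : (q a C).eval x₁ = 0)
    (h0 : sqDist α s₀ = x₁) (h1 : sqDist α (s₀ + T) = x₂)
    (hv : ∀ s ∈ Ioo s₀ (s₀ + T), 0 < sqDistVel α s)
    (hper : ∀ s, treadmillSled α (s + 2 * T) = treadmillSled α s) :
    sweptAngle a C ω α (s₀ + 2 * T) = sweptAngle a C ω α s₀ + deltaTheta a C ω x₁ x₂ := by
  have hcont := hα.continuous_levelAng
  have hii := fun u w => hcont.intervalIntegrable (μ := volume) u w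
  have hp : Function.Periodic (fun s => levelAng a C ω (sqDist α s)) (2 * T) := fun s => by
    simp only [((hα.treadmillSled_eq_iff hα).1 (hper s)).1]
  have hsymm := hα.isNewton.symm_of_vel_eq_zero (isPotential_levelQ ha C ω) (b := s₀)
    (hα.isNewton.vel_eq_zero (by rw [h0]; exact levelQ_eq_zero_iff.2 hq))
  have e1 : sweptAngle a C ω α (s₀ + 2 * T) - sweptAngle a C ω α s₀
      = ∫ s in s₀..(s₀ + 2 * T), levelAng a C ω (sqDist α s) :=
    intervalIntegral.integral_interval_sub_left (hii _ _) (hii _ _)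
  have e2 := hp.intervalIntegral_add_eq s₀ (s₀ - T)
  have e3 := intervalIntegral.integral_add_adjacent_intervals (hii (s₀ - T) s₀) (hii s₀ (s₀ + T))
  -- the distance to the origin is symmetric about the turning point `s₀`
  have e4 : ∫ s in (s₀ - T)..s₀, levelAng a C ω (sqDist α s)
      = ∫ s in s₀..(s₀ + T), levelAng a C ω (sqDist α s) := by
    have h2 : (fun s => levelAng a C ω (sqDist α s))
        = fun s => levelAng a C ω (sqDist α (2 * s₀ - s)) := by
      funext s
      have := (hsymm (s₀ - s)).1
      rw [show s₀ - (s₀ - s) = s by ring, show s₀ + (s₀ - s) = 2 * s₀ - s by ring] at this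
      rw [this]
    rw [h2, intervalIntegral.integral_comp_sub_left
      (fun s => levelAng a C ω (sqDist α s)) (2 * s₀), ← h2]
    congr 1 <;> ring
  rw [show s₀ - T + 2 * T = s₀ + T by ring] at e2
  rw [(hα.deltaTheta_eq hT h0 h1 hv).2]
  linarith

end Swept

/-! ### The monodromy of a periodic TreadmillSled -/

theorem rot_add (δ ε : ℝ) (v : E2) : rot (δ + ε) v = rot δ (rot ε v) := by
  unfold rot
  rw [Real.cos_add, Real.sin_add]
  ext i
  fin_cases i
  · change _ = Real.cos δ * (Real.cos ε * v 0 - Real.sin ε * v 1)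
      - Real.sin δ * (Real.sin ε * v 0 + Real.cos ε * v 1)
    change (Real.cos δ * Real.cos ε - Real.sin δ * Real.sin ε) * v 0
      - (Real.sin δ * Real.cos ε + Real.cos δ * Real.sin ε) * v 1 = _
    ring
  · change _ = Real.sin δ * (Real.cos ε * v 0 - Real.sin ε * v 1)
      + Real.cos δ * (Real.sin ε * v 0 + Real.cos ε * v 1)
    change (Real.sin δ * Real.cos ε + Real.cos δ * Real.sin ε) * v 0
      + (Real.cos δ * Real.cos ε - Real.sin δ * Real.sin ε) * v 1 = _
    ring

theorem rot_zero (v : E2) : rot 0 v = v := by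
  ext i
  fin_cases i
  · change Real.cos 0 * v 0 - Real.sin 0 * v 1 = v 0
    simp
  · change Real.sin 0 * v 0 + Real.cos 0 * v 1 = v 1
    simp

theorem rot_congr {δ ε : ℝ} (hc : Real.cos δ = Real.cos ε) (hs : Real.sin δ = Real.sin ε) (v : E2) :
    rot δ v = rot ε v := by
  unfold rot
  rw [hc, hs]

/-- A rotation is determined by the image of one unit vector. -/
theorem cos_sin_eq_of_rot {δ ε u : ℝ} (h0 : Real.cos (u + ε) = Real.cos δ * Real.cos u
      - Real.sin δ * Real.sin u)
    (h1 : Real.sin (u + ε) = Real.sin δ * Real.cos u + Real.cos δ * Real.sin u) :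
    Real.cos δ = Real.cos ε ∧ Real.sin δ = Real.sin ε := by
  rw [Real.cos_add] at h0
  rw [Real.sin_add] at h1
  have := Real.cos_sq_add_sin_sq u
  constructor
  · linear_combination (Real.cos ε - Real.cos δ) * this - Real.cos u * h0 - Real.sin u * h1
  · linear_combination (Real.sin ε - Real.sin δ) * this + Real.sin u * h0 - Real.cos u * h1

/-- At a passage through the origin, the direction of a unit speed curve is the limit of the
direction of its position vector, up to the sign `σ` of the elapsed time. -/
theorem deriv_eq_of_polar {α : ℝ → E2} {s₁ : ℝ} (hα : DifferentiableAt ℝ α s₁)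
    (hunit : ‖deriv α s₁‖ = 1) (h0 : α s₁ = 0) {l : Filter ℝ} [NeBot l] (hl : l ≤ 𝓝[≠] s₁)
    {σ : ℝ} (hσ : ∀ᶠ s in l, |s - s₁| = σ * (s - s₁)) {w : ℝ → ℝ} (hw : ContinuousAt w s₁)
    {i : Fin 2} (hpol : ∀ᶠ s in l, α s i = Real.sqrt (sqDist α s) * w s) :
    deriv α s₁ i = σ * w s₁ := by
  have h1 := (hasDerivAt_iff_tendsto_slope.1 hα.hasDerivAt).mono_left hl
  have h2 : Tendsto (fun s => ‖slope α s₁ s‖) l (𝓝 1) := by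
    rw [← hunit]; exact h1.norm
  have h3 : Tendsto (fun s => slope α s₁ s i) l (𝓝 (deriv α s₁ i)) :=
    ((EuclideanSpace.proj (𝕜 := ℝ) i).continuous.tendsto _).comp h1
  have h4 : Tendsto (fun s => σ * (‖slope α s₁ s‖ * w s)) l (𝓝 (σ * (1 * w s₁))) :=
    (h2.mul (hw.tendsto.mono_left (hl.trans nhdsWithin_le_nhds))).const_mul σ
  rw [one_mul] at h4
  refine tendsto_nhds_unique (h3.congr' ?_) h4
  have hne : ∀ᶠ s in l, s ≠ s₁ := hl self_mem_nhdsWithin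
  filter_upwards [hσ, hpol, hne] with s hs hp hne
  have hne' := sub_ne_zero.2 hne
  have hs0 : |s - s₁| ≠ 0 := abs_ne_zero.2 hne'
  have hsl : slope α s₁ s = (s - s₁)⁻¹ • α s := by
    rw [slope_def_module, h0, sub_zero]
  rw [hsl, norm_smul, norm_eq_sqrt_sqDist, norm_inv, Real.norm_eq_abs]
  change (s - s₁)⁻¹ * α s i = _
  rw [hp, hs]
  have hσ0 : σ ≠ 0 := by
    rintro rfl
    rw [zero_mul] at hs
    exact hs0 hs
  field_simp

/-- Over one period of its TreadmillSled the profile curve is rotated by the angle `Δθ̃`; a passage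
through the origin adds a half turn. -/
theorem SimpleArc.monodromy {a C ω x₁ x₂ s₀ T : ℝ} {α : ℝ → E2} (ha : a ≠ 0)
    (A : SimpleArc a C x₁ x₂) (hα : Represents a C ω α) (hT : 0 < T) (h0 : sqDist α s₀ = x₁)
    (h1 : sqDist α (s₀ + T) = x₂) (hv : ∀ s ∈ Ioo s₀ (s₀ + T), 0 < sqDistVel α s)
    (hI : ∀ s, sqDist α s ∈ Icc x₁ x₂)
    (hper : ∀ s, treadmillSled α (s + 2 * T) = treadmillSled α s)
    (hfp : IsFundamentalPiece a C ω α s₀ (s₀ + 2 * T)) (s : ℝ) :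
    α (s + 2 * T) = rot (if x₁ = 0 then deltaTheta a C ω x₁ x₂ + Real.pi
      else deltaTheta a C ω x₁ x₂) (α s) := by
  have hφ := hα.sweptAngle_period ha hT A.root₁ h0 h1 hv hper
  set Δ := deltaTheta a C ω x₁ x₂
  set φ := sweptAngle a C ω α
  obtain ⟨δ, hδ⟩ := exists_eq_rot ha hα hα (s := 0) (t := 2 * T)
    (by rw [← hper 0, zero_add])
  simp only [add_zero] at hδ
  rw [(hδ s).1]
  split_ifs with hx
  -- The curve runs from the origin back to the origin. Polar coordinates hold in between, and the
  -- tangents at both ends are limits of the direction of the position vector, which points forward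
  -- at the start and backward at the end.
  · have z0 : α s₀ = 0 := by
      rw [← norm_eq_zero, norm_eq_sqrt_sqDist, h0, hx, Real.sqrt_zero]
    have z1 : α (s₀ + 2 * T) = 0 := by
      rw [← norm_eq_zero, norm_eq_sqrt_sqDist,
        ((hα.treadmillSled_eq_iff hα).1 (hper s₀)).1, h0, hx, Real.sqrt_zero]
    obtain ⟨ψ, hψ⟩ := hα.exists_polar (U := Ioo s₀ (s₀ + 2 * T)) isOpen_Ioo isPreconnected_Ioo
      fun t ht => by
        refine (sqDist_nonneg α t).lt_of_ne fun h => ?_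
        rw [← hx] at h
        have vz : ∀ t, sqDist α t = x₁ → sqDistVel α t = 0 := fun t h =>
          hα.isNewton.vel_eq_zero (by rw [h]; exact levelQ_eq_zero_iff.2 A.root₁)
        have := hfp.once ⟨ht.1.le, ht.2⟩ ⟨le_rfl, hfp.lt⟩
          ((hα.treadmillSled_eq_iff hα).2 ⟨h.symm.trans h0.symm, by rw [vz t h.symm, vz s₀ h0]⟩)
        exact ht.1.ne' this
    have hd : Differentiable ℝ α := hα.1.smooth.differentiable (by simp)
    have hφc : Continuous φ :=
      continuous_iff_continuousAt.2 fun s => (hα.hasDerivAt_sweptAngle s).continuousAt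
    have hlt : s₀ < s₀ + 2 * T := hfp.lt
    have m0 : ∀ᶠ t in 𝓝[>] s₀, t ∈ Ioo s₀ (s₀ + 2 * T) := Ioo_mem_nhdsGT hlt
    have m1 : ∀ᶠ t in 𝓝[<] (s₀ + 2 * T), t ∈ Ioo s₀ (s₀ + 2 * T) := Ioo_mem_nhdsLT hlt
    have l0 : 𝓝[>] s₀ ≤ 𝓝[≠] s₀ := nhdsWithin_mono _ fun t (ht : s₀ < t) => ht.ne'
    have l1 : 𝓝[<] (s₀ + 2 * T) ≤ 𝓝[≠] (s₀ + 2 * T) :=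
      nhdsWithin_mono _ fun t (ht : t < s₀ + 2 * T) => ht.ne
    have σ0 : ∀ᶠ t in 𝓝[>] s₀, |t - s₀| = 1 * (t - s₀) := m0.mono fun t ht => by
      rw [abs_of_pos (sub_pos.2 ht.1), one_mul]
    have σ1 : ∀ᶠ t in 𝓝[<] (s₀ + 2 * T), |t - (s₀ + 2 * T)| = (-1) * (t - (s₀ + 2 * T)) :=
      m1.mono fun t ht => by rw [abs_of_neg (sub_neg.2 ht.2)]; ring
    have wc : Continuous fun t => Real.cos (φ t + ψ) := by fun_prop
    have ws : Continuous fun t => Real.sin (φ t + ψ) := by fun_prop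
    have a0 := deriv_eq_of_polar (i := 0) (hd s₀) (hα.1.unit_speed s₀) z0 l0 σ0 wc.continuousAt
      (m0.mono fun t ht => (hψ t ht).1)
    have a1 := deriv_eq_of_polar (i := 1) (hd s₀) (hα.1.unit_speed s₀) z0 l0 σ0 ws.continuousAt
      (m0.mono fun t ht => (hψ t ht).2)
    have b0 := deriv_eq_of_polar (i := 0) (hd _) (hα.1.unit_speed _) z1 l1 σ1 wc.continuousAt
      (m1.mono fun t ht => (hψ t ht).1)
    have b1 := deriv_eq_of_polar (i := 1) (hd _) (hα.1.unit_speed _) z1 l1 σ1 ws.continuousAt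
      (m1.mono fun t ht => (hψ t ht).2)
    have hrot := (hδ s₀).2
    have c0 : deriv α (s₀ + 2 * T) 0
        = Real.cos δ * deriv α s₀ 0 - Real.sin δ * deriv α s₀ 1 := by rw [hrot]; rfl
    have c1 : deriv α (s₀ + 2 * T) 1
        = Real.sin δ * deriv α s₀ 0 + Real.cos δ * deriv α s₀ 1 := by rw [hrot]; rfl
    rw [a0, a1, b0, hφ] at c0
    rw [a0, a1, b1, hφ] at c1
    have e := cos_sin_eq_of_rot (δ := δ) (ε := Δ + Real.pi) (u := φ s₀ + ψ)
      (by rw [← add_assoc, Real.cos_add_pi, add_right_comm, ← one_mul (Real.cos (φ s₀ + ψ)),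
            ← one_mul (Real.sin (φ s₀ + ψ)), ← c0]; ring)
      (by rw [← add_assoc, Real.sin_add_pi, add_right_comm, ← one_mul (Real.cos (φ s₀ + ψ)),
            ← one_mul (Real.sin (φ s₀ + ψ)), ← c1]; ring)
    exact rot_congr e.1 e.2 _
  -- off the origin, polar coordinates hold along the whole curve
  · have hx0 : 0 < x₁ := (h0 ▸ sqDist_nonneg α s₀).lt_of_ne (Ne.symm hx)
    obtain ⟨ψ, hψ⟩ := hα.exists_polar (U := univ) isOpen_univ isPreconnected_univ
      fun t _ => hx0.trans_le (hI t).1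
    have hsq := Real.sqrt_pos.2 hx0
    have hr : sqDist α (s₀ + 2 * T) = x₁ := by
      rw [((hα.treadmillSled_eq_iff hα).1 (hper s₀)).1, h0]
    have c0 : α (s₀ + 2 * T) 0 = Real.cos δ * α s₀ 0 - Real.sin δ * α s₀ 1 := by
      rw [(hδ s₀).1]; rfl
    have c1 : α (s₀ + 2 * T) 1 = Real.sin δ * α s₀ 0 + Real.cos δ * α s₀ 1 := by
      rw [(hδ s₀).1]; rfl
    rw [(hψ _ (mem_univ _)).1, (hψ s₀ (mem_univ _)).1, (hψ s₀ (mem_univ _)).2, hr, h0,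
      show sweptAngle a C ω α (s₀ + 2 * T) = sweptAngle a C ω α s₀ + Δ from hφ] at c0
    rw [(hψ _ (mem_univ _)).2, (hψ s₀ (mem_univ _)).1, (hψ s₀ (mem_univ _)).2, hr, h0,
      show sweptAngle a C ω α (s₀ + 2 * T) = sweptAngle a C ω α s₀ + Δ from hφ] at c1
    have e := cos_sin_eq_of_rot (δ := δ) (ε := Δ) (u := φ s₀ + ψ)
      (mul_left_cancel₀ hsq.ne' (by rw [add_right_comm]; linear_combination c0))
      (mul_left_cancel₀ hsq.ne' (by rw [add_right_comm]; linear_combination c1))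
    exact rot_congr e.1 e.2 _

/-! ### Closed and dense profile curves -/

theorem rot_int_mul {α : ℝ → E2} {P δ : ℝ} (h : ∀ s, α (s + P) = rot δ (α s)) (n : ℤ) (s : ℝ) :
    α (s + n * P) = rot (n * δ) (α s) := by
  induction n with
  | zero => simp [rot_zero]
  | succ n ih =>
    push_cast at ih ⊢
    rw [show s + ((n : ℝ) + 1) * P = s + n * P + P by ring, h, ih, ← rot_add]
    congr 1
    ring
  | pred n ih =>
    push_cast at ih ⊢
    have h1 := h (s + (-(n : ℝ) - 1) * P)
    rw [show s + (-(n : ℝ) - 1) * P + P = s + -(n : ℝ) * P by ring, ih] at h1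
    rw [show (-(n : ℝ) - 1) * δ = -δ + -(n : ℝ) * δ by ring, rot_add, h1, ← rot_add,
      neg_add_cancel, rot_zero]

theorem rotZ_helicoidal (ω δ : ℝ) {α : ℝ → E2} {s s' t : ℝ} (h : α s' = rot δ (α s)) :
    helicoidal ω α (s', t) = rotZ δ (helicoidal ω α (s, t)) := by
  have h0 : α s' 0 = Real.cos δ * α s 0 - Real.sin δ * α s 1 := by rw [h]; rfl
  have h1 : α s' 1 = Real.sin δ * α s 0 + Real.cos δ * α s 1 := by rw [h]; rfl
  ext i
  fin_cases i
  · change helicoidal ω α (s', t) 0 = Real.cos δ * helicoidal ω α (s, t) 0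
      - Real.sin δ * helicoidal ω α (s, t) 1
    simp only [helicoidal_zero, helicoidal_one, h0, h1]
    ring
  · change helicoidal ω α (s', t) 1 = Real.sin δ * helicoidal ω α (s, t) 0
      + Real.cos δ * helicoidal ω α (s, t) 1
    simp only [helicoidal_zero, helicoidal_one, h0, h1]
    ring
  · rfl

theorem rotZ_congr {δ ε : ℝ} (n : ℤ) (h : δ = ε + n * (2 * Real.pi)) : rotZ δ = rotZ ε := by
  funext v
  unfold rotZ
  rw [h, Real.cos_add_int_mul_two_pi, Real.sin_add_int_mul_two_pi]

theorem rotZ_mem_surface {ω P δ : ℝ} {α : ℝ → E2} (h : ∀ s, α (s + P) = rot δ (α s)) (n : ℤ)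
    {p : E3} (hp : p ∈ surface ω α) : rotZ (n * δ) p ∈ surface ω α := by
  obtain ⟨⟨s, t⟩, rfl⟩ := hp
  exact ⟨(s + n * P, t), rotZ_helicoidal ω _ (rot_int_mul h n s)⟩

/-- A profile curve that is rotated by a rational part of a full turn in each period is closed, and
its surface has the corresponding symmetry. -/
theorem properlyImmersed_of_rational {ω P δ : ℝ} {α : ℝ → E2} (hα : Continuous α) (hP : 0 < P)
    (h : ∀ s, α (s + P) = rot δ (α s)) {p : ℚ} (hp : δ / (2 * Real.pi) = p) :
    ProperlyImmersed (helicoidal ω α) ∧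
      ∃ (m : ℕ) (k : ℤ), 0 < m ∧ IsCoprime k (m : ℤ) ∧ δ = 2 * Real.pi * k / m ∧
        rotZ (2 * Real.pi / m) '' surface ω α = surface ω α := by
  have hm : (0 : ℝ) < p.den := by exact_mod_cast p.den_pos
  have hδ : δ = 2 * Real.pi * p.num / p.den := by
    rw [div_eq_iff Real.two_pi_pos.ne', Rat.cast_def] at hp
    rw [hp]
    ring
  have hcop : IsCoprime p.num (p.den : ℤ) := by
    rw [Int.isCoprime_iff_gcd_eq_one]
    exact p.reduced
  constructor
  · refine properlyImmersed_of_periodic ω hα (T := (p.den : ℤ) * P) (by positivity) fun s => ?_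
    rw [rot_int_mul h, ← rot_zero (α s), ← rot_add, add_zero]
    have e : ((p.den : ℤ) : ℝ) * δ = 0 + p.num * (2 * Real.pi) := by
      rw [hδ]
      push_cast
      field_simp
      ring
    exact rot_congr (by rw [e, Real.cos_add_int_mul_two_pi])
      (by rw [e, Real.sin_add_int_mul_two_pi]) _
  · refine ⟨p.den, p.num, p.den_pos, hcop, hδ, ?_⟩
    obtain ⟨u, w, huw⟩ := hcop
    have huw' : (u : ℝ) * p.num + w * p.den = 1 := by exact_mod_cast huw
    -- by Bézout, the rotation by `2π/m` is a power of the rotation by `2πk/m`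
    have key : ∀ n : ℤ, ∀ x ∈ surface ω α, rotZ (n * (2 * Real.pi / p.den)) x ∈ surface ω α := by
      intro n x hx
      rw [rotZ_congr (ε := (n * u : ℤ) * δ) (n * w)]
      · exact rotZ_mem_surface h _ hx
      · rw [hδ]
        push_cast
        field_simp
        linear_combination (-n : ℝ) * huw'
    apply Subset.antisymm
    · rintro _ ⟨x, hx, rfl⟩
      simpa using key 1 x hx
    · intro x hx
      refine ⟨_, key (-1) x hx, ?_⟩
      have cs := Real.cos_sq_add_sin_sq (2 * Real.pi / p.den)
      have e : ((-1 : ℤ) : ℝ) * (2 * Real.pi / p.den) = -(2 * Real.pi / p.den) := by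
        push_cast; ring
      unfold rotZ
      rw [e, Real.cos_neg, Real.sin_neg]
      set c := Real.cos (2 * Real.pi / p.den)
      set d := Real.sin (2 * Real.pi / p.den)
      ext i
      fin_cases i
      · change c * (c * x 0 - -d * x 1) - d * (-d * x 0 + c * x 1) = x 0
        linear_combination x 0 * cs
      · change d * (c * x 0 - -d * x 1) + c * (-d * x 0 + c * x 1) = x 1
        linear_combination x 1 * cs
      · rfl

/-- Two points at the same distance from the axis and at the same height differ by a rotation. -/
theorem exists_rotZ {p p' : E3} (h : p 0 ^ 2 + p 1 ^ 2 = p' 0 ^ 2 + p' 1 ^ 2) (h2 : p 2 = p' 2) :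
    ∃ θ, p = rotZ θ p' := by
  set r := p' 0 ^ 2 + p' 1 ^ 2 with hr
  rcases (show 0 ≤ r by positivity).eq_or_lt with h0 | h0
  · have z : ∀ {u w : ℝ}, u ^ 2 + w ^ 2 = 0 → u = 0 ∧ w = 0 := fun {u w} e => by
      constructor <;> nlinarith [sq_nonneg u, sq_nonneg w]
    obtain ⟨e0, e1⟩ := z (h.trans h0.symm)
    obtain ⟨e0', e1'⟩ := z h0.symm
    refine ⟨0, ?_⟩
    ext i
    fin_cases i
    · change p 0 = Real.cos 0 * p' 0 - Real.sin 0 * p' 1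
      rw [e0, e0', e1']; ring
    · change p 1 = Real.sin 0 * p' 0 + Real.cos 0 * p' 1
      rw [e1, e0', e1']; ring
    · exact h2
  · obtain ⟨θ, hc, hs⟩ := exists_cos_sin (A := (p 0 * p' 0 + p 1 * p' 1) / r)
      (B := (p 1 * p' 0 - p 0 * p' 1) / r) (by
        rw [div_pow, div_pow, ← add_div, div_eq_one_iff_eq (pow_ne_zero 2 h0.ne'), hr]
        linear_combination (p' 0 ^ 2 + p' 1 ^ 2) * h)
    rw [div_eq_iff h0.ne', hr] at hc hs
    refine ⟨θ, ?_⟩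
    ext i
    fin_cases i
    · change p 0 = Real.cos θ * p' 0 - Real.sin θ * p' 1
      refine mul_right_cancel₀ h0.ne' ?_
      rw [hr]
      linear_combination p' 0 * hc - p' 1 * hs
    · change p 1 = Real.sin θ * p' 0 + Real.cos θ * p' 1
      refine mul_right_cancel₀ h0.ne' ?_
      rw [hr]
      linear_combination p' 0 * hs + p' 1 * hc
    · exact h2

theorem continuous_rotZ (v : E3) : Continuous fun θ => rotZ θ v := by
  refine (PiLp.continuous_toLp 2 _).comp (continuous_pi fun i => ?_)
  fin_cases i
  · change Continuous fun θ => Real.cos θ * v 0 - Real.sin θ * v 1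
    fun_prop
  · change Continuous fun θ => Real.sin θ * v 0 + Real.cos θ * v 1
    fun_prop
  · exact continuous_const

/-- A surface whose profile curve is rotated by an irrational part of a full turn in each period is
dense in the region between two cylinders. -/
theorem closure_surface_of_irrational {ω P δ x₁ x₂ : ℝ} {α : ℝ → E2}
    (h : ∀ s, α (s + P) = rot δ (α s)) (hδ : Irrational (δ / (2 * Real.pi)))
    (hI : range (sqDist α) = Icc x₁ x₂) :
    closure (surface ω α) = {p : E3 | x₁ ≤ p 0 ^ 2 + p 1 ^ 2 ∧ p 0 ^ 2 + p 1 ^ 2 ≤ x₂} := by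
  apply Subset.antisymm
  · have hcont : Continuous fun p : E3 => p 0 ^ 2 + p 1 ^ 2 := by fun_prop
    refine closure_minimal ?_ (isClosed_Icc.preimage hcont)
    rintro _ ⟨z, rfl⟩
    change helicoidal ω α z 0 ^ 2 + helicoidal ω α z 1 ^ 2 ∈ Icc x₁ x₂
    rw [helicoidal_sqDist, ← hI]
    exact mem_range_self _
  · intro p hp
    have hp' : p 0 ^ 2 + p 1 ^ 2 ∈ range (sqDist α) := hI ▸ hp
    obtain ⟨s, hs⟩ := hp'
    obtain ⟨θ, hθ⟩ := exists_rotZ (p := p) (p' := helicoidal ω α (s, p 2))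
      (by rw [helicoidal_sqDist, hs]) rfl
    -- The surface contains the rotations of its points by all multiples of `δ`, which are dense
    -- modulo `2π`.
    have hdense := dense_addSubgroupClosure_pair_iff.2 hδ
    rw [hθ]
    refine map_mem_closure (f := fun θ => rotZ θ (helicoidal ω α (s, p 2))) (continuous_rotZ _)
      (hdense θ) fun ψ hψ => ?_
    obtain ⟨m, n, rfl⟩ := AddSubgroup.mem_closure_pair.1 hψ
    change rotZ (m • δ + n • (2 * Real.pi)) _ ∈ _
    rw [rotZ_congr (ε := m * δ) n (by simp)]
    exact rotZ_mem_surface h m ⟨_, rfl⟩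

/-- A profile curve that is rotated by an irrational part of a full turn in each period of its
TreadmillSled has no periods. -/
theorem IsFundamentalPiece.eq_zero_of_periodic {a C ω s₀ P δ x : ℝ} {α : ℝ → E2}
    (hfp : IsFundamentalPiece a C ω α s₀ (s₀ + P)) (h : ∀ s, α (s + P) = rot δ (α s))
    (hper : Function.Periodic (treadmillSled α) P) (hδ : Irrational (δ / (2 * Real.pi)))
    (hx : α x ≠ 0) {σ : ℝ} (hσ : ∀ s, α (s + σ) = α s) : σ = 0 := by
  have hP : 0 < P := by linarith [hfp.lt]
  have hd : ∀ s, deriv α (s + σ) = deriv α s := fun s => by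
    have : (fun u => α (u + σ)) = α := funext hσ
    rw [← deriv_comp_add_const, this]
  have hTS : treadmillSled α (s₀ + σ) = treadmillSled α s₀ := by
    unfold treadmillSled
    rw [hσ, hd]
  -- a period of the curve is one of its TreadmillSled, which is injective over `[s₀, s₀ + P)`
  obtain ⟨n, hn⟩ : ∃ n : ℤ, σ = n * P := by
    have hm := toIcoMod_mem_Ico hP s₀ (s₀ + σ)
    have e : toIcoMod hP s₀ (s₀ + σ) = s₀ + σ - toIcoDiv hP s₀ (s₀ + σ) * P := by
      rw [toIcoMod, zsmul_eq_mul]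
    have := hfp.once hm ⟨le_rfl, hfp.lt⟩ (by rw [e, hper.sub_int_mul_eq, hTS])
    exact ⟨toIcoDiv hP s₀ (s₀ + σ), by linarith⟩
  have hr : α x = rot (n * δ) (α x) := by rw [← rot_int_mul h, ← hn, hσ]
  have h0 : α x 0 = Real.cos (n * δ) * α x 0 - Real.sin (n * δ) * α x 1 :=
    congrArg (fun v : E2 => v 0) hr
  have h1 : α x 1 = Real.sin (n * δ) * α x 0 + Real.cos (n * δ) * α x 1 :=
    congrArg (fun v : E2 => v 1) hr
  have hpos : 0 < α x 0 ^ 2 + α x 1 ^ 2 := by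
    rw [← norm_vec2_sq]
    exact pow_pos (norm_pos_iff.2 hx) 2
  have hc : Real.cos (n * δ) = 1 := by
    refine mul_right_cancel₀ hpos.ne' ?_
    linear_combination (-α x 0) * h0 - α x 1 * h1
  obtain ⟨j, hj⟩ := (Real.cos_eq_one_iff _).1 hc
  by_contra hne
  have hn0 : (n : ℝ) ≠ 0 := by
    rintro h
    rw [h, zero_mul] at hn
    exact hne hn
  refine hδ ⟨(j : ℚ) / n, ?_⟩
  push_cast
  rw [div_eq_div_iff hn0 Real.two_pi_pos.ne', hj]
  ring

/-! ### The critical radii -/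

/-- The critical radii are the roots of the cubic `a R³ - 2 R + 2`. -/
theorem h_eq_iff {a R : ℝ} (hR : R ≠ 0) : h R = a ↔ a * R ^ 3 - 2 * R + 2 = 0 := by
  unfold h
  rw [div_eq_iff (pow_ne_zero 3 hR)]
  constructor <;> intro e <;> linarith

theorem h_lt_h {R S : ℝ} (hR : 0 < R) (hRS : R < S) (hS : S ≤ 3 / 2) : h R < h S := by
  have hS0 : 0 < S := hR.trans hRS
  unfold h
  rw [div_lt_div_iff₀ (by positivity) (by positivity)]
  have h1 : 0 < R ^ 2 + R * S + S ^ 2 - R * S * (R + S) := by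
    nlinarith [mul_pos hR hS0, sq_pos_of_pos (sub_pos.2 hRS)]
  nlinarith [mul_pos (sub_pos.2 hRS) h1]

theorem h_lt_h' {R S : ℝ} (hR : 3 / 2 ≤ R) (hRS : R < S) : h S < h R := by
  have hR0 : 0 < R := by linarith
  have hS0 : 0 < S := hR0.trans hRS
  unfold h
  rw [div_lt_div_iff₀ (by positivity) (by positivity)]
  have h1 : R ^ 2 + R * S + S ^ 2 - R * S * (R + S) < 0 := by
    nlinarith [sq_pos_of_pos (sub_pos.2 hRS),
      mul_nonneg (sq_nonneg R) (show 0 ≤ S - 3 / 2 by linarith),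
      mul_nonneg (sq_nonneg S) (show 0 ≤ R - 3 / 2 by linarith)]
  nlinarith [mul_neg_of_pos_of_neg (sub_pos.2 hRS) h1]

theorem h_three_halves : h (3 / 2) = 8 / 27 := by unfold h; norm_num

theorem h_pos {R : ℝ} (hR : 1 < R) : 0 < h R := by
  unfold h
  have : 0 < R - 1 := by linarith
  positivity

theorem exists_cubic_root (a : ℝ) {u w : ℝ} (huw : u ≤ w)
    (hs : (a * u ^ 3 - 2 * u + 2 < 0 ∧ 0 < a * w ^ 3 - 2 * w + 2) ∨
      (0 < a * u ^ 3 - 2 * u + 2 ∧ a * w ^ 3 - 2 * w + 2 < 0)) :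
    ∃ R ∈ Ioo u w, a * R ^ 3 - 2 * R + 2 = 0 := by
  have hc : ContinuousOn (fun R : ℝ => a * R ^ 3 - 2 * R + 2) (Icc u w) := by fun_prop
  rcases hs with hs | hs
  · exact intermediate_value_Ioo huw hc hs
  · exact intermediate_value_Ioo' huw hc ⟨hs.2, hs.1⟩

theorem R₁_spec {a : ℝ} (ha : a ≠ 0) : R₁ a ≠ 0 ∧ R₁ a < 1 ∧ h (R₁ a) = a := by
  refine Classical.epsilon_spec (p := fun R => R ≠ 0 ∧ R < 1 ∧ h R = a) ?_
  rcases ha.lt_or_gt with h0 | h0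
  · obtain ⟨R, hR, e⟩ := exists_cubic_root a (u := 0) (w := 1) zero_le_one
      (Or.inr ⟨by norm_num, by linarith⟩)
    exact ⟨R, hR.1.ne', hR.2, (h_eq_iff hR.1.ne').2 e⟩
  · have hM : 0 < 1 + 4 / a := by positivity
    have e1 : a * (1 + 4 / a) = a + 4 := by field_simp
    obtain ⟨R, hR, e⟩ := exists_cubic_root a (u := -(1 + 4 / a)) (w := 0) (by linarith)
      (Or.inl ⟨by
        have : 1 ≤ 1 + 4 / a := by linarith [show 0 < 4 / a by positivity]
        have e2 : a * (-(1 + 4 / a)) ^ 3 = -((a + 4) * (1 + 4 / a) ^ 2) := by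
          linear_combination -(1 + 4 / a) ^ 2 * e1
        rw [e2]
        nlinarith [mul_pos h0 (sq_pos_of_pos hM)], by norm_num⟩)
    exact ⟨R, hR.2.ne, by linarith [hR.2], (h_eq_iff hR.2.ne).2 e⟩

theorem R₂_spec {a : ℝ} (h0 : 0 < a) (h1 : a < 8 / 27) :
    1 < R₂ a ∧ R₂ a < 3 / 2 ∧ h (R₂ a) = a := by
  refine Classical.epsilon_spec (p := fun R => 1 < R ∧ R < 3 / 2 ∧ h R = a) ?_
  obtain ⟨R, hR, e⟩ := exists_cubic_root a (u := 1) (w := 3 / 2) (by norm_num)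
    (Or.inr ⟨by linarith, by linarith⟩)
  exact ⟨R, hR.1, hR.2, (h_eq_iff (by linarith [hR.1])).2 e⟩

theorem R₃_spec {a : ℝ} (h0 : 0 < a) (h1 : a < 8 / 27) : 3 / 2 < R₃ a ∧ h (R₃ a) = a := by
  refine Classical.epsilon_spec (p := fun R => 3 / 2 < R ∧ h R = a) ?_
  have hM : 0 < 2 / a := by positivity
  have e1 : a * (2 / a) = 2 := by field_simp
  obtain ⟨R, hR, e⟩ := exists_cubic_root a (u := 3 / 2) (w := 3 / 2 + 2 / a) (by linarith)
    (Or.inl ⟨by linarith, by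
      have e2 : a * (3 / 2 + 2 / a) ^ 3 = (3 / 2 * a + 2) * (3 / 2 + 2 / a) ^ 2 := by
        linear_combination (3 / 2 + 2 / a) ^ 2 * e1
      rw [e2]
      nlinarith [mul_pos h0 (sq_pos_of_pos (show 0 < 3 / 2 + 2 / a by linarith))]⟩)
  exact ⟨R, hR.1, (h_eq_iff (by linarith [hR.1])).2 e⟩

theorem R₁_neg {a : ℝ} (ha : 0 < a) : R₁ a < 0 := by
  obtain ⟨h0, h1, h2⟩ := R₁_spec ha.ne'
  rw [h_eq_iff h0] at h2
  by_contra hcon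
  have : 0 < R₁ a := lt_of_le_of_ne (not_lt.1 hcon) (Ne.symm h0)
  nlinarith [mul_pos ha (pow_pos this 3)]

/-! ### The levels of the critical radii -/

/-- The value of `G` at the points of the `ξ₂`-axis: the level set `G = C` meets this axis in the
points `(0, -R)` with `levelG a R = C`. -/
def levelG (a R : ℝ) : ℝ := -2 * R + R ^ 2 - a * R ^ 4 / 4

theorem levelG_neg (a R : ℝ) : levelG a (-R) = levelG a R + 4 * R := by unfold levelG; ring

/-- The critical points of the level are the critical radii. -/
theorem hasDerivAt_levelG (a R : ℝ) :
    HasDerivAt (levelG a) (-(a * R ^ 3 - 2 * R + 2)) R := by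
  have h1 : HasDerivAt (fun R : ℝ => R) 1 R := hasDerivAt_id R
  have := ((h1.const_mul (-2)).add (h1.pow 2)).sub (((h1.pow 4).const_mul a).div_const 4)
  exact this.congr_deriv (by push_cast; ring)

theorem continuous_levelG (a : ℝ) : Continuous (levelG a) := by unfold levelG; fun_prop

/-- `q ≥ 0` at `R²` means that `C` lies between the values of the level at `R` and `-R`. -/
theorem q_eval_sq (a C R : ℝ) :
    (q a C).eval (R ^ 2) = 16 * (levelG a (-R) - C) * (C - levelG a R) := by
  rw [q_eval]; unfold levelP levelG; ring

/-- A root of `q` is multiple exactly if it is the square of a critical radius. -/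
theorem q_derivative_eval_sq {a C R : ℝ} (hR : levelG a R = C) :
    (q a C).derivative.eval (R ^ 2) = 32 * (a * R ^ 3 - 2 * R + 2) := by
  rw [q_derivative_eval, ← hR]; unfold levelP levelG; ring

/-- The roots of `q` are the squares of the real solutions of `levelG a R = C`. -/
theorem q_root_iff {a C r : ℝ} : (q a C).eval r = 0 ↔ ∃ R, R ^ 2 = r ∧ levelG a R = C := by
  constructor
  · intro e
    have hs := Real.sq_sqrt (nonneg_of_q_nonneg e.ge)
    have e' := e
    rw [← hs, q_eval_sq] at e'
    rcases mul_eq_zero.1 e' with h1 | h1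
    · exact ⟨-Real.sqrt r, by rw [neg_sq, hs], by linarith⟩
    · exact ⟨Real.sqrt r, hs, by linarith⟩
  · rintro ⟨R, rfl, e⟩
    rw [q_eval_sq, e, sub_self, mul_zero]

/-- Different solutions of `levelG a R = C` have different squares. -/
theorem sq_ne_sq_of_levelG {a C u w : ℝ} (hu : levelG a u = C) (hw : levelG a w = C)
    (huw : u ≠ w) : u ^ 2 ≠ w ^ 2 := by
  intro e
  rcases sq_eq_sq_iff_eq_or_eq_neg.1 e with h1 | h1
  · exact huw h1
  · rw [h1, levelG_neg, hw] at hu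
    have : w = 0 := by linarith
    exact huw (by rw [h1, this, neg_zero])

/-- The level of a critical radius, as a function of the radius. -/
theorem levelG_h {R : ℝ} (hR : R ≠ 0) : levelG (h R) R = R * (R - 3) / 2 := by
  unfold levelG h
  field_simp
  ring

/-- The function `Cfun` is the level of the critical radius. -/
theorem Cfun_h {R : ℝ} (hR : R ≠ 0) : Cfun (h R) (R ^ 2) = R * (R - 3) / 2 := by
  have e : -2 + h R * R ^ 2 = -2 / R := by
    unfold h; field_simp; ring
  unfold Cfun
  rw [e]
  unfold h
  field_simp
  ring

theorem C₁_eq {a : ℝ} (ha : a ≠ 0) : C₁ a = R₁ a * (R₁ a - 3) / 2 ∧ levelG a (R₁ a) = C₁ a := by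
  obtain ⟨h0, -, h2⟩ := R₁_spec ha
  have e := Cfun_h h0
  have e' := levelG_h h0
  rw [h2] at e e'
  exact ⟨e, e'.trans e.symm⟩

theorem C₂_eq {a : ℝ} (h0 : 0 < a) (h1 : a < 8 / 27) :
    C₂ a = R₂ a * (R₂ a - 3) / 2 ∧ levelG a (R₂ a) = C₂ a := by
  obtain ⟨h2, -, h3⟩ := R₂_spec h0 h1
  have hne : R₂ a ≠ 0 := by linarith
  have e := Cfun_h hne
  have e' := levelG_h hne
  rw [h3] at e e'
  exact ⟨e, e'.trans e.symm⟩

theorem C₃_eq {a : ℝ} (h0 : 0 < a) (h1 : a < 8 / 27) :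
    C₃ a = R₃ a * (R₃ a - 3) / 2 ∧ levelG a (R₃ a) = C₃ a := by
  obtain ⟨h2, h3⟩ := R₃_spec h0 h1
  have hne : R₃ a ≠ 0 := by linarith
  have e := Cfun_h hne
  have e' := levelG_h hne
  rw [h3] at e e'
  exact ⟨e, e'.trans e.symm⟩

theorem cubic_R₁ {a : ℝ} (ha : a ≠ 0) : a * R₁ a ^ 3 - 2 * R₁ a + 2 = 0 :=
  (h_eq_iff (R₁_spec ha).1).1 (R₁_spec ha).2.2

theorem cubic_R₂ {a : ℝ} (h0 : 0 < a) (h1 : a < 8 / 27) : a * R₂ a ^ 3 - 2 * R₂ a + 2 = 0 :=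
  (h_eq_iff (by linarith [(R₂_spec h0 h1).1])).1 (R₂_spec h0 h1).2.2

theorem cubic_R₃ {a : ℝ} (h0 : 0 < a) (h1 : a < 8 / 27) : a * R₃ a ^ 3 - 2 * R₃ a + 2 = 0 :=
  (h_eq_iff (by linarith [(R₃_spec h0 h1).1])).1 (R₃_spec h0 h1).2

/-! ### Monotonicity of the level -/

theorem strictMonoOn_levelG {a : ℝ} {S : Set ℝ} (hS : Convex ℝ S)
    (h0 : ∀ R ∈ interior S, a * R ^ 3 - 2 * R + 2 < 0) : StrictMonoOn (levelG a) S :=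
  strictMonoOn_of_deriv_pos hS (continuous_levelG a).continuousOn fun R hR => by
    rw [(hasDerivAt_levelG a R).deriv]
    linarith [h0 R hR]

theorem strictAntiOn_levelG {a : ℝ} {S : Set ℝ} (hS : Convex ℝ S)
    (h0 : ∀ R ∈ interior S, 0 < a * R ^ 3 - 2 * R + 2) : StrictAntiOn (levelG a) S :=
  strictAntiOn_of_deriv_neg hS (continuous_levelG a).continuousOn fun R hR => by
    rw [(hasDerivAt_levelG a R).deriv]
    linarith [h0 R hR]

section Negative

variable {a : ℝ}

theorem strictAntiOn_levelG_Iic (ha : a < 0) : StrictAntiOn (levelG a) (Iic (R₁ a)) := by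
  refine strictAntiOn_levelG (convex_Iic _) fun R hR => ?_
  rw [interior_Iic] at hR
  have h1 := cubic_R₁ ha.ne
  have h2 : R ^ 3 < R₁ a ^ 3 := (Odd.strictMono_pow (by decide : Odd 3)) hR
  have h3 : R < R₁ a := hR
  nlinarith [mul_pos_of_neg_of_neg ha (sub_neg.2 h2)]

theorem strictMonoOn_levelG_Ici (ha : a < 0) : StrictMonoOn (levelG a) (Ici (R₁ a)) := by
  refine strictMonoOn_levelG (convex_Ici _) fun R hR => ?_
  rw [interior_Ici] at hR
  have h1 := cubic_R₁ ha.ne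
  have h2 : R₁ a ^ 3 < R ^ 3 := (Odd.strictMono_pow (by decide : Odd 3)) hR
  have h3 : R₁ a < R := hR
  nlinarith [mul_neg_of_neg_of_pos ha (sub_pos.2 h2)]

theorem C₁_le_levelG (ha : a < 0) (R : ℝ) : C₁ a ≤ levelG a R := by
  rw [← (C₁_eq ha.ne).2]
  rcases le_total R (R₁ a) with h1 | h1
  · exact (strictAntiOn_levelG_Iic ha).antitoneOn h1 self_mem_Iic h1
  · exact (strictMonoOn_levelG_Ici ha).monotoneOn self_mem_Ici h1 h1

end Negative

section Positive

variable {a : ℝ}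

/-- For `a > 0` the critical radius `R₁ < 0` is the only one on the negative half line. -/
theorem cubic_factor_pos (ha : 0 < a) {R : ℝ} (hR : R ≤ 0) :
    ∃ k > 0, a * R ^ 3 - 2 * R + 2 = (R - R₁ a) * k := by
  have h1 := cubic_R₁ ha.ne'
  have h2 := R₁_neg ha
  refine ⟨a * (R ^ 2 + R * R₁ a + R₁ a ^ 2) - 2, ?_, by linear_combination h1⟩
  have h3 : 2 < a * R₁ a ^ 2 := by
    by_contra hcon
    nlinarith [mul_nonneg_of_nonpos_of_nonpos h2.le (sub_nonpos.2 (not_lt.1 hcon))]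
  nlinarith [mul_nonneg ha.le (sq_nonneg R),
    mul_nonneg ha.le (mul_nonneg_of_nonpos_of_nonpos hR h2.le)]

theorem strictMonoOn_levelG_Iic (ha : 0 < a) : StrictMonoOn (levelG a) (Iic (R₁ a)) := by
  refine strictMonoOn_levelG (convex_Iic _) fun R hR => ?_
  rw [interior_Iic] at hR
  have h3 : R < R₁ a := hR
  obtain ⟨k, hk, e⟩ := cubic_factor_pos ha (h3.trans (R₁_neg ha)).le
  rw [e]
  exact mul_neg_of_neg_of_pos (sub_neg.2 h3) hk

theorem cubic_pos_of_nonpos (ha : 0 < a) {R : ℝ} (h1 : R₁ a < R) (h2 : R ≤ 0) :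
    0 < a * R ^ 3 - 2 * R + 2 := by
  obtain ⟨k, hk, e⟩ := cubic_factor_pos ha h2
  rw [e]
  exact mul_pos (sub_pos.2 h1) hk

theorem levelG_le_C₁ (ha : 0 < a) {R : ℝ} (hR : R ≤ 0) : levelG a R ≤ C₁ a := by
  rw [← (C₁_eq ha.ne').2]
  rcases le_total R (R₁ a) with h1 | h1
  · exact (strictMonoOn_levelG_Iic ha).monotoneOn h1 self_mem_Iic h1
  · have : StrictAntiOn (levelG a) (Icc (R₁ a) 0) :=
      strictAntiOn_levelG (convex_Icc _ _) fun R hR => by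
        rw [interior_Icc] at hR
        exact cubic_pos_of_nonpos ha hR.1 hR.2.le
    exact this.antitoneOn ⟨le_rfl, (R₁_neg ha).le⟩ ⟨h1, hR⟩ h1

/-- For `a ≥ 8/27` the level decreases beyond `R₁`. -/
theorem strictAntiOn_levelG_Ici (ha : 8 / 27 ≤ a) : StrictAntiOn (levelG a) (Ici (R₁ a)) := by
  have ha0 : 0 < a := by linarith
  have key : ∀ R, R₁ a < R → R ≠ 3 / 2 → 0 < a * R ^ 3 - 2 * R + 2 := fun R h1 h2 => by
    rcases le_or_gt R 0 with h3 | h3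
    · exact cubic_pos_of_nonpos ha0 h1 h3
    · have h4 : 0 < (2 * R - 3) ^ 2 := by
        have : 2 * R - 3 ≠ 0 := fun h => h2 (by linarith)
        positivity
      nlinarith [mul_nonneg (sub_nonneg.2 ha) (pow_pos h3 3).le,
        mul_pos (show 0 < R + 3 by linarith) h4]
  have hlt : R₁ a ≤ 3 / 2 := by linarith [R₁_neg ha0]
  have A : StrictAntiOn (levelG a) (Icc (R₁ a) (3 / 2)) :=
    strictAntiOn_levelG (convex_Icc _ _) fun R hR => by
      rw [interior_Icc] at hR
      exact key R hR.1 hR.2.ne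
  have B : StrictAntiOn (levelG a) (Ici (3 / 2)) :=
    strictAntiOn_levelG (convex_Ici _) fun R hR => by
      rw [interior_Ici] at hR
      exact key R (lt_of_le_of_lt hlt hR) (ne_of_gt hR)
  have := A.union B (isGreatest_Icc hlt) isLeast_Ici
  rwa [Icc_union_Ici_eq_Ici hlt] at this

/-- For `0 < a < 8/27` there are three critical radii. -/
theorem cubic_factor (h0 : 0 < a) (h1 : a < 8 / 27) (R : ℝ) :
    a * R ^ 3 - 2 * R + 2 = a * (R - R₁ a) * (R - R₂ a) * (R - R₃ a) := by
  have e1 := cubic_R₁ h0.ne'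
  have e2 := cubic_R₂ h0 h1
  have e3 := cubic_R₃ h0 h1
  have n1 := R₁_neg h0
  obtain ⟨b1, b2, -⟩ := R₂_spec h0 h1
  obtain ⟨b3, -⟩ := R₃_spec h0 h1
  set u := R₁ a
  set w := R₂ a
  set z := R₃ a
  have s12 : a * (u ^ 2 + u * w + w ^ 2) = 2 := by
    have : u - w ≠ 0 := by linarith
    refine mul_right_cancel₀ this ?_
    linear_combination e1 - e2
  have s23 : a * (w ^ 2 + w * z + z ^ 2) = 2 := by
    have : w - z ≠ 0 := by linarith
    refine mul_right_cancel₀ this ?_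
    linear_combination e2 - e3
  have s : u + w + z = 0 := by
    have : a * (u - z) ≠ 0 := mul_ne_zero h0.ne' (by linarith)
    refine mul_left_cancel₀ this ?_
    linear_combination s12 - s23
  have hz : z = -u - w := by linarith
  rw [hz]
  linear_combination (R - u) * s12 + e1

theorem levelG_antitone₁₂ (h0 : 0 < a) (h1 : a < 8 / 27) :
    StrictAntiOn (levelG a) (Icc (R₁ a) (R₂ a)) :=
  strictAntiOn_levelG (convex_Icc _ _) fun R hR => by
    rw [interior_Icc] at hR
    rw [cubic_factor h0 h1]
    have := (R₂_spec h0 h1).2.1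
    have := (R₃_spec h0 h1).1
    refine mul_pos_of_neg_of_neg (mul_neg_of_pos_of_neg (mul_pos h0 ?_) ?_) ?_ <;>
      linarith [hR.1, hR.2]

theorem levelG_monotone₂₃ (h0 : 0 < a) (h1 : a < 8 / 27) :
    StrictMonoOn (levelG a) (Icc (R₂ a) (R₃ a)) :=
  strictMonoOn_levelG (convex_Icc _ _) fun R hR => by
    rw [interior_Icc] at hR
    rw [cubic_factor h0 h1]
    have := (R₂_spec h0 h1).1
    have := R₁_neg h0
    refine mul_neg_of_pos_of_neg (mul_pos (mul_pos h0 ?_) ?_) ?_ <;>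
      linarith [hR.1, hR.2]

theorem levelG_antitone₃ (h0 : 0 < a) (h1 : a < 8 / 27) :
    StrictAntiOn (levelG a) (Ici (R₃ a)) :=
  strictAntiOn_levelG (convex_Ici _) fun R hR => by
    rw [interior_Ici, mem_Ioi] at hR
    rw [cubic_factor h0 h1]
    have := (R₂_spec h0 h1).2.1
    have := (R₃_spec h0 h1).1
    have := R₁_neg h0
    refine mul_pos (mul_pos (mul_pos h0 ?_) ?_) ?_ <;> linarith

theorem C₂_lt_C₃ (h0 : 0 < a) (h1 : a < 8 / 27) : C₂ a < C₃ a := by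
  have b1 := (R₂_spec h0 h1).2.1
  have b2 := (R₃_spec h0 h1).1
  rw [← (C₂_eq h0 h1).2, ← (C₃_eq h0 h1).2]
  exact levelG_monotone₂₃ h0 h1 ⟨le_rfl, by linarith⟩ ⟨by linarith, le_rfl⟩ (by linarith)

/-- The value at `-R₃ < 0` exceeds that at `R₃`, and is at most the maximum `C₁` on the negative
half line. -/
theorem C₃_lt_C₁ (h0 : 0 < a) (h1 : a < 8 / 27) : C₃ a < C₁ a := by
  have b2 := (R₃_spec h0 h1).1
  have := levelG_le_C₁ h0 (R := -R₃ a) (by linarith)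
  rw [levelG_neg, (C₃_eq h0 h1).2] at this
  linarith

end Positive

/-! ### Solutions of the level equation -/

/-- A function that is injective on `S` takes each value between those at the ends of an interval in
`S` exactly once on `S`. -/
theorem exists_unique_level {f : ℝ → ℝ} (hf : Continuous f) {S : Set ℝ} (hS : InjOn f S) {u w C : ℝ}
    (huw : u ≤ w) (hsub : Icc u w ⊆ S) (hC : f u < C ∧ C < f w ∨ C < f u ∧ f w < C) :
    ∃ R ∈ Ioo u w, f R = C ∧ ∀ R' ∈ S, f R' = C → R' = R := by
  have : ∃ R ∈ Ioo u w, f R = C := by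
    rcases hC with hC | hC
    · exact intermediate_value_Ioo huw hf.continuousOn hC
    · exact intermediate_value_Ioo' huw hf.continuousOn ⟨hC.2, hC.1⟩
  obtain ⟨R, hR, e⟩ := this
  exact ⟨R, hR, e, fun R' h' e' => hS h' (hsub (Ioo_subset_Icc_self hR)) (e'.trans e.symm)⟩

theorem levelG_lt_of_abs_ge {a : ℝ} (ha : 0 < a) (C : ℝ) :
    ∃ M, ∀ R, M ≤ |R| → levelG a R < C := by
  -- For `|R| ≥ 1` the first two terms are at most `3 R²`, and `K` is chosen such that the quartic
  -- term exceeds `(4 + |C|) R²`.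
  set K := 4 * (4 + |C|) / a with hK
  have hK0 : 0 < K := by positivity
  refine ⟨1 + K, fun R hR => ?_⟩
  have h1 : 1 ≤ |R| := by linarith
  have h2 : |R| ^ 2 = R ^ 2 := sq_abs R
  have h3 : K ≤ R ^ 2 := by rw [← h2]; nlinarith
  have h4 : (4 + |C|) ≤ a * R ^ 2 / 4 := by
    rw [hK, div_le_iff₀ ha] at h3
    linarith
  have h5 : 1 ≤ R ^ 2 := by rw [← h2]; nlinarith
  have h6 : -R ≤ R ^ 2 := by rw [← h2]; nlinarith [neg_abs_le R]
  unfold levelG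
  nlinarith [mul_le_mul_of_nonneg_right h4 (sq_nonneg R), neg_abs_le C, abs_nonneg C]

theorem lt_levelG_of_abs_ge {a : ℝ} (ha : a < 0) (C : ℝ) :
    ∃ M, ∀ R, M ≤ |R| → C < levelG a R := by
  refine ⟨3 + |C|, fun R hR => ?_⟩
  have h2 : |R| ^ 2 = R ^ 2 := sq_abs R
  unfold levelG
  nlinarith [abs_nonneg C, le_abs_self C, le_abs_self R, mul_nonneg_of_nonpos_of_nonpos
    (show -R ^ 4 ≤ 0 by nlinarith [sq_nonneg (R ^ 2)]) ha.le]

/-- The level `C` is attained at exactly two simple points. -/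
def TwoSimple (a C : ℝ) : Prop :=
  ∃ u w, u ≠ w ∧ (∀ R, levelG a R = C ↔ R = u ∨ R = w) ∧
    a * u ^ 3 - 2 * u + 2 ≠ 0 ∧ a * w ^ 3 - 2 * w + 2 ≠ 0

/-- For `a` outside `[0, 8/27]`, `R₁` is the only critical radius. -/
theorem cubic_ne_zero {a R : ℝ} (ha : a ≠ 0) (h1 : a < 0 ∨ 8 / 27 < a) (hR : R ≠ R₁ a) :
    a * R ^ 3 - 2 * R + 2 ≠ 0 := by
  intro e
  have e1 := cubic_R₁ ha
  rcases h1 with h1 | h1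
  · rcases hR.lt_or_gt with h2 | h2
    · have h3 := (Odd.strictMono_pow (by decide : Odd 3)) h2
      simp only at h3
      nlinarith [mul_pos_of_neg_of_neg h1 (sub_neg.2 h3)]
    · have h3 := (Odd.strictMono_pow (by decide : Odd 3)) h2
      simp only at h3
      nlinarith [mul_neg_of_neg_of_pos h1 (sub_pos.2 h3)]
  · have h0 : 0 < a := by linarith
    rcases le_or_gt R 0 with h3 | h3
    · obtain ⟨k, hk, e'⟩ := cubic_factor_pos h0 h3
      rw [e'] at e
      rcases mul_eq_zero.1 e with h4 | h4
      · exact hR (by linarith)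
      · exact hk.ne' h4
    · nlinarith [mul_pos (sub_pos.2 h1) (pow_pos h3 3),
        mul_nonneg (show 0 ≤ R + 3 by linarith) (sq_nonneg (2 * R - 3))]

/-- For `a < 0` the level has a single minimum, at `R₁`. -/
theorem twoSimple_of_neg {a C : ℝ} (ha : a < 0) (hC : C₁ a < C) : TwoSimple a C := by
  obtain ⟨M, hM⟩ := lt_levelG_of_abs_ge ha C
  have e1 := (C₁_eq ha.ne).2
  have hM1 : C < levelG a (-(|M| + |R₁ a|)) := hM _ (by
    rw [abs_neg, abs_of_nonneg (by positivity)]; linarith [le_abs_self M, abs_nonneg (R₁ a)])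
  have hM2 : C < levelG a (|M| + |R₁ a|) := hM _ (by
    rw [abs_of_nonneg (by positivity)]; linarith [le_abs_self M, abs_nonneg (R₁ a)])
  obtain ⟨u, hu, eu, uu⟩ := exists_unique_level (continuous_levelG a)
    (strictAntiOn_levelG_Iic ha).injOn (u := -(|M| + |R₁ a|)) (w := R₁ a) (C := C)
    (by linarith [neg_abs_le (R₁ a), abs_nonneg M]) (fun x hx => hx.2) (Or.inr ⟨hM1, by rwa [e1]⟩)
  obtain ⟨w, hw, ew, uw⟩ := exists_unique_level (continuous_levelG a)
    (strictMonoOn_levelG_Ici ha).injOn (u := R₁ a) (w := |M| + |R₁ a|) (C := C)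
    (by linarith [le_abs_self (R₁ a), abs_nonneg M]) (fun x hx => hx.1) (Or.inl ⟨by rwa [e1], hM2⟩)
  refine ⟨u, w, (hu.2.trans hw.1).ne, fun R => ⟨fun e => ?_, ?_⟩,
    cubic_ne_zero ha.ne (Or.inl ha) hu.2.ne, cubic_ne_zero ha.ne (Or.inl ha) hw.1.ne'⟩
  · rcases le_total R (R₁ a) with h1 | h1
    · exact Or.inl (uu R h1 e)
    · exact Or.inr (uw R h1 e)
  · rintro (rfl | rfl) <;> assumption

/-- Below the level of `R₁`, there is exactly one solution to the left of `R₁`. -/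
theorem exists_level_left {a C : ℝ} (ha : 0 < a) (hC : C < C₁ a) :
    ∃ u < R₁ a, levelG a u = C ∧ a * u ^ 3 - 2 * u + 2 ≠ 0 ∧
      ∀ R ≤ R₁ a, levelG a R = C → R = u := by
  obtain ⟨M, hM⟩ := levelG_lt_of_abs_ge ha C
  have hM1 : levelG a (-(|M| + |R₁ a|)) < C := hM _ (by
    rw [abs_neg, abs_of_nonneg (by positivity)]; linarith [le_abs_self M, abs_nonneg (R₁ a)])
  obtain ⟨u, hu, eu, uu⟩ := exists_unique_level (continuous_levelG a)
    (strictMonoOn_levelG_Iic ha).injOn (u := -(|M| + |R₁ a|)) (w := R₁ a) (C := C)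
    (by linarith [neg_abs_le (R₁ a), abs_nonneg M]) (fun x hx => hx.2)
    (Or.inl ⟨hM1, by rwa [(C₁_eq ha.ne').2]⟩)
  obtain ⟨k, hk, e⟩ := cubic_factor_pos ha (hu.2.trans (R₁_neg ha)).le
  exact ⟨u, hu.2, eu, by rw [e]; exact mul_ne_zero (sub_ne_zero.2 hu.2.ne) hk.ne', uu⟩

/-- Solutions on a half line on which the level decreases. -/
theorem exists_level_right {a C m : ℝ} (ha : 0 < a) (hm : StrictAntiOn (levelG a) (Ici m))
    (hC : C < levelG a m) :
    ∃ w > m, levelG a w = C ∧ ∀ R ≥ m, levelG a R = C → R = w := by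
  obtain ⟨M, hM⟩ := levelG_lt_of_abs_ge ha C
  have hM1 : levelG a (|M| + |m|) < C := hM _ (by
    rw [abs_of_nonneg (by positivity)]; linarith [le_abs_self M, abs_nonneg m])
  obtain ⟨w, hw, ew, uw⟩ := exists_unique_level (continuous_levelG a)
    hm.injOn (u := m) (w := |M| + |m|) (C := C)
    (by linarith [le_abs_self m, abs_nonneg M]) (fun x hx => hx.1) (Or.inr ⟨hC, hM1⟩)
  exact ⟨w, hw.1, ew, uw⟩

/-- For `a ≥ 8/27` the level has a single maximum, at `R₁`; the only further critical point is the
cusp `a = 8/27`, `R = 3/2`, with `C = -9/8`. -/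
theorem twoSimple_of_large {a C : ℝ} (ha : 8 / 27 ≤ a) (hC : C < C₁ a)
    (hcusp : ¬ (a = 8 / 27 ∧ C = -(9 / 8))) : TwoSimple a C := by
  have ha0 : 0 < a := by linarith
  obtain ⟨u, hu, eu, du, uu⟩ := exists_level_left ha0 hC
  obtain ⟨w, hw, ew, uw⟩ := exists_level_right ha0 (strictAntiOn_levelG_Ici ha)
    (by rwa [(C₁_eq ha0.ne').2])
  refine ⟨u, w, (hu.trans hw).ne, fun R => ⟨fun e => ?_, ?_⟩, du, ?_⟩
  · rcases le_total R (R₁ a) with h1 | h1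
    · exact Or.inl (uu R h1 e)
    · exact Or.inr (uw R h1 e)
  · rintro (rfl | rfl) <;> assumption
  · rcases ha.eq_or_lt with h1 | h1
    · subst h1
      intro e
      rcases le_or_gt w 0 with h2 | h2
      · exact (cubic_pos_of_nonpos ha0 hw h2).ne' e
      · have h3 : (w + 3) * (2 * w - 3) ^ 2 = 0 := by linear_combination 27 / 2 * e
        rcases mul_eq_zero.1 h3 with h4 | h4
        · linarith
        · have h5 : w = 3 / 2 := by linarith [pow_eq_zero_iff two_ne_zero |>.1 h4]
          refine hcusp ⟨rfl, ?_⟩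
          rw [← ew, h5]
          unfold levelG
          norm_num
    · exact cubic_ne_zero ha0.ne' (Or.inr h1) hw.ne'

/-- For `0 < a < 8/27` the level rises to the maximum at `R₁`, falls to `R₂`, rises to `R₃` and
falls again. A value that is below `C₁` and not between those at `R₂` and `R₃` is attained exactly
once on either side of `R₁`. -/
theorem twoSimple_of_small {a C : ℝ} (h0 : 0 < a) (h1 : a < 8 / 27) (hC : C < C₁ a)
    (hC' : C < C₂ a ∨ C₃ a < C) : TwoSimple a C := by
  obtain ⟨u, hu, eu, du, uu⟩ := exists_level_left h0 hC
  have n1 := R₁_neg h0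
  obtain ⟨b1, b2, -⟩ := R₂_spec h0 h1
  obtain ⟨b3, -⟩ := R₃_spec h0 h1
  have c1 := (C₁_eq h0.ne').2
  have c2 := (C₂_eq h0 h1).2
  have c3 := (C₃_eq h0 h1).2
  rcases hC' with hC' | hC'
  · obtain ⟨w, hw, ew, uw⟩ := exists_level_right h0 (levelG_antitone₃ h0 h1)
      (by rw [c3]; exact hC'.trans (C₂_lt_C₃ h0 h1))
    refine ⟨u, w, by linarith, fun R => ⟨fun e => ?_, ?_⟩, du, ?_⟩
    · rcases le_total R (R₁ a) with h3 | h3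
      · exact Or.inl (uu R h3 e)
      rcases le_total R (R₂ a) with h4 | h4
      · have := (levelG_antitone₁₂ h0 h1).antitoneOn ⟨h3, h4⟩ ⟨by linarith, le_rfl⟩ h4
        linarith
      rcases le_total R (R₃ a) with h5 | h5
      · have := (levelG_monotone₂₃ h0 h1).monotoneOn ⟨le_rfl, by linarith⟩ ⟨h4, h5⟩ h4
        linarith
      · exact Or.inr (uw R h5 e)
    · rintro (rfl | rfl) <;> assumption
    · rw [cubic_factor h0 h1]
      have : 0 < a * (w - R₁ a) * (w - R₂ a) * (w - R₃ a) :=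
        mul_pos (mul_pos (mul_pos h0 (by linarith)) (by linarith)) (by linarith)
      exact this.ne'
  · obtain ⟨w, hw, ew, uw⟩ := exists_unique_level (continuous_levelG a)
      (levelG_antitone₁₂ h0 h1).injOn (u := R₁ a) (w := R₂ a) (C := C) (by linarith) Subset.rfl
      (Or.inr ⟨by rwa [c1], by rw [c2]; exact (C₂_lt_C₃ h0 h1).trans hC'⟩)
    refine ⟨u, w, (hu.trans hw.1).ne, fun R => ⟨fun e => ?_, ?_⟩, du, ?_⟩
    · rcases le_total R (R₁ a) with h3 | h3
      · exact Or.inl (uu R h3 e)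
      rcases le_total R (R₂ a) with h4 | h4
      · exact Or.inr (uw R ⟨h3, h4⟩ e)
      rcases le_total R (R₃ a) with h5 | h5
      · have := (levelG_monotone₂₃ h0 h1).monotoneOn ⟨h4, h5⟩ ⟨by linarith, le_rfl⟩ h5
        linarith
      · have := (levelG_antitone₃ h0 h1).antitoneOn self_mem_Ici h5 h5
        linarith
    · rintro (rfl | rfl) <;> assumption
    · rw [cubic_factor h0 h1]
      have : 0 < a * (w - R₁ a) * (w - R₂ a) * (w - R₃ a) :=
        mul_pos_of_neg_of_neg (mul_neg_of_pos_of_neg (mul_pos h0 (by linarith [hw.1]))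
          (by linarith [hw.2])) (by linarith [hw.2])
      exact this.ne'

/-- Between the levels of `R₂` and `R₃` there are four solutions, all simple. -/
theorem exists_four_levels {a C : ℝ} (h0 : 0 < a) (h1 : a < 8 / 27) (hC2 : C₂ a < C)
    (hC3 : C < C₃ a) :
    ∃ u w z t, u < w ∧ w < z ∧ z < t ∧
      (∀ R, levelG a R = C ↔ R = u ∨ R = w ∨ R = z ∨ R = t) ∧
      ∀ R, levelG a R = C → a * R ^ 3 - 2 * R + 2 ≠ 0 := by
  have hC : C < C₁ a := hC3.trans (C₃_lt_C₁ h0 h1)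
  obtain ⟨u, hu, eu, du, uu⟩ := exists_level_left h0 hC
  have n1 := R₁_neg h0
  obtain ⟨b1, b2, -⟩ := R₂_spec h0 h1
  obtain ⟨b3, -⟩ := R₃_spec h0 h1
  have c1 := (C₁_eq h0.ne').2
  have c2 := (C₂_eq h0 h1).2
  have c3 := (C₃_eq h0 h1).2
  obtain ⟨w, hw, ew, uw⟩ := exists_unique_level (continuous_levelG a)
    (levelG_antitone₁₂ h0 h1).injOn (u := R₁ a) (w := R₂ a) (C := C) (by linarith) Subset.rfl
    (Or.inr ⟨by rwa [c1], by rwa [c2]⟩)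
  obtain ⟨z, hz, ez, uz⟩ := exists_unique_level (continuous_levelG a)
    (levelG_monotone₂₃ h0 h1).injOn (u := R₂ a) (w := R₃ a) (C := C) (by linarith) Subset.rfl
    (Or.inl ⟨by rwa [c2], by rwa [c3]⟩)
  obtain ⟨t, ht, et, ut⟩ := exists_level_right h0 (levelG_antitone₃ h0 h1) (by rwa [c3])
  refine ⟨u, w, z, t, hu.trans hw.1, hw.2.trans hz.1, hz.2.trans ht, fun R => ⟨fun e => ?_, ?_⟩,
    fun R e => ?_⟩
  · rcases le_total R (R₁ a) with h3 | h3
    · exact Or.inl (uu R h3 e)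
    rcases le_total R (R₂ a) with h4 | h4
    · exact Or.inr (Or.inl (uw R ⟨h3, h4⟩ e))
    rcases le_total R (R₃ a) with h5 | h5
    · exact Or.inr (Or.inr (Or.inl (uz R ⟨h4, h5⟩ e)))
    · exact Or.inr (Or.inr (Or.inr (ut R h5 e)))
  · rintro (rfl | rfl | rfl | rfl) <;> assumption
  · rw [cubic_factor h0 h1]
    refine mul_ne_zero (mul_ne_zero (mul_ne_zero h0.ne' ?_) ?_) ?_ <;> rw [sub_ne_zero] <;>
      rintro rfl <;> linarith

/-! ### Signs between roots -/

section Signs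

open Polynomial

/-- To the right of a root at which it increases, a polynomial is positive up to its next root. -/
theorem pos_of_derivative_pos {p : ℝ[X]} {x y : ℝ} (hx : p.eval x = 0)
    (hd : 0 < p.derivative.eval x) (hno : ∀ r ∈ Ioo x y, p.eval r ≠ 0) :
    ∀ r ∈ Ioo x y, 0 < p.eval r := by
  intro r hr
  by_contra hcon
  have e := eventually_gt_of_deriv_pos (p.hasDerivAt x) hd
  obtain ⟨z, hz, hz'⟩ := (e.and (Ioo_mem_nhdsGT hr.1)).exists
  rw [hx] at hz
  obtain ⟨w, hw, hw0⟩ := intermediate_value_Icc' hz'.2.le p.continuous.continuousOn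
    ⟨not_lt.1 hcon, hz.le⟩
  exact hno w ⟨hz'.1.trans_le hw.1, hw.2.trans_lt hr.2⟩ hw0

/-- To the left of a root at which it decreases, a polynomial is positive down to its previous root.
-/
theorem pos_of_derivative_neg {p : ℝ[X]} {x y : ℝ} (hy : p.eval y = 0)
    (hd : p.derivative.eval y < 0) (hno : ∀ r ∈ Ioo x y, p.eval r ≠ 0) :
    ∀ r ∈ Ioo x y, 0 < p.eval r := by
  intro r hr
  by_contra hcon
  have e := eventually_lt_of_deriv_pos (p.hasDerivAt y).neg (neg_pos.2 hd)
  obtain ⟨z, hz, hz'⟩ := (e.and (Ioo_mem_nhdsLT hr.2)).exists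
  simp only [Pi.neg_apply, hy, neg_zero, neg_lt_zero] at hz
  obtain ⟨w, hw, hw0⟩ := intermediate_value_Icc hz'.1.le p.continuous.continuousOn
    ⟨not_lt.1 hcon, hz.le⟩
  exact hno w ⟨hr.1.trans_le hw.1, hw.2.trans_lt hz'.2⟩ hw0

theorem derivative_nonneg_of_pos {p : ℝ[X]} {x y : ℝ} (hxy : x < y) (hx : p.eval x = 0)
    (hpos : ∀ r ∈ Ioo x y, 0 < p.eval r) : 0 ≤ p.derivative.eval x := by
  by_contra hcon
  have e := eventually_gt_of_deriv_pos (p.hasDerivAt x).neg (neg_pos.2 (not_le.1 hcon))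
  obtain ⟨z, hz, hz'⟩ := (e.and (Ioo_mem_nhdsGT hxy)).exists
  simp only [Pi.neg_apply, hx, neg_zero] at hz
  linarith [hpos z hz']

theorem derivative_nonpos_of_pos {p : ℝ[X]} {x y : ℝ} (hxy : x < y) (hy : p.eval y = 0)
    (hpos : ∀ r ∈ Ioo x y, 0 < p.eval r) : p.derivative.eval y ≤ 0 := by
  by_contra hcon
  have e := eventually_lt_of_deriv_pos (p.hasDerivAt y) (not_le.1 hcon)
  obtain ⟨z, hz, hz'⟩ := (e.and (Ioo_mem_nhdsLT hxy)).exists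
  rw [hy] at hz
  linarith [hpos z hz']

variable {a C : ℝ}

theorem exists_q_neg_gt (ha : a ≠ 0) (C x : ℝ) : ∃ r > x, (q a C).eval r < 0 := by
  refine ⟨|x| + 1 + (1 + (21 + 4 * |C|) / |a|), ?_, ?_⟩
  · have : 0 ≤ (21 + 4 * |C|) / |a| := by positivity
    linarith [le_abs_self x]
  · by_contra hcon
    have h1 := abs_le_of_q_nonneg ha (not_lt.1 hcon)
    rw [abs_of_nonneg (by positivity)] at h1
    linarith [abs_nonneg x]

theorem q_neg_of_lt_roots {x : ℝ} (hno : ∀ r < x, (q a C).eval r ≠ 0) {r : ℝ} (hr : r < x) :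
    (q a C).eval r < 0 := by
  by_contra hcon
  have h0 := nonneg_of_q_nonneg (not_lt.1 hcon)
  have h1 : (q a C).eval (-1) < 0 := by
    by_contra h
    linarith [nonneg_of_q_nonneg (not_lt.1 h)]
  obtain ⟨w, hw, hw0⟩ := intermediate_value_Icc (show -1 ≤ r by linarith)
    (q a C).continuous.continuousOn ⟨h1.le, not_lt.1 hcon⟩
  exact hno w (hw.2.trans_lt hr) hw0

theorem q_neg_of_gt_roots (ha : a ≠ 0) {x : ℝ} (hno : ∀ r > x, (q a C).eval r ≠ 0) {r : ℝ}
    (hr : x < r) : (q a C).eval r < 0 := by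
  by_contra hcon
  obtain ⟨z, hz, hz'⟩ := exists_q_neg_gt ha C r
  obtain ⟨w, hw, hw0⟩ := intermediate_value_Icc' hz.le (q a C).continuous.continuousOn
    ⟨hz'.le, not_lt.1 hcon⟩
  exact hno w (hr.trans_le hw.1) hw0

/-- At the smallest root `q` becomes positive, unless the root is multiple. -/
theorem derivative_pos_of_least {x : ℝ} (hx : (q a C).eval x = 0)
    (hd : (q a C).derivative.eval x ≠ 0) (hno : ∀ r < x, (q a C).eval r ≠ 0) :
    0 < (q a C).derivative.eval x := by
  have h1 := derivative_nonpos_of_pos (p := -q a C) (x := x - 1) (y := x) (by linarith)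
    (by simp [hx]) fun r hr => by
      rw [eval_neg]
      linarith [q_neg_of_lt_roots hno hr.2]
  rw [derivative_neg, eval_neg] at h1
  exact lt_of_le_of_ne (by linarith) hd.symm

theorem derivative_neg_of_greatest (ha : a ≠ 0) {x : ℝ} (hx : (q a C).eval x = 0)
    (hd : (q a C).derivative.eval x ≠ 0) (hno : ∀ r > x, (q a C).eval r ≠ 0) :
    (q a C).derivative.eval x < 0 := by
  have h1 := derivative_nonneg_of_pos (p := -q a C) (x := x) (y := x + 1) (by linarith)
    (by simp [hx]) fun r hr => by
      rw [eval_neg]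
      linarith [q_neg_of_gt_roots ha hno hr.1]
  rw [derivative_neg, eval_neg] at h1
  exact lt_of_le_of_ne (by linarith) hd

/-- Two simple roots bound one arc. -/
theorem simpleArc_of_two_roots (ha : a ≠ 0) {x₁ x₂ : ℝ} (h12 : x₁ < x₂)
    (hroot : ∀ r, (q a C).eval r = 0 ↔ r = x₁ ∨ r = x₂)
    (hd : ∀ r, (q a C).eval r = 0 → (q a C).derivative.eval r ≠ 0) :
    SimpleArc a C x₁ x₂ ∧ ∀ r, 0 ≤ (q a C).eval r → r ∈ Icc x₁ x₂ := by
  have r1 := (hroot x₁).2 (Or.inl rfl)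
  have r2 := (hroot x₂).2 (Or.inr rfl)
  have n1 : ∀ r < x₁, (q a C).eval r ≠ 0 := fun r hr e => by
    rcases (hroot r).1 e with h | h <;> linarith
  have n2 : ∀ r > x₂, (q a C).eval r ≠ 0 := fun r hr e => by
    rcases (hroot r).1 e with h | h <;> linarith
  have d1 := derivative_pos_of_least r1 (hd _ r1) n1
  refine ⟨⟨h12, r1, r2, pos_of_derivative_pos r1 d1 fun r hr e => ?_, d1,
    derivative_neg_of_greatest ha r2 (hd _ r2) n2⟩, fun r hr => ⟨?_, ?_⟩⟩
  · rcases (hroot r).1 e with h | h <;> linarith [hr.1, hr.2]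
  · by_contra hcon
    linarith [q_neg_of_lt_roots n1 (not_le.1 hcon)]
  · by_contra hcon
    linarith [q_neg_of_gt_roots ha n2 (not_le.1 hcon)]

/-- Four simple roots bound two arcs. -/
theorem simpleArc_of_four_roots (ha : a ≠ 0) {x₁ x₂ x₃ x₄ : ℝ} (h12 : x₁ < x₂) (h23 : x₂ < x₃)
    (h34 : x₃ < x₄) (hroot : ∀ r, (q a C).eval r = 0 ↔ r = x₁ ∨ r = x₂ ∨ r = x₃ ∨ r = x₄)
    (hd : ∀ r, (q a C).eval r = 0 → (q a C).derivative.eval r ≠ 0) :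
    SimpleArc a C x₁ x₂ ∧ SimpleArc a C x₃ x₄ ∧
      ∀ r, 0 ≤ (q a C).eval r → r ∈ Icc x₁ x₂ ∨ r ∈ Icc x₃ x₄ := by
  have r1 := (hroot x₁).2 (Or.inl rfl)
  have r2 := (hroot x₂).2 (Or.inr (Or.inl rfl))
  have r3 := (hroot x₃).2 (Or.inr (Or.inr (Or.inl rfl)))
  have r4 := (hroot x₄).2 (Or.inr (Or.inr (Or.inr rfl)))
  have n1 : ∀ r < x₁, (q a C).eval r ≠ 0 := fun r hr e => by
    rcases (hroot r).1 e with h | h | h | h <;> linarith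
  have n2 : ∀ r > x₄, (q a C).eval r ≠ 0 := fun r hr e => by
    rcases (hroot r).1 e with h | h | h | h <;> linarith
  have m12 : ∀ r ∈ Ioo x₁ x₂, (q a C).eval r ≠ 0 := fun r hr e => by
    rcases (hroot r).1 e with h | h | h | h <;> linarith [hr.1, hr.2]
  have m23 : ∀ r ∈ Ioo x₂ x₃, (q a C).eval r ≠ 0 := fun r hr e => by
    rcases (hroot r).1 e with h | h | h | h <;> linarith [hr.1, hr.2]
  have m34 : ∀ r ∈ Ioo x₃ x₄, (q a C).eval r ≠ 0 := fun r hr e => by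
    rcases (hroot r).1 e with h | h | h | h <;> linarith [hr.1, hr.2]
  have d1 := derivative_pos_of_least r1 (hd _ r1) n1
  have d4 := derivative_neg_of_greatest ha r4 (hd _ r4) n2
  have p12 := pos_of_derivative_pos r1 d1 m12
  have p34 := pos_of_derivative_neg r4 d4 m34
  have d2 : (q a C).derivative.eval x₂ < 0 :=
    lt_of_le_of_ne (derivative_nonpos_of_pos h12 r2 p12) (hd _ r2)
  have d3 : 0 < (q a C).derivative.eval x₃ :=
    lt_of_le_of_ne (derivative_nonneg_of_pos h34 r3 p34) (hd _ r3).symm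
  refine ⟨⟨h12, r1, r2, p12, d1, d2⟩, ⟨h34, r3, r4, p34, d3, d4⟩, fun r hr => ?_⟩
  have hl : x₁ ≤ r := by
    by_contra hcon
    linarith [q_neg_of_lt_roots n1 (not_le.1 hcon)]
  have hu : r ≤ x₄ := by
    by_contra hcon
    linarith [q_neg_of_gt_roots ha n2 (not_le.1 hcon)]
  rcases le_or_gt r x₂ with h | h
  · exact Or.inl ⟨hl, h⟩
  rcases le_or_gt x₃ r with h' | h'
  · exact Or.inr ⟨h', hu⟩
  have := pos_of_derivative_pos (p := -q a C) (x := x₂) (y := x₃) (by simp [r2])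
    (by rw [derivative_neg, eval_neg]; linarith) (fun r hr => by simpa using m23 r hr) r ⟨h, h'⟩
  rw [eval_neg] at this
  linarith

theorem q_isRoot_iff {a C r : ℝ} : (q a C).IsRoot r ↔ (q a C).eval r = 0 := Iff.rfl

/-- Simple solutions of the level equation give simple roots of `q`. -/
theorem derivative_ne_zero_of_levels
    (hs : ∀ R, levelG a R = C → a * R ^ 3 - 2 * R + 2 ≠ 0) {r : ℝ} (hr : (q a C).eval r = 0) :
    (q a C).derivative.eval r ≠ 0 := by
  obtain ⟨R, rfl, e⟩ := q_root_iff.1 hr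
  rw [q_derivative_eval_sq e]
  exact mul_ne_zero (by norm_num) (hs R e)

/-- A level with two simple solutions carries one simple arc, which is the whole of `{q ≥ 0}`. -/
theorem TwoSimple.exists_arc (ha : a ≠ 0) (hs : TwoSimple a C) :
    ∃ x₁ x₂, x₁ < x₂ ∧ (∀ r, (q a C).eval r = 0 ↔ r = x₁ ∨ r = x₂) ∧ SimpleArc a C x₁ x₂ ∧
      ∀ r, 0 ≤ (q a C).eval r → r ∈ Icc x₁ x₂ := by
  obtain ⟨u, w, huw, hR, du, dw⟩ := hs
  have eu := (hR u).2 (Or.inl rfl)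
  have ew := (hR w).2 (Or.inr rfl)
  have hd : ∀ r, (q a C).eval r = 0 → (q a C).derivative.eval r ≠ 0 := fun r hr =>
    derivative_ne_zero_of_levels (fun R e => by
      rcases (hR R).1 e with rfl | rfl <;> assumption) hr
  have hroot : ∀ r, (q a C).eval r = 0 ↔ r = u ^ 2 ∨ r = w ^ 2 := fun r => by
    rw [q_root_iff]
    constructor
    · rintro ⟨R, rfl, e⟩
      rcases (hR R).1 e with rfl | rfl
      · exact Or.inl rfl
      · exact Or.inr rfl
    · rintro (rfl | rfl)
      · exact ⟨u, rfl, eu⟩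
      · exact ⟨w, rfl, ew⟩
  rcases (sq_ne_sq_of_levelG eu ew huw).lt_or_gt with h | h
  · exact ⟨_, _, h, hroot, simpleArc_of_two_roots ha h hroot hd⟩
  · have hroot' : ∀ r, (q a C).eval r = 0 ↔ r = w ^ 2 ∨ r = u ^ 2 := fun r => by
      rw [hroot, or_comm]
    exact ⟨_, _, h, hroot', simpleArc_of_two_roots ha h hroot' hd⟩

theorem exists_sorted_four {S : Finset ℝ} (hS : S.card = 4) :
    ∃ x₁ x₂ x₃ x₄, x₁ < x₂ ∧ x₂ < x₃ ∧ x₃ < x₄ ∧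
      ∀ r, r ∈ S ↔ r = x₁ ∨ r = x₂ ∨ r = x₃ ∨ r = x₄ := by
  set f := S.orderEmbOfFin hS
  refine ⟨f 0, f 1, f 2, f 3, f.strictMono (by decide), f.strictMono (by decide),
    f.strictMono (by decide), fun r => ?_⟩
  have : r ∈ S ↔ r ∈ range f := by rw [Finset.range_orderEmbOfFin, Finset.mem_coe]
  rw [this]
  constructor
  · rintro ⟨i, rfl⟩
    fin_cases i
    · exact Or.inl rfl
    · exact Or.inr (Or.inl rfl)
    · exact Or.inr (Or.inr (Or.inl rfl))
    · exact Or.inr (Or.inr (Or.inr rfl))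
  · rintro (rfl | rfl | rfl | rfl) <;> exact mem_range_self _

/-- On the levels between those of `R₂` and `R₃`, the region `{q ≥ 0}` consists of two simple arcs.
-/
theorem exists_two_arcs (h0 : 0 < a) (h1 : a < 8 / 27) (hC2 : C₂ a < C) (hC3 : C < C₃ a) :
    ∃ x₁ x₂ x₃ x₄, x₁ < x₂ ∧ x₂ < x₃ ∧ x₃ < x₄ ∧
      (∀ r, (q a C).eval r = 0 ↔ r = x₁ ∨ r = x₂ ∨ r = x₃ ∨ r = x₄) ∧
      SimpleArc a C x₁ x₂ ∧ SimpleArc a C x₃ x₄ ∧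
      ∀ r, 0 ≤ (q a C).eval r → r ∈ Icc x₁ x₂ ∨ r ∈ Icc x₃ x₄ := by
  obtain ⟨u, w, z, t, huw, hwz, hzt, hR, hs⟩ := exists_four_levels h0 h1 hC2 hC3
  have eu := (hR u).2 (Or.inl rfl)
  have ew := (hR w).2 (Or.inr (Or.inl rfl))
  have ez := (hR z).2 (Or.inr (Or.inr (Or.inl rfl)))
  have et := (hR t).2 (Or.inr (Or.inr (Or.inr rfl)))
  have hcard : ({u ^ 2, w ^ 2, z ^ 2, t ^ 2} : Finset ℝ).card = 4 := by
    have n := fun {x y} (hx : levelG a x = C) (hy : levelG a y = C) (hxy : x < y) =>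
      sq_ne_sq_of_levelG hx hy hxy.ne
    rw [Finset.card_insert_of_notMem, Finset.card_insert_of_notMem, Finset.card_pair]
    · exact n ez et hzt
    · simp only [Finset.mem_insert, Finset.mem_singleton, not_or]
      exact ⟨n ew ez hwz, n ew et (hwz.trans hzt)⟩
    · simp only [Finset.mem_insert, Finset.mem_singleton, not_or]
      exact ⟨n eu ew huw, n eu ez (huw.trans hwz), n eu et (huw.trans (hwz.trans hzt))⟩
  obtain ⟨x₁, x₂, x₃, x₄, h12, h23, h34, hS⟩ := exists_sorted_four hcard
  have hroot : ∀ r, (q a C).eval r = 0 ↔ r = x₁ ∨ r = x₂ ∨ r = x₃ ∨ r = x₄ := fun r => by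
    rw [← hS, q_root_iff]
    simp only [Finset.mem_insert, Finset.mem_singleton]
    constructor
    · rintro ⟨R, rfl, e⟩
      rcases (hR R).1 e with rfl | rfl | rfl | rfl <;> simp
    · rintro (rfl | rfl | rfl | rfl)
      exacts [⟨u, rfl, eu⟩, ⟨w, rfl, ew⟩, ⟨z, rfl, ez⟩, ⟨t, rfl, et⟩]
  exact ⟨x₁, x₂, x₃, x₄, h12, h23, h34, hroot, simpleArc_of_four_roots h0.ne' h12 h23 h34 hroot
    fun r hr => derivative_ne_zero_of_levels hs hr⟩

/-! ### Multiple roots -/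

/-- The multiple roots of `q` are the squares of the critical radii. -/
theorem exists_radius_of_multiple_root {x : ℝ} (hx : (q a C).eval x = 0)
    (hd : (q a C).derivative.eval x = 0) :
    ∃ R, R ≠ 0 ∧ x = R ^ 2 ∧ a = h R ∧ C = R * (R - 3) / 2 := by
  obtain ⟨R, rfl, e⟩ := q_root_iff.1 hx
  rw [q_derivative_eval_sq e] at hd
  have hc : a * R ^ 3 - 2 * R + 2 = 0 := by linarith
  have hR : R ≠ 0 := by
    rintro rfl
    norm_num at hc
  have ha := (h_eq_iff hR).2 hc
  exact ⟨R, hR, rfl, ha.symm, by rw [← e, ← ha, levelG_h hR]⟩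

/-- On the level of a critical radius `R`, `q` is divisible by `(r - R²)²`. -/
theorem q_eval_critical {R : ℝ} (hR : R ≠ 0) (r : ℝ) :
    (q (h R) (R * (R - 3) / 2)).eval r = -(4 * (R - 1) ^ 2 / R ^ 6 * r ^ 2
      - 8 * (R ^ 2 - 1) / R ^ 4 * r + 4 * (R - 3) ^ 2 / R ^ 2) * (r - R ^ 2) ^ 2 := by
  rw [q_eval]
  unfold levelP h
  field_simp
  ring

theorem q_derivative_eval_critical {R : ℝ} (hR : R ≠ 0) (r : ℝ) :
    (q (h R) (R * (R - 3) / 2)).derivative.eval r = -(8 * (R - 1) ^ 2 / R ^ 6 * r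
      - 8 * (R ^ 2 - 1) / R ^ 4) * (r - R ^ 2) ^ 2 - (4 * (R - 1) ^ 2 / R ^ 6 * r ^ 2
      - 8 * (R ^ 2 - 1) / R ^ 4 * r + 4 * (R - 3) ^ 2 / R ^ 2) * (2 * (r - R ^ 2)) := by
  rw [q_derivative_eval]
  unfold levelP h
  field_simp
  ring

/-- `q` has at most one multiple root. -/
theorem multiple_root_unique (ha : a ≠ 0) {x x' : ℝ} (hx : (q a C).eval x = 0)
    (hd : (q a C).derivative.eval x = 0) (hx' : (q a C).eval x' = 0)
    (hd' : (q a C).derivative.eval x' = 0) : x' = x := by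
  obtain ⟨R, hR, rfl, rfl, rfl⟩ := exists_radius_of_multiple_root hx hd
  by_contra hne
  have hne' : x' - R ^ 2 ≠ 0 := sub_ne_zero.2 hne
  rw [q_eval_critical hR] at hx'
  have h1 := (mul_eq_zero.1 hx').resolve_right (pow_ne_zero 2 hne')
  rw [q_derivative_eval_critical hR] at hd'
  have h2 : (8 * (R - 1) ^ 2 / R ^ 6 * x' - 8 * (R ^ 2 - 1) / R ^ 4) * (x' - R ^ 2) ^ 2 = 0 := by
    linear_combination -hd' + 2 * (x' - R ^ 2) * h1
  have h3 := (mul_eq_zero.1 h2).resolve_right (pow_ne_zero 2 hne')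
  -- the discriminant of the second factor is `512 (R - 1)³ / R⁸`
  have h4 : 512 * (R - 1) ^ 3 / R ^ 8 = 0 := by
    have : 512 * (R - 1) ^ 3 / R ^ 8
        = (8 * (R - 1) ^ 2 / R ^ 6 * x' - 8 * (R ^ 2 - 1) / R ^ 4) ^ 2
        + 16 * (R - 1) ^ 2 / R ^ 6 * (-(4 * (R - 1) ^ 2 / R ^ 6 * x' ^ 2
      - 8 * (R ^ 2 - 1) / R ^ 4 * x' + 4 * (R - 3) ^ 2 / R ^ 2)) := by
      field_simp
      ring
    rw [this, h3, h1]
    ring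
  have h5 : R - 1 = 0 := by
    rcases div_eq_zero_iff.1 h4 with h | h
    · exact pow_eq_zero_iff three_ne_zero |>.1 (by linarith)
    · exact absurd h (pow_ne_zero 8 hR)
  apply ha
  unfold h
  rw [h5]
  simp

theorem rootMultiplicity_of_factor {p s : ℝ[X]} {x : ℝ} {n : ℕ}
    (hp : p = s * (X - Polynomial.C x) ^ n)
    (hs : s.eval x ≠ 0) : p.rootMultiplicity x = n := by
  have hs0 : s ≠ 0 := by
    rintro rfl
    simp at hs
  rw [hp, rootMultiplicity_mul_X_sub_C_pow hs0, rootMultiplicity_eq_zero hs, zero_add]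

/-- Away from the cusp the critical radius is a double root. -/
theorem rootMultiplicity_critical {R : ℝ} (hR : R ≠ 0) (hR' : R ≠ 3 / 2) :
    (q (h R) (R * (R - 3) / 2)).rootMultiplicity (R ^ 2) = 2 := by
  refine rootMultiplicity_of_factor (s := -(Polynomial.C (4 * (R - 1) ^ 2 / R ^ 6) * X ^ 2
    - Polynomial.C (8 * (R ^ 2 - 1) / R ^ 4) * X + Polynomial.C (4 * (R - 3) ^ 2 / R ^ 2)))
    (Polynomial.funext fun r => ?_) ?_
  · rw [q_eval_critical hR]
    simp
  · have : eval (R ^ 2) (-(Polynomial.C (4 * (R - 1) ^ 2 / R ^ 6) * X ^ 2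
        - Polynomial.C (8 * (R ^ 2 - 1) / R ^ 4) * X + Polynomial.C (4 * (R - 3) ^ 2 / R ^ 2)))
        = 16 * (2 * R - 3) / R ^ 2 := by
      simp only [eval_neg, eval_add, eval_sub, eval_mul, eval_C, eval_pow, eval_X]
      field_simp
      ring
    rw [this]
    refine div_ne_zero (mul_ne_zero (by norm_num) fun h => hR' (by linarith)) (pow_ne_zero 2 hR)

/-- The critical radius `R₁` is the only root on its level. -/
theorem q_neg_of_lt_one {R : ℝ} (hR : R ≠ 0) (hR1 : R < 1) {r : ℝ} (hr : r ≠ R ^ 2) :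
    (q (h R) (R * (R - 3) / 2)).eval r < 0 := by
  rw [q_eval_critical hR]
  have hA : 0 < 16 * (R - 1) ^ 2 / R ^ 6 := by
    have h1 : R - 1 ≠ 0 := by linarith
    positivity
  have h2 : 0 < 512 * (1 - R) ^ 3 / R ^ 8 := by
    have h1 : 0 < 1 - R := by linarith
    positivity
  -- completing the square; the second factor of `q` has discriminant `512 (R - 1)³ / R⁸ < 0`
  have key : 0 < 16 * (R - 1) ^ 2 / R ^ 6 * (4 * (R - 1) ^ 2 / R ^ 6 * r ^ 2
      - 8 * (R ^ 2 - 1) / R ^ 4 * r + 4 * (R - 3) ^ 2 / R ^ 2) := by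
    have : 16 * (R - 1) ^ 2 / R ^ 6 * (4 * (R - 1) ^ 2 / R ^ 6 * r ^ 2
      - 8 * (R ^ 2 - 1) / R ^ 4 * r + 4 * (R - 3) ^ 2 / R ^ 2)
      = (8 * (R - 1) ^ 2 / R ^ 6 * r - 8 * (R ^ 2 - 1) / R ^ 4) ^ 2
        + 512 * (1 - R) ^ 3 / R ^ 8 := by
      field_simp
      ring
    rw [this]
    positivity
  have h3 := (mul_pos_iff_of_pos_left hA).1 key
  have h4 : 0 < (r - R ^ 2) ^ 2 := by
    have := sub_ne_zero.2 hr
    positivity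
  nlinarith [mul_pos h3 h4]

/-- On the level of a critical radius `R > 1` the two further roots are rational in
`w = √(2(R - 1))`. -/
theorem q_eval_critical_factor {w : ℝ} (hw : 0 < w) (r : ℝ) :
    (q (h (1 + w ^ 2 / 2)) ((1 + w ^ 2 / 2) * ((1 + w ^ 2 / 2) - 3) / 2)).eval r
      = -(h (1 + w ^ 2 / 2) ^ 2) * (r - (1 + w ^ 2 / 2) ^ 2) ^ 2
        * (r - ((1 + w ^ 2 / 2) * (w - 2) / w) ^ 2)
        * (r - ((1 + w ^ 2 / 2) * (w + 2) / w) ^ 2) := by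
  have : (2 + w ^ 2) ≠ 0 := by positivity
  rw [q_eval]
  unfold levelP h
  field_simp
  ring

theorem q_derivative_of_factor {c x y z : ℝ}
    (hq : ∀ r, (q a C).eval r = -c * (r - x) ^ 2 * (r - y) * (r - z)) (r : ℝ) :
    (q a C).derivative.eval r = -c * (2 * (r - x) * (r - y) * (r - z)
      + (r - x) ^ 2 * (r - z) + (r - x) ^ 2 * (r - y)) := by
  have e : q a C = -Polynomial.C c * (X - Polynomial.C x) ^ 2 * (X - Polynomial.C y)
      * (X - Polynomial.C z) := Polynomial.funext fun r => by
    rw [hq]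
    simp
  rw [e]
  simp [derivative_mul, derivative_pow]
  ring

/-- The position of the roots on the level of a critical radius `R > 1`. -/
theorem exists_factor_of_one_lt {R : ℝ} (hR : 1 < R) :
    ∃ y z, y < z ∧ (R < 3 / 2 → R ^ 2 < y) ∧ (3 / 2 < R → y < R ^ 2 ∧ R ^ 2 < z) ∧
      ∀ r, (q (h R) (R * (R - 3) / 2)).eval r
        = -(h R ^ 2) * (r - R ^ 2) ^ 2 * (r - y) * (r - z) := by
  obtain ⟨w, hw, rfl⟩ : ∃ w > 0, R = 1 + w ^ 2 / 2 :=
    ⟨Real.sqrt (2 * (R - 1)), Real.sqrt_pos.2 (by linarith), by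
      rw [Real.sq_sqrt (by linarith)]; ring⟩
  have hS : 0 < 1 + w ^ 2 / 2 := by positivity
  refine ⟨_, _, ?_, fun h1 => ?_, fun h1 => ⟨?_, ?_⟩, q_eval_critical_factor hw⟩
  · rw [div_pow, div_pow]
    refine div_lt_div_of_pos_right ?_ (by positivity)
    nlinarith [mul_pos (sq_pos_of_pos hS) hw]
  · have hw1 : w < 1 := by nlinarith
    rw [div_pow, lt_div_iff₀ (by positivity), mul_pow]
    refine mul_lt_mul_of_pos_left ?_ (sq_pos_of_pos hS)
    nlinarith
  · have hw1 : 1 < w := by nlinarith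
    rw [div_pow, div_lt_iff₀ (by positivity), mul_pow]
    refine mul_lt_mul_of_pos_left ?_ (sq_pos_of_pos hS)
    nlinarith
  · rw [div_pow, lt_div_iff₀ (by positivity), mul_pow]
    refine mul_lt_mul_of_pos_left ?_ (sq_pos_of_pos hS)
    nlinarith

theorem q_eval_cusp (r : ℝ) : (q (8 / 27) (-(9 / 8))).eval r
    = -((8 / 27) ^ 2) * (r - 9 / 4) ^ 2 * (r - 9 / 4) * (r - 81 / 4) := by
  rw [q_eval]; unfold levelP; ring

theorem rootMultiplicity_cusp : (q (8 / 27) (-(9 / 8))).rootMultiplicity (9 / 4) = 3 := by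
  refine rootMultiplicity_of_factor
    (s := Polynomial.C (-((8 / 27) ^ 2)) * (X - Polynomial.C (81 / 4)))
    (Polynomial.funext fun r => ?_) ?_
  · rw [q_eval_cusp]
    simp only [eval_mul, eval_C, eval_sub, eval_X, eval_pow]
    ring
  · simp only [eval_mul, eval_C, eval_sub, eval_X]
    norm_num

/-! ### The arc through a given point -/

theorem exists_zero_left {f : ℝ → ℝ} (hf : Continuous f) {u r : ℝ} (hur : u < r) (hu : f u ≤ 0)
    (hr : 0 < f r) : ∃ x ∈ Ico u r, f x = 0 ∧ ∀ t ∈ Ioc x r, 0 < f t := by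
  set S := Icc u r ∩ f ⁻¹' Iic 0
  have hS : IsCompact S := isCompact_Icc.inter_right (isClosed_Iic.preimage hf)
  obtain ⟨x, hx, hmax⟩ := hS.exists_isGreatest ⟨u, ⟨le_rfl, hur.le⟩, hu⟩
  have hxr : x < r := by
    refine lt_of_le_of_ne hx.1.2 ?_
    rintro rfl
    exact absurd hx.2 (not_le.2 hr)
  have hpos : ∀ t ∈ Ioc x r, 0 < f t := fun t ht => by
    by_contra hcon
    exact absurd (hmax ⟨⟨hx.1.1.trans ht.1.le, ht.2⟩, not_lt.1 hcon⟩) (not_le.2 ht.1)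
  refine ⟨x, ⟨hx.1.1, hxr⟩, le_antisymm hx.2 ?_, hpos⟩
  obtain ⟨t, ht, ht0⟩ := intermediate_value_Icc hxr.le hf.continuousOn ⟨hx.2, hr.le⟩
  rcases ht.1.eq_or_lt with h | h
  · rw [h, ht0]
  · exact absurd ht0 (hpos t ⟨h, ht.2⟩).ne'

theorem exists_zero_right {f : ℝ → ℝ} (hf : Continuous f) {u r : ℝ} (hur : r < u) (hu : f u ≤ 0)
    (hr : 0 < f r) : ∃ x ∈ Ioc r u, f x = 0 ∧ ∀ t ∈ Ico r x, 0 < f t := by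
  obtain ⟨x, hx, hx0, hpos⟩ := exists_zero_left (f := fun t => f (-t)) (hf.comp continuous_neg)
    (u := -u) (r := -r) (by linarith) (by simpa using hu) (by simpa using hr)
  refine ⟨-x, ⟨by linarith [hx.2], by linarith [hx.1]⟩, hx0, fun t ht => ?_⟩
  have := hpos (-t) ⟨by linarith [ht.2], by linarith [ht.1]⟩
  simpa using this

theorem exists_arc_of_pos (ha : a ≠ 0) {r₀ : ℝ} (hr₀ : 0 < (q a C).eval r₀) :
    ∃ x₁ x₂, r₀ ∈ Ioo x₁ x₂ ∧ (q a C).eval x₁ = 0 ∧ (q a C).eval x₂ = 0 ∧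
      ∀ r ∈ Ioo x₁ x₂, 0 < (q a C).eval r := by
  have h1 : (q a C).eval (-1) < 0 := by
    by_contra h
    linarith [nonneg_of_q_nonneg (not_lt.1 h)]
  obtain ⟨z, hz, hz'⟩ := exists_q_neg_gt ha C r₀
  obtain ⟨x₁, hx₁, e₁, p₁⟩ := exists_zero_left (q a C).continuous
    (by linarith [nonneg_of_q_nonneg hr₀.le]) h1.le hr₀
  obtain ⟨x₂, hx₂, e₂, p₂⟩ := exists_zero_right (q a C).continuous hz hz'.le hr₀
  refine ⟨x₁, x₂, ⟨hx₁.2, hx₂.1⟩, e₁, e₂, fun r hr => ?_⟩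
  rcases le_total r r₀ with h | h
  · exact p₁ r ⟨hr.1, h⟩
  · exact p₂ r ⟨h, hr.2⟩

/-- A point of `{q ≥ 0}` that is not a multiple root lies on an arc of `{q > 0}` or at one of its
ends. -/
theorem exists_arc (ha : a ≠ 0) {r₀ : ℝ} (hr₀ : 0 ≤ (q a C).eval r₀)
    (hns : ¬ ((q a C).eval r₀ = 0 ∧ (q a C).derivative.eval r₀ = 0)) :
    ∃ x₁ x₂, x₁ < x₂ ∧ r₀ ∈ Icc x₁ x₂ ∧ (q a C).eval x₁ = 0 ∧ (q a C).eval x₂ = 0 ∧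
      ∀ r ∈ Ioo x₁ x₂, 0 < (q a C).eval r := by
  rcases hr₀.eq_or_lt with h0 | h0
  · have hd : (q a C).derivative.eval r₀ ≠ 0 := fun h => hns ⟨h0.symm, h⟩
    rcases hd.lt_or_gt with hd | hd
    · have e := eventually_lt_of_deriv_pos ((q a C).hasDerivAt r₀).neg (neg_pos.2 hd)
      obtain ⟨l, hl, hl'⟩ := mem_nhdsLT_iff_exists_Ioo_subset.1 e
      have hl0 : l < r₀ := hl
      have hp : ∀ r ∈ Ioo l r₀, 0 < (q a C).eval r := fun r hr => by
        have : -(q a C).eval r < -(q a C).eval r₀ := hl' hr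
        linarith
      have hm : (l + r₀) / 2 ∈ Ioo l r₀ := ⟨by linarith, by linarith⟩
      obtain ⟨x₁, x₂, hx, e₁, e₂, p⟩ := exists_arc_of_pos ha (hp _ hm)
      have hx2 : x₂ = r₀ := by
        rcases lt_trichotomy x₂ r₀ with h | h | h
        · exact absurd e₂ (hp x₂ ⟨hm.1.trans hx.2, h⟩).ne'
        · exact h
        · exact absurd h0 (p r₀ ⟨hx.1.trans hm.2, h⟩).ne
      exact ⟨x₁, x₂, hx.1.trans hx.2, ⟨by rw [← hx2]; exact (hx.1.trans hx.2).le, hx2.ge⟩,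
        e₁, e₂, p⟩
    · have e := eventually_gt_of_deriv_pos ((q a C).hasDerivAt r₀) hd
      obtain ⟨l, hl, hl'⟩ := mem_nhdsGT_iff_exists_Ioo_subset.1 e
      have hl0 : r₀ < l := hl
      have hp : ∀ r ∈ Ioo r₀ l, 0 < (q a C).eval r := fun r hr => by
        have : (q a C).eval r₀ < (q a C).eval r := hl' hr
        linarith
      have hm : (l + r₀) / 2 ∈ Ioo r₀ l := ⟨by linarith, by linarith⟩
      obtain ⟨x₁, x₂, hx, e₁, e₂, p⟩ := exists_arc_of_pos ha (hp _ hm)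
      have hx1 : x₁ = r₀ := by
        rcases lt_trichotomy x₁ r₀ with h | h | h
        · exact absurd h0 (p r₀ ⟨h, hm.1.trans hx.2⟩).ne
        · exact h
        · exact absurd e₁ (hp x₁ ⟨h, hx.1.trans hm.2⟩).ne'
      exact ⟨x₁, x₂, hx.1.trans hx.2, ⟨hx1.le, by rw [← hx1]; exact (hx.1.trans hx.2).le⟩,
        e₁, e₂, p⟩
  · obtain ⟨x₁, x₂, hx, e₁, e₂, p⟩ := exists_arc_of_pos ha h0
    exact ⟨x₁, x₂, hx.1.trans hx.2, ⟨hx.1.le, hx.2.le⟩, e₁, e₂, p⟩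

end Signs

/-! ### The regions of the parameter space -/

/-- The level `R (R - 3) / 2` of a critical radius increases beyond `3/2`. -/
theorem critical_value_lt {R S : ℝ} (hR : 3 / 2 ≤ R) (hRS : R < S) :
    R * (R - 3) / 2 < S * (S - 3) / 2 := by nlinarith

/-- The level `R (R - 3) / 2` of a critical radius decreases up to `3/2`. -/
theorem critical_value_lt' {R S : ℝ} (hRS : R < S) (hS : S ≤ 3 / 2) :
    S * (S - 3) / 2 < R * (R - 3) / 2 := by nlinarith

theorem h_lt_cusp {R : ℝ} (hR : 0 < R) (hR' : R < 3 / 2) : h R < 8 / 27 := by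
  rw [← h_three_halves]
  exact h_lt_h hR hR' le_rfl

theorem R₂_h {R : ℝ} (hR : 1 < R) (hR' : R < 3 / 2) : R₂ (h R) = R := by
  obtain ⟨h1, h2, h3⟩ := R₂_spec (h_pos hR) (h_lt_cusp (by linarith) hR')
  rcases lt_trichotomy (R₂ (h R)) R with hlt | heq | hgt
  · exact absurd h3 (h_lt_h (by linarith) hlt hR'.le).ne
  · exact heq
  · exact absurd h3 (h_lt_h (by linarith) hgt h2.le).ne'

theorem mem_closure_of_mem_β₂ {a C ω : ℝ} (hp : (a, C, ω) ∈ β₂) : (a, C, ω) ∈ closure Ω₂ := by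
  obtain ⟨hC, h0, h1, hω⟩ := hp
  have hC : C = C₂ a := hC
  subst hC
  have hlt := C₂_lt_C₃ h0 h1
  have hmem : C₂ a ∈ closure (Ioo (C₂ a) (C₃ a)) := by
    rw [closure_Ioo hlt.ne]; exact ⟨le_rfl, hlt.le⟩
  exact map_mem_closure (f := fun t : ℝ => (a, t, ω)) (by fun_prop) hmem
    fun t ht => ⟨ht.1, ht.2, h0, h1, hω⟩

theorem mem_closure_of_mem_β₃ {a C ω : ℝ} (hp : (a, C, ω) ∈ β₃) : (a, C, ω) ∈ closure Ω₂ := by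
  obtain ⟨hC, h0, h1, hω⟩ := hp
  have hC : C = C₃ a := hC
  subst hC
  have hlt := C₂_lt_C₃ h0 h1
  have hmem : C₃ a ∈ closure (Ioo (C₂ a) (C₃ a)) := by
    rw [closure_Ioo hlt.ne]; exact ⟨hlt.le, le_rfl⟩
  exact map_mem_closure (f := fun t : ℝ => (a, t, ω)) (by fun_prop) hmem
    fun t ht => ⟨ht.1, ht.2, h0, h1, hω⟩

theorem mem_closure_of_mem_cusp {a C ω : ℝ} (hp : (a, C, ω) ∈ cuspPoints) :
    (a, C, ω) ∈ closure Ω₂ := by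
  obtain ⟨ha, hC, hω⟩ := hp
  have ha : a = 8 / 27 := ha
  have hC : C = -(9 / 8) := hC
  subst ha hC
  -- The curve of critical levels `R ↦ (h R, R (R - 3) / 2)` runs through `β₂` for `1 < R < 3/2` and
  -- ends in the cusp.
  set f : ℝ → ℝ × ℝ × ℝ := fun R => (h R, R * (R - 3) / 2, ω) with hf
  have hcont : ContinuousWithinAt f (Ioo 1 (3 / 2)) (3 / 2) := by
    have : ContinuousAt h (3 / 2) := by
      unfold h
      exact ContinuousAt.div (by fun_prop) (by fun_prop) (by norm_num)
    exact (this.prodMk (by fun_prop)).continuousWithinAt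
  have hmem : (3 / 2 : ℝ) ∈ closure (Ioo (1 : ℝ) (3 / 2)) := by
    rw [closure_Ioo (by norm_num)]; norm_num
  have h1 := hcont.mem_closure_image hmem
  have h2 : f (3 / 2) = (8 / 27, -(9 / 8), ω) := by
    simp only [hf, h_three_halves]
    norm_num
  rw [← h2]
  refine closure_minimal ?_ isClosed_closure h1
  rintro _ ⟨R, hR, rfl⟩
  refine mem_closure_of_mem_β₂ ⟨?_, h_pos hR.1, h_lt_cusp (by linarith [hR.1]) hR.2, hω⟩
  change R * (R - 3) / 2 = C₂ (h R)
  rw [(C₂_eq (h_pos hR.1) (h_lt_cusp (by linarith [hR.1]) hR.2)).1, R₂_h hR.1 hR.2]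

/-- The interior of `Ω` avoids the boundary of `Ω₂`; its levels have two simple solutions. -/
theorem twoSimple_of_mem_interior {a C ω : ℝ} (hp : (a, C, ω) ∈ interior Ω) :
    a ≠ 0 ∧ TwoSimple a C := by
  have hcl : (a, C, ω) ∉ closure Ω₂ := fun hcl => by
    obtain ⟨z, hz, hz'⟩ := mem_closure_iff.1 hcl _ isOpen_interior hp
    exact (interior_subset hz).2 hz'
  rcases (interior_subset hp).1 with ⟨hC, ha, -⟩ | ⟨hC, ha, hω⟩
  · exact ⟨ha.ne, twoSimple_of_neg ha hC⟩
  · have hC : C < C₁ a := hC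
    have ha : 0 < a := ha
    have hω : 0 < ω := hω
    refine ⟨ha.ne', ?_⟩
    rcases lt_or_ge a (8 / 27) with h1 | h1
    · refine twoSimple_of_small ha h1 hC ?_
      by_contra hcon
      rw [not_or, not_lt, not_lt] at hcon
      rcases hcon.1.eq_or_lt with h2 | h2
      · exact hcl (mem_closure_of_mem_β₂ ⟨h2.symm, ha, h1, hω⟩)
      rcases hcon.2.eq_or_lt with h3 | h3
      · exact hcl (mem_closure_of_mem_β₃ ⟨h3, ha, h1, hω⟩)
      · exact hcl (subset_closure ⟨h2, h3, ha, h1, hω⟩)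
    · exact twoSimple_of_large h1 hC fun hc => hcl (mem_closure_of_mem_cusp ⟨hc.1, hc.2, hω⟩)

/-- Points above the level of a critical radius `S₀ ≥ 3/2` stay off the closure of `Ω₂`. The radius
`R₃` need not be known to depend continuously on `a`: a radius `S > S₀` whose level is still below
`C` serves as a bound for all `a` close to `h S₀`. -/
theorem eventually_notMem_of_gt {a C ω S₀ : ℝ} (hS₀ : 3 / 2 ≤ S₀) (ha : h S₀ = a)
    (hC : S₀ * (S₀ - 3) / 2 < C) : ∀ᶠ p in 𝓝 (a, C, ω), p ∉ Ω₂ := by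
  have hc : ContinuousAt (fun S : ℝ => S * (S - 3) / 2) S₀ := by fun_prop
  obtain ⟨S, hS, hS'⟩ := (((hc.eventually (gt_mem_nhds hC)).filter_mono
    nhdsWithin_le_nhds).and (self_mem_nhdsWithin (s := Ioi S₀))).exists
  have hS1 : S₀ < S := hS'
  have hh : h S < a := by rw [← ha]; exact h_lt_h' hS₀ hS1
  have e1 : ∀ᶠ p : ℝ × ℝ × ℝ in 𝓝 (a, C, ω), h S < p.1 :=
    (isOpen_lt continuous_const continuous_fst).mem_nhds hh
  have e2 : ∀ᶠ p : ℝ × ℝ × ℝ in 𝓝 (a, C, ω), S * (S - 3) / 2 < p.2.1 :=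
    (isOpen_lt continuous_const (by fun_prop)).mem_nhds hS
  filter_upwards [e1, e2] with p h1 h2 hp
  obtain ⟨-, hp3, hp0, hp1, -⟩ := hp
  obtain ⟨b1, b2⟩ := R₃_spec hp0 hp1
  rw [(C₃_eq hp0 hp1).1] at hp3
  rcases lt_or_ge (R₃ p.1) S with h3 | h3
  · linarith [critical_value_lt b1.le h3]
  · rcases h3.eq_or_lt with h4 | h4
    · rw [h4, b2] at h1
      exact lt_irrefl _ h1
    · have := h_lt_h' (hS₀.trans hS1.le) h4
      linarith

/-- Points below the level of a critical radius `S₀` between `1` and `3/2` stay off the closure of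
`Ω₂`. -/
theorem eventually_notMem_of_lt {a C ω S₀ : ℝ} (hS₀ : 1 < S₀) (hS₀' : S₀ < 3 / 2) (ha : h S₀ = a)
    (hC : C < S₀ * (S₀ - 3) / 2) : ∀ᶠ p in 𝓝 (a, C, ω), p ∉ Ω₂ := by
  have hc : ContinuousAt (fun S : ℝ => S * (S - 3) / 2) S₀ := by fun_prop
  obtain ⟨S, hS, hS'⟩ := (((hc.eventually (lt_mem_nhds hC)).filter_mono
    nhdsWithin_le_nhds).and (Ioo_mem_nhdsGT hS₀')).exists
  have hh : a < h S := by rw [← ha]; exact h_lt_h (by linarith) hS'.1 hS'.2.le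
  have e1 : ∀ᶠ p : ℝ × ℝ × ℝ in 𝓝 (a, C, ω), p.1 < h S :=
    (isOpen_lt continuous_fst continuous_const).mem_nhds hh
  have e2 : ∀ᶠ p : ℝ × ℝ × ℝ in 𝓝 (a, C, ω), p.2.1 < S * (S - 3) / 2 :=
    (isOpen_lt (by fun_prop) continuous_const).mem_nhds hS
  filter_upwards [e1, e2] with p h1 h2 hp
  obtain ⟨hp2, -, hp0, hp1, -⟩ := hp
  obtain ⟨b1, b2, b3⟩ := R₂_spec hp0 hp1
  rw [(C₂_eq hp0 hp1).1] at hp2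
  rcases lt_or_ge (R₂ p.1) S with h3 | h3
  · linarith [critical_value_lt' h3 hS'.2.le]
  · rcases h3.eq_or_lt with h4 | h4
    · rw [h4, b3] at h1
      exact lt_irrefl _ h1
    · have := h_lt_h (by linarith [hS'.1]) h4 b2.le
      linarith

/-- All of `Ω₂` lies above the level `-9/8` of the cusp. -/
theorem eventually_notMem_of_lt_cusp {a C ω : ℝ} (hC : C < -(9 / 8)) :
    ∀ᶠ p in 𝓝 (a, C, ω), p ∉ Ω₂ := by
  have e2 : ∀ᶠ p : ℝ × ℝ × ℝ in 𝓝 (a, C, ω), p.2.1 < -(9 / 8) :=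
    (isOpen_lt (by fun_prop) continuous_const).mem_nhds hC
  filter_upwards [e2] with p h2 hp
  obtain ⟨hp2, -, hp0, hp1, -⟩ := hp
  obtain ⟨b1, b2, b3⟩ := R₂_spec hp0 hp1
  rw [(C₂_eq hp0 hp1).1] at hp2
  have := critical_value_lt' b2 le_rfl
  norm_num at this
  linarith

/-- That `C > C₁(a)` is an open condition follows without continuity of `C₁`, by evaluating the
level of nearby `a` at the fixed radius `R₁(a)`, since `C₁` is its minimum. -/
theorem mem_interior_Ω_of_neg {a C ω : ℝ} (ha : a < 0) (hC : C₁ a < C) (hω : 0 < ω) :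
    (a, C, ω) ∈ interior Ω := by
  rw [mem_interior_iff_mem_nhds]
  have e1 : ∀ᶠ p : ℝ × ℝ × ℝ in 𝓝 (a, C, ω), p.1 < 0 :=
    (isOpen_lt continuous_fst continuous_const).mem_nhds ha
  have e2 : ∀ᶠ p : ℝ × ℝ × ℝ in 𝓝 (a, C, ω), 0 < p.2.2 :=
    (isOpen_lt continuous_const (by fun_prop)).mem_nhds hω
  have e3 : ∀ᶠ p : ℝ × ℝ × ℝ in 𝓝 (a, C, ω), levelG p.1 (R₁ a) < p.2.1 :=
    (isOpen_lt (by unfold levelG; fun_prop) (by fun_prop)).mem_nhds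
      (show levelG a (R₁ a) < C by rwa [(C₁_eq ha.ne).2])
  filter_upwards [e1, e2, e3] with p h1 h2 h3
  exact ⟨Or.inl ⟨(C₁_le_levelG h1 _).trans_lt h3, h1, h2⟩, fun hp => by linarith [hp.2.2.1]⟩

/-- That `C < C₁(a)` is an open condition follows without continuity of `C₁`, by evaluating the
level of nearby `a` at the fixed radius `R₁(a)`, since `C₁` is its maximum on the negative half
line. -/
theorem mem_interior_Ω_of_pos {a C ω : ℝ} (ha : 0 < a) (hC : C < C₁ a) (hω : 0 < ω)
    (hΩ : ∀ᶠ p in 𝓝 (a, C, ω), p ∉ Ω₂) : (a, C, ω) ∈ interior Ω := by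
  rw [mem_interior_iff_mem_nhds]
  have e1 : ∀ᶠ p : ℝ × ℝ × ℝ in 𝓝 (a, C, ω), 0 < p.1 :=
    (isOpen_lt continuous_const continuous_fst).mem_nhds ha
  have e2 : ∀ᶠ p : ℝ × ℝ × ℝ in 𝓝 (a, C, ω), 0 < p.2.2 :=
    (isOpen_lt continuous_const (by fun_prop)).mem_nhds hω
  have e3 : ∀ᶠ p : ℝ × ℝ × ℝ in 𝓝 (a, C, ω), p.2.1 < levelG p.1 (R₁ a) :=
    (isOpen_lt (by fun_prop) (by unfold levelG; fun_prop)).mem_nhds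
      (show C < levelG a (R₁ a) by rwa [(C₁_eq ha.ne').2])
  filter_upwards [e1, e2, e3, hΩ] with p h1 h2 h3 h4
  exact ⟨Or.inr ⟨h3.trans_le (levelG_le_C₁ h1 (R₁_neg ha).le), h1, h2⟩, h4⟩

/-- Every nonempty level set belongs to one of the regions. -/
theorem mem_regions {a C ω r : ℝ} (ha : a ≠ 0) (hω : 0 < ω) (hr : 0 ≤ (q a C).eval r) :
    (a, C, ω) ∈ interior Ω ∪ Ω₂ ∪ β₁ ∪ β₂ ∪ β₃ ∪ cuspPoints := by
  have hs := Real.sq_sqrt (nonneg_of_q_nonneg hr)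
  have hs0 := Real.sqrt_nonneg r
  rw [← hs, q_eval_sq, levelG_neg] at hr
  -- the level `C` lies between the values at `√r` and `-√r`; this excludes the wrong side of `C₁`
  have hb : levelG a (Real.sqrt r) ≤ C ∧ C ≤ levelG a (Real.sqrt r) + 4 * Real.sqrt r := by
    constructor <;> by_contra hcon <;> nlinarith
  by_cases hC1 : C = C₁ a
  · exact Or.inl (Or.inl (Or.inl (Or.inr ⟨hC1, ha, hω⟩)))
  rcases ha.lt_or_gt with h0 | h0
  · exact Or.inl (Or.inl (Or.inl (Or.inl (Or.inl (mem_interior_Ω_of_neg h0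
      (lt_of_le_of_ne ((C₁_le_levelG h0 _).trans hb.1) (Ne.symm hC1)) hω)))))
  · have hlt : C < C₁ a := by
      refine lt_of_le_of_ne (hb.2.trans ?_) hC1
      rw [← levelG_neg]
      exact levelG_le_C₁ h0 (by linarith)
    have hint := mem_interior_Ω_of_pos h0 hlt hω
    rcases lt_trichotomy a (8 / 27) with h1 | h1 | h1
    · obtain ⟨b1, b2, b3⟩ := R₂_spec h0 h1
      obtain ⟨b4, b5⟩ := R₃_spec h0 h1
      rcases lt_trichotomy C (C₂ a) with h2 | h2 | h2
      · exact Or.inl (Or.inl (Or.inl (Or.inl (Or.inl (hint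
          (eventually_notMem_of_lt b1 b2 b3 (by rwa [← (C₂_eq h0 h1).1])))))))
      · exact Or.inl (Or.inl (Or.inr ⟨h2, h0, h1, hω⟩))
      rcases lt_trichotomy C (C₃ a) with h3 | h3 | h3
      · exact Or.inl (Or.inl (Or.inl (Or.inl (Or.inr ⟨h2, h3, h0, h1, hω⟩))))
      · exact Or.inl (Or.inr ⟨h3, h0, h1, hω⟩)
      · exact Or.inl (Or.inl (Or.inl (Or.inl (Or.inl (hint
          (eventually_notMem_of_gt b4.le b5 (by rwa [← (C₃_eq h0 h1).1])))))))
    · rcases lt_trichotomy C (-(9 / 8)) with h2 | h2 | h2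
      · exact Or.inl (Or.inl (Or.inl (Or.inl (Or.inl (hint (eventually_notMem_of_lt_cusp h2))))))
      · exact Or.inr ⟨h1, h2, hω⟩
      · exact Or.inl (Or.inl (Or.inl (Or.inl (Or.inl (hint
          (eventually_notMem_of_gt le_rfl (h_three_halves.trans h1.symm) (by linarith)))))))
    · refine Or.inl (Or.inl (Or.inl (Or.inl (Or.inl (hint ?_)))))
      have e1 : ∀ᶠ p : ℝ × ℝ × ℝ in 𝓝 (a, C, ω), 8 / 27 < p.1 :=
        (isOpen_lt continuous_const continuous_fst).mem_nhds h1
      filter_upwards [e1] with p h2 hp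
      linarith [hp.2.2.2.1]

/-! ### The drops on a level set -/

variable {a C ω x₁ x₂ : ℝ} {α β : ℝ → E2}

/-- Every point of `{q ≥ 0}` is a squared distance of some drop on the level set. -/
theorem exists_represents_sqDist (ha : a ≠ 0) (ω : ℝ) {r : ℝ} (hr : 0 ≤ (q a C).eval r) :
    ∃ α, Represents a C ω α ∧ sqDist α 0 = r := by
  have hI : ∀ x ∈ ({r} : Set ℝ), 0 ≤ (q a C).eval x := by
    rintro x rfl
    exact hr
  obtain ⟨h1, h2⟩ := (mem_rhoCurve_iff hI (rho a C ω r)).1 (Or.inl ⟨r, rfl, rfl⟩)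
  obtain ⟨α, hα, h0⟩ := exists_represents ha h1
  refine ⟨α, hα, ?_⟩
  rw [← h2, ← h0]
  exact (treadmillSled_norm hα 0).symm

/-- A drop is determined up to congruence by the arc that it covers. -/
theorem congruentProfiles_of_range (ha : a ≠ 0) (hα : Represents a C ω α)
    (hβ : Represents a C ω β) {I : Set ℝ} (hI : ∀ r ∈ I, 0 ≤ (q a C).eval r)
    (hrange : range (treadmillSled α) = rhoCurve a C ω I) {t : ℝ} (ht : sqDist β t ∈ I) :
    CongruentProfiles α β := by
  have : treadmillSled β t ∈ range (treadmillSled α) := by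
    rw [hrange, mem_rhoCurve_iff hI, treadmillSled_norm hβ]
    exact ⟨hβ.2 t, ht⟩
  obtain ⟨s, hs⟩ := this
  exact congruentProfiles_of_treadmillSled_eq ha hα hβ hs

theorem CongruentProfiles.exists_sqDist_eq (h : CongruentProfiles α β) (s : ℝ) :
    ∃ t, sqDist β s = sqDist α t := by
  obtain ⟨δ, s₀, h⟩ := h
  refine ⟨s + s₀, ?_⟩
  have h0 : β s 0 = Real.cos δ * α (s + s₀) 0 - Real.sin δ * α (s + s₀) 1 := by rw [h]; rfl
  have h1 : β s 1 = Real.sin δ * α (s + s₀) 0 + Real.cos δ * α (s + s₀) 1 := by rw [h]; rfl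
  unfold sqDist
  rw [h0, h1]
  linear_combination (α (s + s₀) 0 ^ 2 + α (s + s₀) 1 ^ 2) * Real.cos_sq_add_sin_sq δ

theorem IsCircular.sqDist_eq {R : ℝ} (h : IsCircular ω α R) (s : ℝ) : sqDist α s = R ^ 2 := by
  have h1 : helicoidal ω α (s, 0) ∈ roundCylinder R := h.2 ▸ mem_range_self _
  rw [← helicoidal_sqDist ω α (s, 0)]
  exact h1

/-- The drop over a simple arc. -/
theorem SimpleArc.exists_drop (ha : a ≠ 0) (A : SimpleArc a C x₁ x₂) (ω : ℝ) :
    ∃ α, Represents a C ω α ∧ (∃ s₀ s₁, IsFundamentalPiece a C ω α s₀ s₁) ∧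
      range (treadmillSled α) = rhoCurve a C ω (Icc x₁ x₂) ∧ (∀ s, sqDist α s ∈ Icc x₁ x₂) ∧
      (∀ R, ¬ IsCircular ω α R) ∧
      ∀ β t, Represents a C ω β → sqDist β t ∈ Icc x₁ x₂ → CongruentProfiles α β := by
  obtain ⟨α, hα, h0⟩ := exists_represents_sqDist ha ω A.root₁.ge
  obtain ⟨s₀, T, -, e1, e2, -, hI, hrange, -, hfp⟩ := A.exists_period ha hα (t := 0)
    (by rw [h0]; exact ⟨le_rfl, A.lt.le⟩)
  refine ⟨α, hα, ⟨_, _, hfp⟩, hrange, hI, fun R hR => ?_, fun β t hβ ht =>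
    congruentProfiles_of_range ha hα hβ (fun r hr => A.nonneg hr) hrange ht⟩
  have h1 := hR.sqDist_eq s₀
  have h2 := hR.sqDist_eq (s₀ + T)
  linarith [A.lt]

/-- The round cylinder over a critical radius. -/
theorem exists_cylinder {R : ℝ} (hR : R ≠ 0) (ha : h R ≠ 0) (ω : ℝ) :
    ∃ κ, Represents (h R) (R * (R - 3) / 2) ω κ ∧ IsCircular ω κ |R| ∧
      ∀ β t, Represents (h R) (R * (R - 3) / 2) ω β → sqDist β t = R ^ 2 →
        CongruentProfiles κ β := by
  have e := levelG_h hR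
  have h1 : (q (h R) (R * (R - 3) / 2)).eval (R ^ 2) = 0 := q_root_iff.2 ⟨R, rfl, e⟩
  have h2 : (q (h R) (R * (R - 3) / 2)).derivative.eval (R ^ 2) = 0 := by
    rw [q_derivative_eval_sq e, (h_eq_iff hR).1 rfl, mul_zero]
  obtain ⟨κ, hκ, h0⟩ := exists_represents_sqDist ha ω h1.ge
  have hc := sqDist_eq_const ha h1 h2 hκ h0
  refine ⟨κ, hκ, ?_, fun β t hβ ht => ?_⟩
  · rw [← Real.sqrt_sq_eq_abs]
    exact (hκ.isCircular (by positivity) h1 fun s => (hc s).1).1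
  · have hc' := sqDist_eq_const ha h1 h2 hβ ht
    exact congruentProfiles_of_treadmillSled_eq ha hκ hβ (s := 0) (t := t)
      ((hκ.treadmillSled_eq_iff hβ).2
        ⟨(hc 0).1.trans (hc' t).1.symm, (hc 0).2.trans (hc' t).2.symm⟩)

/-- The drop over an arc that ends in a multiple root on the right. -/
theorem exists_exceptional_left (ha : a ≠ 0) (h0 : 0 < x₂) (h12 : x₁ < x₂)
    (h1 : (q a C).eval x₁ = 0) (h2 : (q a C).eval x₂ = 0)
    (hpos : ∀ r ∈ Ioo x₁ x₂, 0 < (q a C).eval r)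
    (d1 : 0 < (q a C).derivative.eval x₁) (d2 : (q a C).derivative.eval x₂ = 0) (ω : ℝ) :
    ∃ α, Represents a C ω α ∧ range (treadmillSled α) = rhoCurve a C ω (Ico x₁ x₂) ∧
      SpiralsTo α (Real.sqrt x₂) ∧ ¬ ProperlyImmersed (helicoidal ω α) ∧
      (∀ s, sqDist α s ∈ Ico x₁ x₂) ∧
      ∀ β t, Represents a C ω β → sqDist β t ∈ Ico x₁ x₂ → CongruentProfiles α β := by
  obtain ⟨α, hα, h00⟩ := exists_represents_sqDist ha ω h1.ge
  obtain ⟨htop, hbot, hI, hrange⟩ := homoclinic_left ha h12 h1 h2 hpos d1 d2 hα (t := 0)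
    (by rw [h00]; exact ⟨le_rfl, h12⟩)
  have hne : ∀ s, sqDist α s ≠ x₂ := fun s => (hI s).2.ne
  refine ⟨α, hα, hrange, hα.spiralsTo h0 h2 htop hbot hne,
    hα.not_properlyImmersed_of_tendsto ha htop hne, hI, fun β t hβ ht =>
    congruentProfiles_of_range ha hα hβ (fun r hr => ?_) hrange ht⟩
  rcases hr.1.eq_or_lt with h | h
  · rw [← h, h1]
  · exact (hpos r ⟨h, hr.2⟩).le

/-- The drop over an arc that ends in a multiple root on the left. -/
theorem exists_exceptional_right (ha : a ≠ 0) (h0 : 0 < x₁) (h12 : x₁ < x₂)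
    (h1 : (q a C).eval x₁ = 0) (h2 : (q a C).eval x₂ = 0)
    (hpos : ∀ r ∈ Ioo x₁ x₂, 0 < (q a C).eval r)
    (d1 : (q a C).derivative.eval x₁ = 0) (d2 : (q a C).derivative.eval x₂ < 0) (ω : ℝ) :
    ∃ α, Represents a C ω α ∧ range (treadmillSled α) = rhoCurve a C ω (Ioc x₁ x₂) ∧
      SpiralsTo α (Real.sqrt x₁) ∧ ¬ ProperlyImmersed (helicoidal ω α) ∧
      (∀ s, sqDist α s ∈ Ioc x₁ x₂) ∧
      ∀ β t, Represents a C ω β → sqDist β t ∈ Ioc x₁ x₂ → CongruentProfiles α β := by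
  obtain ⟨α, hα, h00⟩ := exists_represents_sqDist ha ω h2.ge
  obtain ⟨htop, hbot, hI, hrange⟩ := homoclinic_right ha h12 h1 h2 hpos d1 d2 hα (t := 0)
    (by rw [h00]; exact ⟨h12, le_rfl⟩)
  have hne : ∀ s, sqDist α s ≠ x₁ := fun s => (hI s).1.ne'
  refine ⟨α, hα, hrange, hα.spiralsTo h0 h1 htop hbot hne,
    hα.not_properlyImmersed_of_tendsto ha htop hne, hI, fun β t hβ ht =>
    congruentProfiles_of_range ha hα hβ (fun r hr => ?_) hrange ht⟩
  rcases hr.2.eq_or_lt with h | h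
  · rw [h, h2]
  · exact (hpos r ⟨hr.1, h⟩).le

/-! ### The classification by regions -/

/-- Two simple roots: one periodic drop. -/
theorem classification_interior (hp : (a, C, ω) ∈ interior Ω) :
    ∃ x₁ x₂ : ℝ, x₁ < x₂ ∧ (∀ r, (q a C).IsRoot r ↔ r = x₁ ∨ r = x₂) ∧
      ∃ α : ℝ → E2, Represents a C ω α ∧ (∃ s₀ s₁, IsFundamentalPiece a C ω α s₀ s₁) ∧
        range (treadmillSled α) = rhoCurve a C ω (Icc x₁ x₂) ∧
        ∀ β, Represents a C ω β → CongruentProfiles α β := by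
  obtain ⟨ha, hs⟩ := twoSimple_of_mem_interior hp
  obtain ⟨x₁, x₂, h12, hroot, A, hq⟩ := hs.exists_arc ha
  obtain ⟨α, hα, hfp, hrange, -, -, huniq⟩ := A.exists_drop ha ω
  exact ⟨x₁, x₂, h12, hroot, α, hα, hfp, hrange, fun β hβ =>
    huniq β 0 hβ (hq _ (hβ.q_nonneg 0))⟩

/-- Four simple roots: two periodic drops, over disjoint arcs. -/
theorem classification_Ω₂ (hp : (a, C, ω) ∈ Ω₂) :
    ∃ x₁ x₂ x₃ x₄ : ℝ, x₁ < x₂ ∧ x₂ < x₃ ∧ x₃ < x₄ ∧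
      (∀ r, (q a C).IsRoot r ↔ r = x₁ ∨ r = x₂ ∨ r = x₃ ∨ r = x₄) ∧
      ∃ α α' : ℝ → E2, Represents a C ω α ∧ Represents a C ω α' ∧ ¬ CongruentProfiles α α' ∧
        (∃ s₀ s₁, IsFundamentalPiece a C ω α s₀ s₁) ∧
        (∃ s₀ s₁, IsFundamentalPiece a C ω α' s₀ s₁) ∧
        range (treadmillSled α) = rhoCurve a C ω (Icc x₁ x₂) ∧
        range (treadmillSled α') = rhoCurve a C ω (Icc x₃ x₄) ∧
        ∀ β, Represents a C ω β → CongruentProfiles α β ∨ CongruentProfiles α' β := by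
  obtain ⟨h2, h3, h0, h1, -⟩ := hp
  obtain ⟨x₁, x₂, x₃, x₄, h12, h23, h34, hroot, A, A', hq⟩ := exists_two_arcs h0 h1 h2 h3
  obtain ⟨α, hα, hfp, hrange, hI, -, huniq⟩ := A.exists_drop h0.ne' ω
  obtain ⟨α', hα', hfp', hrange', hI', -, huniq'⟩ := A'.exists_drop h0.ne' ω
  refine ⟨x₁, x₂, x₃, x₄, h12, h23, h34, hroot, α, α', hα, hα', fun hc => ?_, hfp, hfp', hrange,
    hrange', fun β hβ => ?_⟩
  · obtain ⟨t, ht⟩ := hc.exists_sqDist_eq 0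
    linarith [(hI' 0).1, (hI t).2]
  · exact (hq _ (hβ.q_nonneg 0)).imp (huniq β 0 hβ) (huniq' β 0 hβ)

/-- The level set is a single point, and the only drop is a round cylinder. -/
theorem classification_β₁ (hp : (a, C, ω) ∈ β₁) :
    ∃ α : ℝ → E2, Represents a C ω α ∧ IsCircular ω α |R₁ a| ∧
      ∀ β, Represents a C ω β → CongruentProfiles α β := by
  obtain ⟨hC, ha, -⟩ := hp
  have hC : C = C₁ a := hC
  have ha : a ≠ 0 := ha
  obtain ⟨hR, hR1, hh⟩ := R₁_spec ha
  have hC' := hC.trans (C₁_eq ha).1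
  obtain ⟨κ, hκ, hcirc, huniq⟩ := exists_cylinder hR (by rwa [hh]) ω
  rw [hh, ← hC'] at hκ huniq
  refine ⟨κ, hκ, hcirc, fun β hβ => huniq β 0 hβ ?_⟩
  by_contra hne
  have h1 := q_neg_of_lt_one hR hR1 hne
  rw [hh, ← hC'] at h1
  linarith [hβ.q_nonneg 0]

/-- The double root is isolated in `{q ≥ 0}`: it carries a round cylinder, and the arc of simple
roots a periodic drop. -/
theorem classification_β₂ (hp : (a, C, ω) ∈ β₂) :
    ∃ x₁ x₂ x₃ : ℝ, x₁ < x₂ ∧ x₂ < x₃ ∧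
      (∀ r, (q a C).IsRoot r ↔ r = x₁ ∨ r = x₂ ∨ r = x₃) ∧
      (q a C).rootMultiplicity x₁ = 2 ∧ x₁ = R₂ a ^ 2 ∧
      ∃ κ α : ℝ → E2, Represents a C ω κ ∧ Represents a C ω α ∧
        IsCircular ω κ (R₂ a) ∧ (∀ R, ¬ IsCircular ω α R) ∧
        (∃ s₀ s₁, IsFundamentalPiece a C ω α s₀ s₁) ∧
        range (treadmillSled α) = rhoCurve a C ω (Icc x₂ x₃) ∧
        ∀ β, Represents a C ω β → CongruentProfiles κ β ∨ CongruentProfiles α β := by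
  obtain ⟨hC, h0, h1, -⟩ := hp
  have h0 : 0 < a := h0
  have hC' := (show C = C₂ a from hC).trans (C₂_eq h0 h1).1
  obtain ⟨b1, b2, hh⟩ := R₂_spec h0 h1
  set R := R₂ a
  have hR : R ≠ 0 := by linarith
  obtain ⟨y, z, hyz, hlt, -, hfac⟩ := exists_factor_of_one_lt b1
  have hmult := rootMultiplicity_critical hR b2.ne
  obtain ⟨κ, hκ, hcirc, huniq⟩ := exists_cylinder hR (by rw [hh]; exact h0.ne') ω
  rw [abs_of_pos (by linarith)] at hcirc
  rw [hh, ← hC'] at hfac hmult hκ huniq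
  have hxy := hlt b2
  have hd := q_derivative_of_factor hfac
  have ha2 : 0 < a ^ 2 := by positivity
  have hroot : ∀ r, (q a C).IsRoot r ↔ r = R ^ 2 ∨ r = y ∨ r = z := fun r => by
    rw [q_isRoot_iff, hfac]
    constructor
    · intro e
      rcases mul_eq_zero.1 e with e | e
      · rcases mul_eq_zero.1 e with e | e
        · rcases mul_eq_zero.1 e with e | e
          · linarith
          · exact Or.inl (sub_eq_zero.1 (pow_eq_zero_iff two_ne_zero |>.1 e))
        · exact Or.inr (Or.inl (sub_eq_zero.1 e))
      · exact Or.inr (Or.inr (sub_eq_zero.1 e))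
    · rintro (rfl | rfl | rfl) <;> ring
  have A : SimpleArc a C y z := by
    refine ⟨hyz, (hroot y).2 (Or.inr (Or.inl rfl)), (hroot z).2 (Or.inr (Or.inr rfl)),
      fun r hr => ?_, ?_, ?_⟩
    · rw [hfac]
      have e : 0 < a ^ 2 * (r - R ^ 2) ^ 2 * ((r - y) * (z - r)) :=
        mul_pos (mul_pos ha2 (pow_pos (by linarith [hr.1]) 2))
          (mul_pos (by linarith [hr.1]) (by linarith [hr.2]))
      linarith
    · rw [hd]
      have e : 0 < a ^ 2 * (y - R ^ 2) ^ 2 * (z - y) :=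
        mul_pos (mul_pos ha2 (pow_pos (by linarith) 2)) (by linarith)
      linarith
    · rw [hd]
      have e : 0 < a ^ 2 * (z - R ^ 2) ^ 2 * (z - y) :=
        mul_pos (mul_pos ha2 (pow_pos (by linarith) 2)) (by linarith)
      linarith
  obtain ⟨α, hα, hfp, hrange, -, hnc, huniq'⟩ := A.exists_drop h0.ne' ω
  refine ⟨R ^ 2, y, z, hxy, hyz, hroot, hmult, rfl, κ, α, hκ, hα, hcirc, hnc, hfp, hrange,
    fun β hβ => ?_⟩
  by_cases hβ0 : sqDist β 0 = R ^ 2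
  · exact Or.inl (huniq β 0 hβ hβ0)
  · refine Or.inr (huniq' β 0 hβ ?_)
    have h2 := hβ.q_nonneg 0
    rw [hfac] at h2
    have h3 : 0 < (sqDist β 0 - R ^ 2) ^ 2 := by
      have := sub_ne_zero.2 hβ0
      positivity
    have h4 : 0 < a ^ 2 * (sqDist β 0 - R ^ 2) ^ 2 := mul_pos ha2 h3
    constructor <;> by_contra hcon <;> rw [not_le] at hcon
    · nlinarith [mul_pos h4 (mul_pos (show 0 < y - sqDist β 0 by linarith)
        (show 0 < z - sqDist β 0 by linarith))]
    · nlinarith [mul_pos h4 (mul_pos (show 0 < sqDist β 0 - y by linarith)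
        (show 0 < sqDist β 0 - z by linarith))]

/-- The double root separates two arcs of `{q > 0}`: it carries a round cylinder, and the arcs carry
drops that are asymptotic to it. -/
theorem classification_β₃ (hp : (a, C, ω) ∈ β₃) :
    ∃ x₁ x₂ x₃ : ℝ, x₁ < x₂ ∧ x₂ < x₃ ∧
      (∀ r, (q a C).IsRoot r ↔ r = x₁ ∨ r = x₂ ∨ r = x₃) ∧
      (q a C).rootMultiplicity x₂ = 2 ∧ x₂ = R₃ a ^ 2 ∧
      ∃ κ α α' : ℝ → E2,
        Represents a C ω κ ∧ Represents a C ω α ∧ Represents a C ω α' ∧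
        ¬ CongruentProfiles α α' ∧
        IsCircular ω κ (R₃ a) ∧
        range (treadmillSled α) = rhoCurve a C ω (Ico x₁ x₂) ∧
        range (treadmillSled α') = rhoCurve a C ω (Ioc x₂ x₃) ∧
        SpiralsTo α (R₃ a) ∧ SpiralsTo α' (R₃ a) ∧
        ¬ ProperlyImmersed (helicoidal ω α) ∧ ¬ ProperlyImmersed (helicoidal ω α') ∧
        ∀ β, Represents a C ω β →
          CongruentProfiles κ β ∨ CongruentProfiles α β ∨ CongruentProfiles α' β := by
  obtain ⟨hC, h0, h1, -⟩ := hp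
  have h0 : 0 < a := h0
  have hC' := (show C = C₃ a from hC).trans (C₃_eq h0 h1).1
  obtain ⟨b2, hh⟩ := R₃_spec h0 h1
  set R := R₃ a
  have hR0 : 0 < R := by linarith
  have hR : R ≠ 0 := hR0.ne'
  obtain ⟨y, z, hyz, -, hlt, hfac⟩ := exists_factor_of_one_lt (show 1 < R by linarith)
  have hmult := rootMultiplicity_critical hR b2.ne'
  obtain ⟨κ, hκ, hcirc, huniq⟩ := exists_cylinder hR (by rw [hh]; exact h0.ne') ω
  rw [abs_of_pos hR0] at hcirc
  rw [hh, ← hC'] at hfac hmult hκ huniq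
  obtain ⟨hyx, hxz⟩ := hlt b2
  have hd := q_derivative_of_factor hfac
  have ha2 : 0 < a ^ 2 := by positivity
  have hroot : ∀ r, (q a C).IsRoot r ↔ r = y ∨ r = R ^ 2 ∨ r = z := fun r => by
    rw [q_isRoot_iff, hfac]
    constructor
    · intro e
      rcases mul_eq_zero.1 e with e | e
      · rcases mul_eq_zero.1 e with e | e
        · rcases mul_eq_zero.1 e with e | e
          · linarith
          · exact Or.inr (Or.inl (sub_eq_zero.1 (pow_eq_zero_iff two_ne_zero |>.1 e)))
        · exact Or.inl (sub_eq_zero.1 e)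
      · exact Or.inr (Or.inr (sub_eq_zero.1 e))
    · rintro (rfl | rfl | rfl) <;> ring
  have hpos : ∀ r ∈ Ioo y z, r ≠ R ^ 2 → 0 < (q a C).eval r := fun r hr hne => by
    rw [hfac]
    have e : 0 < a ^ 2 * (r - R ^ 2) ^ 2 * ((r - y) * (z - r)) :=
      mul_pos (mul_pos ha2 (sq_pos_iff.2 (sub_ne_zero.2 hne)))
        (mul_pos (by linarith [hr.1]) (by linarith [hr.2]))
    linarith
  have dx : (q a C).derivative.eval (R ^ 2) = 0 := by rw [hd]; ring
  have dy : 0 < (q a C).derivative.eval y := by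
    rw [hd]
    have e : 0 < a ^ 2 * (y - R ^ 2) ^ 2 * (z - y) :=
      mul_pos (mul_pos ha2 (sq_pos_iff.2 (sub_ne_zero.2 hyx.ne))) (by linarith)
    linarith
  have dz : (q a C).derivative.eval z < 0 := by
    rw [hd]
    have e : 0 < a ^ 2 * (z - R ^ 2) ^ 2 * (z - y) :=
      mul_pos (mul_pos ha2 (sq_pos_iff.2 (sub_ne_zero.2 hxz.ne'))) (by linarith)
    linarith
  have ry := (hroot y).2 (Or.inl rfl)
  have rx := (hroot (R ^ 2)).2 (Or.inr (Or.inl rfl))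
  have rz := (hroot z).2 (Or.inr (Or.inr rfl))
  have hx0 : 0 < R ^ 2 := by positivity
  obtain ⟨α, hα, hrange, hsp, hnp, hI, hu⟩ := exists_exceptional_left h0.ne' hx0 hyx ry rx
    (fun r hr => hpos r ⟨hr.1, hr.2.trans hxz⟩ hr.2.ne) dy dx ω
  obtain ⟨α', hα', hrange', hsp', hnp', hI', hu'⟩ := exists_exceptional_right h0.ne' hx0 hxz rx rz
    (fun r hr => hpos r ⟨hyx.trans hr.1, hr.2⟩ hr.1.ne') dx dz ω
  rw [Real.sqrt_sq hR0.le] at hsp hsp'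
  refine ⟨y, R ^ 2, z, hyx, hxz, hroot, hmult, rfl, κ, α, α', hκ, hα, hα', fun hc => ?_, hcirc,
    hrange, hrange', hsp, hsp', hnp, hnp', fun β hβ => ?_⟩
  · obtain ⟨t, ht⟩ := hc.exists_sqDist_eq 0
    linarith [(hI' 0).1, (hI t).2]
  by_cases hβ0 : sqDist β 0 = R ^ 2
  · exact Or.inl (huniq β 0 hβ hβ0)
  · have h2 := hβ.q_nonneg 0
    rw [hfac] at h2
    have h4 : 0 < a ^ 2 * (sqDist β 0 - R ^ 2) ^ 2 :=
      mul_pos ha2 (sq_pos_iff.2 (sub_ne_zero.2 hβ0))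
    have hl : y ≤ sqDist β 0 := by
      by_contra hcon
      rw [not_le] at hcon
      nlinarith [mul_pos h4 (mul_pos (show 0 < y - sqDist β 0 by linarith)
        (show 0 < z - sqDist β 0 by linarith))]
    have hr : sqDist β 0 ≤ z := by
      by_contra hcon
      rw [not_le] at hcon
      nlinarith [mul_pos h4 (mul_pos (show 0 < sqDist β 0 - y by linarith)
        (show 0 < sqDist β 0 - z by linarith))]
    rcases lt_or_gt_of_ne hβ0 with h | h
    · exact Or.inr (Or.inl (hu β 0 hβ ⟨hl, h⟩))
    · exact Or.inr (Or.inr (hu' β 0 hβ ⟨h, hr⟩))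

/-- The triple root carries a round cylinder, and the only arc a drop that is asymptotic to it. -/
theorem classification_cusp (hp : (a, C, ω) ∈ cuspPoints) :
    (∀ r, (q a C).IsRoot r ↔ r = 9 / 4 ∨ r = 81 / 4) ∧
      (q a C).rootMultiplicity (9 / 4) = 3 ∧
      ∃ κ α : ℝ → E2, Represents a C ω κ ∧ Represents a C ω α ∧
        IsCircular ω κ (3 / 2) ∧
        range (treadmillSled α) = rhoCurve a C ω (Ioc (9 / 4) (81 / 4)) ∧
        SpiralsTo α (3 / 2) ∧ ¬ ProperlyImmersed (helicoidal ω α) ∧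
        ∀ β, Represents a C ω β → CongruentProfiles κ β ∨ CongruentProfiles α β := by
  obtain ⟨ha, hC, -⟩ := hp
  have ha : a = 8 / 27 := ha
  have hC : C = -(9 / 8) := hC
  subst ha hC
  have hd := q_derivative_of_factor q_eval_cusp
  have hroot : ∀ r, (q (8 / 27) (-(9 / 8))).IsRoot r ↔ r = 9 / 4 ∨ r = 81 / 4 := fun r => by
    rw [q_isRoot_iff, q_eval_cusp]
    constructor
    · intro e
      rcases mul_eq_zero.1 e with e | e
      · rcases mul_eq_zero.1 e with e | e
        · rcases mul_eq_zero.1 e with e | e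
          · norm_num at e
          · exact Or.inl (sub_eq_zero.1 (pow_eq_zero_iff two_ne_zero |>.1 e))
        · exact Or.inl (sub_eq_zero.1 e)
      · exact Or.inr (sub_eq_zero.1 e)
    · rintro (rfl | rfl) <;> ring
  obtain ⟨κ, hκ, hcirc, huniq⟩ := exists_cylinder (R := 3 / 2) (by norm_num)
    (by rw [h_three_halves]; norm_num) ω
  rw [abs_of_pos (by norm_num)] at hcirc
  rw [h_three_halves, show (3 / 2 : ℝ) * (3 / 2 - 3) / 2 = -(9 / 8) by norm_num] at hκ huniq
  obtain ⟨α, hα, hrange, hsp, hnp, hI, hu⟩ := exists_exceptional_right (a := 8 / 27)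
    (C := -(9 / 8)) (x₁ := 9 / 4) (x₂ := 81 / 4) (by norm_num) (by norm_num) (by norm_num)
    ((hroot _).2 (Or.inl rfl)) ((hroot _).2 (Or.inr rfl)) (fun r hr => by
      rw [q_eval_cusp]
      nlinarith [mul_pos (pow_pos (show 0 < r - 9 / 4 by linarith [hr.1]) 3)
        (show 0 < 81 / 4 - r by linarith [hr.2])])
    (by rw [hd]; ring) (by rw [hd]; norm_num) ω
  rw [show (9 / 4 : ℝ) = (3 / 2) ^ 2 by norm_num, Real.sqrt_sq (by norm_num)] at hsp
  refine ⟨hroot, rootMultiplicity_cusp, κ, α, hκ, hα, hcirc, hrange, hsp, hnp, fun β hβ => ?_⟩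
  by_cases hβ0 : sqDist β 0 = 9 / 4
  · exact Or.inl (huniq β 0 hβ (by rw [hβ0]; norm_num))
  · refine Or.inr (hu β 0 hβ ?_)
    have h2 := hβ.q_nonneg 0
    rw [q_eval_cusp] at h2
    have h3 : 0 < (sqDist β 0 - 9 / 4) ^ 2 := sq_pos_iff.2 (sub_ne_zero.2 hβ0)
    constructor
    · by_contra hcon
      have hcon' := lt_of_le_of_ne (not_lt.1 hcon) hβ0
      nlinarith [mul_pos h3 (mul_pos (show 0 < 9 / 4 - sqDist β 0 by linarith)
        (show 0 < 81 / 4 - sqDist β 0 by linarith))]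
    · by_contra hcon
      rw [not_le] at hcon
      nlinarith [mul_pos h3 (mul_pos (show 0 < sqDist β 0 - 9 / 4 by linarith)
        (show 0 < sqDist β 0 - 81 / 4 by linarith))]

/-! ### Every drop is represented -/

/-- Reflection of space in the horizontal plane. -/
def reflectZ : E3 ≃ᵢ E3 where
  toFun v := !₂[v 0, v 1, -v 2]
  invFun v := !₂[v 0, v 1, -v 2]
  left_inv v := by ext i; fin_cases i <;> simp
  right_inv v := by ext i; fin_cases i <;> simp
  isometry_toFun := by
    refine Isometry.of_dist_eq fun v w => ?_
    rw [EuclideanSpace.dist_eq, EuclideanSpace.dist_eq]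
    congr 1
    simp only [Fin.sum_univ_three]
    change dist (v 0) (w 0) ^ 2 + dist (v 1) (w 1) ^ 2 + dist (-v 2) (-w 2) ^ 2 = _
    rw [dist_neg_neg]

/-- Reflection in a horizontal plane reverses the sign of `ω`. -/
theorem congruentImmersions_neg (ω : ℝ) (α : ℝ → E2) :
    CongruentImmersions (helicoidal ω α) (helicoidal (-ω) α) := by
  refine ⟨reflectZ, (Homeomorph.refl ℝ).prodCongr (Homeomorph.neg ℝ), fun p => ?_⟩
  ext i
  fin_cases i
  · change helicoidal ω α p 0 = helicoidal (-ω) α (p.1, -p.2) 0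
    rw [helicoidal_zero, helicoidal_zero, neg_mul_neg]
  · change helicoidal ω α p 1 = helicoidal (-ω) α (p.1, -p.2) 1
    rw [helicoidal_one, helicoidal_one, neg_mul_neg]
  · change p.2 = -(-p.2)
    rw [neg_neg]

theorem CongruentImmersions.refl (X : ℝ × ℝ → E3) : CongruentImmersions X X :=
  ⟨IsometryEquiv.refl _, Homeomorph.refl _, fun _ => rfl⟩

/-- Up to a reflection `ω > 0`, and the level set of a drop is not empty, so that its parameters
belong to one of the regions. -/
theorem IsDrop.exists_region (ha : a ≠ 0) (hω : ω ≠ 0) (hα : IsDrop 1 a ω α) :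
    ∃ (C ω' : ℝ) (α' : ℝ → E2),
      (a, C, ω') ∈ interior Ω ∪ Ω₂ ∪ β₁ ∪ β₂ ∪ β₃ ∪ cuspPoints ∧
      Represents a C ω' α' ∧ CongruentImmersions (helicoidal ω α) (helicoidal ω' α') := by
  rcases hω.lt_or_gt with h | h
  · obtain ⟨C, hC⟩ := hα.neg.exists_represents
    exact ⟨C, -ω, α, mem_regions ha (neg_pos.2 h) (hC.q_nonneg 0), hC,
      congruentImmersions_neg ω α⟩
  · obtain ⟨C, hC⟩ := hα.exists_represents
    exact ⟨C, ω, α, mem_regions ha h (hC.q_nonneg 0), hC, CongruentImmersions.refl _⟩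

/-! ### Closed and dense drops -/

/-- A drop that is not exceptional is a round cylinder or covers a simple arc. -/
theorem Represents.circular_or_simpleArc (ha : a ≠ 0) (hα : Represents a C ω α)
    (hne : ¬ IsExceptional α) :
    (∃ R, IsCircular ω α R ∧ ProperlyImmersed (helicoidal ω α)) ∨
      ∃ x₁ x₂, SimpleArc a C x₁ x₂ ∧ sqDist α 0 ∈ Icc x₁ x₂ := by
  have hq := hα.q_nonneg 0
  have hpos : ∀ {x}, (q a C).eval x = 0 → (q a C).derivative.eval x = 0 → 0 < x := by
    intro x hx hd
    obtain ⟨R, hR, rfl, -, -⟩ := exists_radius_of_multiple_root hx hd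
    positivity
  by_cases hm : (q a C).eval (sqDist α 0) = 0 ∧ (q a C).derivative.eval (sqDist α 0) = 0
  · exact Or.inl ⟨_, hα.isCircular (hpos hm.1 hm.2) hm.1 fun s =>
      (sqDist_eq_const ha hm.1 hm.2 hα rfl s).1⟩
  -- An end of the arc is a simple root, or else a multiple one and the drop spirals; since `q` has
  -- at most one multiple root, the other end is simple in that case.
  obtain ⟨x₁, x₂, h12, hr, e1, e2, hp⟩ := exists_arc ha hq hm
  have d1 := derivative_nonneg_of_pos h12 e1 hp
  have d2 := derivative_nonpos_of_pos h12 e2 hp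
  by_cases z1 : (q a C).derivative.eval x₁ = 0
  · have z2 : (q a C).derivative.eval x₂ ≠ 0 := fun z2 =>
      h12.ne (multiple_root_unique ha e2 z2 e1 z1)
    have hr' : sqDist α 0 ∈ Ioc x₁ x₂ :=
      ⟨lt_of_le_of_ne hr.1 fun h => hm (by rw [← h]; exact ⟨e1, z1⟩), hr.2⟩
    obtain ⟨htop, hbot, hI, -⟩ := homoclinic_right ha h12 e1 e2 hp z1 (lt_of_le_of_ne d2 z2) hα hr'
    have h0 := hpos e1 z1
    exact absurd ⟨_, Real.sqrt_pos.2 h0, hα.spiralsTo h0 e1 htop hbot fun s => (hI s).1.ne'⟩ hne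
  by_cases z2 : (q a C).derivative.eval x₂ = 0
  · have hr' : sqDist α 0 ∈ Ico x₁ x₂ :=
      ⟨hr.1, lt_of_le_of_ne hr.2 fun h => hm (by rw [h]; exact ⟨e2, z2⟩)⟩
    obtain ⟨htop, hbot, hI, -⟩ := homoclinic_left ha h12 e1 e2 hp
      (lt_of_le_of_ne d1 (Ne.symm z1)) z2 hα hr'
    have h0 := hpos e2 z2
    exact absurd ⟨_, Real.sqrt_pos.2 h0, hα.spiralsTo h0 e2 htop hbot fun s => (hI s).2.ne⟩ hne
  exact Or.inr ⟨x₁, x₂, ⟨h12, e1, e2, hp, lt_of_le_of_ne d1 (Ne.symm z1), lt_of_le_of_ne d2 z2⟩, hr⟩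

/-- The alternative between closed and dense drops. -/
theorem SimpleArc.closed_or_dense (ha : a ≠ 0) (A : SimpleArc a C x₁ x₂)
    (hα : Represents a C ω α) {t : ℝ} (ht : sqDist α t ∈ Icc x₁ x₂) :
    range (treadmillSled α) = rhoCurve a C ω (Icc x₁ x₂) ∧
    IntervalIntegrable (deltaIntegrand a C ω) MeasureTheory.volume x₁ x₂ ∧
    ∃ δ : ℝ,
      δ = (if x₁ = 0 then deltaTheta a C ω x₁ x₂ + Real.pi else deltaTheta a C ω x₁ x₂) ∧
      (∃ s₀ s₁, IsFundamentalPiece a C ω α s₀ s₁ ∧ ∀ s, α (s + (s₁ - s₀)) = rot δ (α s)) ∧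
      ((∃ p : ℚ, deltaTheta a C ω x₁ x₂ / Real.pi = p) →
        ProperlyImmersed (helicoidal ω α) ∧
        ∃ (m : ℕ) (k : ℤ), 0 < m ∧ IsCoprime k (m : ℤ) ∧ δ = 2 * Real.pi * k / m ∧
          rotZ (2 * Real.pi / m) '' surface ω α = surface ω α) ∧
      (Irrational (deltaTheta a C ω x₁ x₂ / Real.pi) →
        ¬ ProperlyImmersed (helicoidal ω α) ∧
        closure (surface ω α) = {p : E3 | x₁ ≤ p 0 ^ 2 + p 1 ^ 2 ∧
          p 0 ^ 2 + p 1 ^ 2 ≤ x₂}) := by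
  obtain ⟨s₀, T, hT, h0, h1, hv, hI, hrange, hper, hfp⟩ := A.exists_period ha hα ht
  have hmono := A.monodromy ha hα hT h0 h1 hv hI hper hfp
  set Δ := deltaTheta a C ω x₁ x₂
  have hpi := Real.pi_pos
  -- adding a half turn does not affect the rationality of the angle in units of `π`
  obtain ⟨n, hn⟩ : ∃ n : ℤ, (if x₁ = 0 then Δ + Real.pi else Δ) = Δ + n * Real.pi := by
    split_ifs
    · exact ⟨1, by push_cast; ring⟩
    · exact ⟨0, by push_cast; ring⟩
  set δ := if x₁ = 0 then Δ + Real.pi else Δ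
  have hδ : δ / (2 * Real.pi) = (Δ / Real.pi + n) / 2 := by
    rw [hn]
    field_simp
  refine ⟨hrange, (hα.deltaTheta_eq hT h0 h1 hv).1, δ, rfl, ⟨s₀, s₀ + 2 * T, hfp, ?_⟩, ?_, ?_⟩
  · rwa [add_sub_cancel_left]
  · rintro ⟨p, hp⟩
    refine properlyImmersed_of_rational hα.continuous (show 0 < 2 * T by linarith) hmono
      (p := (p + n) / 2) ?_
    rw [hδ, hp]
    push_cast
    ring
  · intro hirr
    have hirr' : Irrational (δ / (2 * Real.pi)) := by
      rintro ⟨p, hp⟩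
      refine hirr ⟨2 * p - n, ?_⟩
      rw [hδ] at hp
      push_cast
      linarith
    have hx2 : 0 < x₂ := (nonneg_of_q_nonneg A.root₁.ge).trans_lt A.lt
    refine ⟨not_properlyImmersed ω (hα.norm_le ha) fun σ hσ => ?_,
      closure_surface_of_irrational hmono hirr' ?_⟩
    · refine hfp.eq_zero_of_periodic hmono hper hirr' (x := s₀ + T) ?_ hσ
      rw [← norm_pos_iff, norm_eq_sqrt_sqDist, h1]
      exact Real.sqrt_pos.2 hx2
    · apply Subset.antisymm
      · rintro _ ⟨s, rfl⟩
        exact hI s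
      · rw [← h0, ← h1]
        exact intermediate_value_univ _ _ hα.isNewton.continuous_pos

end HelicoidalDrop

end

theorem mainTheorem2 :
    -- (i)
    (∀ a C ω : ℝ, (a, C, ω) ∈ interior Ω →
      ∃ x₁ x₂ : ℝ, x₁ < x₂ ∧ (∀ r, (q a C).IsRoot r ↔ r = x₁ ∨ r = x₂) ∧
      ∃ α : ℝ → E2, Represents a C ω α ∧ (∃ s₀ s₁, IsFundamentalPiece a C ω α s₀ s₁) ∧
        Set.range (treadmillSled α) = rhoCurve a C ω (Set.Icc x₁ x₂) ∧
        ∀ β, Represents a C ω β → CongruentProfiles α β) ∧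
    -- (ii)
    (∀ a C ω : ℝ, (a, C, ω) ∈ Ω₂ →
      ∃ x₁ x₂ x₃ x₄ : ℝ, x₁ < x₂ ∧ x₂ < x₃ ∧ x₃ < x₄ ∧
        (∀ r, (q a C).IsRoot r ↔ r = x₁ ∨ r = x₂ ∨ r = x₃ ∨ r = x₄) ∧
      ∃ α α' : ℝ → E2, Represents a C ω α ∧ Represents a C ω α' ∧ ¬ CongruentProfiles α α' ∧
        (∃ s₀ s₁, IsFundamentalPiece a C ω α s₀ s₁) ∧
        (∃ s₀ s₁, IsFundamentalPiece a C ω α' s₀ s₁) ∧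
        Set.range (treadmillSled α) = rhoCurve a C ω (Set.Icc x₁ x₂) ∧
        Set.range (treadmillSled α') = rhoCurve a C ω (Set.Icc x₃ x₄) ∧
        ∀ β, Represents a C ω β → CongruentProfiles α β ∨ CongruentProfiles α' β) ∧
    -- (iii)
    (∀ a C ω : ℝ, (a, C, ω) ∈ β₁ →
      ∃ α : ℝ → E2, Represents a C ω α ∧ IsCircular ω α |R₁ a| ∧
        ∀ β, Represents a C ω β → CongruentProfiles α β) ∧
    -- (iv)
    (∀ a C ω : ℝ, (a, C, ω) ∈ β₂ →
      ∃ x₁ x₂ x₃ : ℝ, x₁ < x₂ ∧ x₂ < x₃ ∧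
        (∀ r, (q a C).IsRoot r ↔ r = x₁ ∨ r = x₂ ∨ r = x₃) ∧
        (q a C).rootMultiplicity x₁ = 2 ∧ x₁ = R₂ a ^ 2 ∧
      ∃ κ α : ℝ → E2, Represents a C ω κ ∧ Represents a C ω α ∧
        IsCircular ω κ (R₂ a) ∧ (∀ R, ¬ IsCircular ω α R) ∧
        (∃ s₀ s₁, IsFundamentalPiece a C ω α s₀ s₁) ∧
        Set.range (treadmillSled α) = rhoCurve a C ω (Set.Icc x₂ x₃) ∧
        ∀ β, Represents a C ω β → CongruentProfiles κ β ∨ CongruentProfiles α β) ∧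
    -- (v)
    (∀ a C ω : ℝ, (a, C, ω) ∈ β₃ →
      ∃ x₁ x₂ x₃ : ℝ, x₁ < x₂ ∧ x₂ < x₃ ∧
        (∀ r, (q a C).IsRoot r ↔ r = x₁ ∨ r = x₂ ∨ r = x₃) ∧
        (q a C).rootMultiplicity x₂ = 2 ∧ x₂ = R₃ a ^ 2 ∧
      ∃ κ α α' : ℝ → E2,
        Represents a C ω κ ∧ Represents a C ω α ∧ Represents a C ω α' ∧
        ¬ CongruentProfiles α α' ∧
        IsCircular ω κ (R₃ a) ∧
        Set.range (treadmillSled α) = rhoCurve a C ω (Set.Ico x₁ x₂) ∧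
        Set.range (treadmillSled α') = rhoCurve a C ω (Set.Ioc x₂ x₃) ∧
        SpiralsTo α (R₃ a) ∧ SpiralsTo α' (R₃ a) ∧
        ¬ ProperlyImmersed (helicoidal ω α) ∧ ¬ ProperlyImmersed (helicoidal ω α') ∧
        ∀ β, Represents a C ω β → CongruentProfiles κ β ∨ CongruentProfiles α β ∨ CongruentProfiles α' β) ∧
    -- (vi)
    (∀ a C ω : ℝ, (a, C, ω) ∈ cuspPoints →
      (∀ r, (q a C).IsRoot r ↔ r = 9 / 4 ∨ r = 81 / 4) ∧
      (q a C).rootMultiplicity (9 / 4) = 3 ∧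
      ∃ κ α : ℝ → E2, Represents a C ω κ ∧ Represents a C ω α ∧
        IsCircular ω κ (3 / 2) ∧
        Set.range (treadmillSled α) = rhoCurve a C ω (Set.Ioc (9 / 4) (81 / 4)) ∧
        SpiralsTo α (3 / 2) ∧ ¬ ProperlyImmersed (helicoidal ω α) ∧
        ∀ β, Represents a C ω β → CongruentProfiles κ β ∨ CongruentProfiles α β) ∧
    -- (vii)
    (∀ (a ω : ℝ) (α : ℝ → E2), a ≠ 0 → ω ≠ 0 → IsDrop 1 a ω α →
      ∃ (C ω' : ℝ) (α' : ℝ → E2),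
        (a, C, ω') ∈ interior Ω ∪ Ω₂ ∪ β₁ ∪ β₂ ∪ β₃ ∪ cuspPoints ∧
        Represents a C ω' α' ∧
        CongruentImmersions (helicoidal ω α) (helicoidal ω' α')) ∧
    -- (viii)
    (∀ (a C ω : ℝ) (α : ℝ → E2), a ≠ 0 → ω ≠ 0 → Represents a C ω α → ¬ IsExceptional α →
      (∃ R, IsCircular ω α R ∧ ProperlyImmersed (helicoidal ω α)) ∨
      ∃ x₁ x₂ : ℝ, 0 ≤ x₁ ∧ x₁ < x₂ ∧ (q a C).IsRoot x₁ ∧ (q a C).IsRoot x₂ ∧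
        (∀ r ∈ Set.Ioo x₁ x₂, 0 < (q a C).eval r) ∧
        Set.range (treadmillSled α) = rhoCurve a C ω (Set.Icc x₁ x₂) ∧
        IntervalIntegrable (deltaIntegrand a C ω) MeasureTheory.volume x₁ x₂ ∧
        ∃ δ : ℝ,
          δ = (if x₁ = 0 then deltaTheta a C ω x₁ x₂ + Real.pi else deltaTheta a C ω x₁ x₂) ∧
          (∃ s₀ s₁, IsFundamentalPiece a C ω α s₀ s₁ ∧
            ∀ s, α (s + (s₁ - s₀)) = rot δ (α s)) ∧
          ((∃ p : ℚ, deltaTheta a C ω x₁ x₂ / Real.pi = p) →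
            ProperlyImmersed (helicoidal ω α) ∧
            ∃ (m : ℕ) (k : ℤ), 0 < m ∧ IsCoprime k (m : ℤ) ∧ δ = 2 * Real.pi * k / m ∧
              rotZ (2 * Real.pi / m) '' surface ω α = surface ω α) ∧
          (Irrational (deltaTheta a C ω x₁ x₂ / Real.pi) →
            ¬ ProperlyImmersed (helicoidal ω α) ∧
            closure (surface ω α) = {p : E3 | x₁ ≤ p 0 ^ 2 + p 1 ^ 2 ∧
              p 0 ^ 2 + p 1 ^ 2 ≤ x₂})) := by
  refine ⟨fun a C ω => classification_interior, fun a C ω => classification_Ω₂,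
    fun a C ω => classification_β₁, fun a C ω => classification_β₂, fun a C ω => classification_β₃,
    fun a C ω => classification_cusp, fun a ω α ha hω hα => hα.exists_region ha hω,
    fun a C ω α ha _ hα hne => ?_⟩
  rcases hα.circular_or_simpleArc ha hne with hc | ⟨x₁, x₂, A, h0⟩
  · exact Or.inl hc
  · exact Or.inr ⟨x₁, x₂, nonneg_of_q_nonneg A.root₁.ge, A.lt, A.root₁, A.root₂, A.pos,
      A.closed_or_dense ha hα h0⟩
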